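/- Let $n\ge 2$. **Volume.** Let $\mathrm{Vol}_{\mathbb H^3}:\mathbb P(\mathbb C^2)^4\to\mathbb R$ be the signed volume of ideal geodesic simplices of $\mathbb H^3$, where $\partial\mathbb H^3=\mathbb P(\mathbb C^2)$ (degenerate simplices have volume $0$), and let $v_3$ be its maximal value. An ideal simplex is *regular* if its four vertices are distinct and each permutation of them is induced by an isometry of $\mathbb H^3$. **Configurations.** For $k\ge 0$ let $\sigma_k$ be the set of isomorphism classes $[V;(x_0,\dots,x_k)]$ of a finite-dimensional complex vector space $V$ with vectors $x_0,\dots,x_k$ spanning $V$. For a function $f$ on $\sigma_k$ put $$D^*f([V;(x_0,\dots,x_{k+1})])=\sum_{i=0}^{k+1}(-1)^i f([\langle x_j\rangle_{j\ne i};(x_j)_{j\neq i}])-\sum_{i=0}^{k+1}(-1)^i f([V/\langle x_i\rangle;(x_j)_{j\ne i}]).$$ Let $\mathrm{Vol}:\sigma_3\to\mathbb R$ be $\mathrm{Vol}_{\mathbb H^3}(x_0,\dots,x_3)$ on classes $[\mathbb C^2;(x_0,\dots,x_3)]$ with all $x_i\ne0$, and $0$ on all other classes. **Flags.** $\mathcal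 F(\mathbb C^n)$ is the flag manifold of complete flags $F^0\subset F^1\subset\dots\subset F^n$, $\dim F^j=j$. An affine flag is a flag $F$ with vectors $v^1,\dots,v^n$ such that $F^j=\mathbb Cv^j+F^{j-1}$. For a function $f$ on $\sigma_k$ define a function $T_k^*f$ on $(k+1)$-tuples of affine flags in $\mathbb C^n$ by $$T_k^*f\big((F_0,v_0),\dots,(F_k,v_k)\big)=\sum_{(j_0,\dots,j_k)\in\{0,\dots,n-1\}^{k+1}} f\left(\left[\frac{\langle F_0^{j_0+1},\dots,F_k^{j_k+1}\rangle}{\langle F_0^{j_0},\dots,F_k^{j_k}\rangle};(v_0^{j_0+1},\dots,v_k^{j_k+1})\right]\right),$$ and put $B_n=T_3^*\mathrm{Vol}$. Let $\partial^*$ be the usual homogeneous coboundary $\partial^*c(y_0,\dots,y_{k+1})=\sum_i(-1)^ic(y_0,\dots,\widehat{y_i},\dots,y_{k+1})$. Let $\varphi_n:\mathbb P(\mathbb C^2)\to\mathcal F(\mathbb C^n)$ be the Veronese embedding: for $0\le i\le n$, the $(n-i)$-dimensional space of $\varphi_n([x:y])$ has as basis the $n-i$ vectors $\sum_{l=0}^{i}\binom{i}{l}x^{i-l}y^l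 e_{k+l+1}$, $0\le k\le n-i-1$. **Theorem.** 0. $\partial^*T_k^*f=T_{k+1}^*D^*f$ for every $k\ge0$ and every alternating $f:\sigma_k\to\mathbb R$. The function $\mathrm{Vol}$ is alternating and $D^*\mathrm{Vol}=0$. The value of $B_n$ on four affine flags depends only on the underlying flags, so that $B_n$ is a function $\mathcal F(\mathbb C^n)^4\to\mathbb R$. 1. $B_n:\mathcal F(\mathbb C^n)^4\to\mathbb R$ is a Borel function; it is $\mathrm{GL}(n,\mathbb C)$-invariant, alternating, and a strict cocycle, i.e. $\sum_{i=0}^4(-1)^iB_n(F_0,\dots,\widehat{F_i},\dots,F_4)=0$ for all $F_0,\dots,F_4\in\mathcal F(\mathbb C^n)$. 2. For all $F_0,\dots,F_3\in\mathcal F(\mathbb C^n)$, $$|B_n(F_0,\dots,F_3)|\le\frac{n(n^2-1)}{6}\,v_3,$$ with equality if and only if there are $g\in\mathrm{GL}(n,\mathbb C)$ and vertices $\xi_0,\dots,\xi_3\in\mathbb P(\mathbb C^2)$ of a regular ideal simplex with $F_i=g\,\varphi_n(\xi_i)$ for $i=0,\dots,3$. -/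

import Mathlib

open Set MeasureTheory
open scoped Pointwise LinearAlgebra.Projectivization

noncomputable section

namespace BorelCocycle

/-! ## Hyperbolic volume of ideal simplices (hyperboloid model) -/

/-- The Lorentzian quadratic form on `ℝ⁴` with coordinates `(x, y, z, t)`. -/
def lorentz (X : Fin 4 → ℝ) : ℝ := X 3 ^ 2 - X 0 ^ 2 - X 1 ^ 2 - X 2 ^ 2

/-- Hyperbolic 3-space: the upper sheet of the hyperboloid `t² - x² - y² - z² = 1`. -/
def hyperbolicSpace : Set (Fin 4 → ℝ) := {X | lorentz X = 1 ∧ 0 < X 3}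

/-- The hyperbolic (Riemannian) volume of a subset `A` of `hyperbolicSpace`.
The position vector is a unit normal of the hyperboloid, so in polar coordinates `X = r • u`, with
`0 < r` and `u` in the hyperboloid, Lebesgue measure is `r³ dr dvol(u)`. Hence `vol A` is `4` times
the Lebesgue measure of the open cone `{r • u | 0 < r < 1, u ∈ A}`; compare Mathlib's
`MeasureTheory.Measure.toSphere` for the sphere. -/
def hyperbolicVolume (A : Set (Fin 4 → ℝ)) : ENNReal :=
  4 * volume (Ioo (0 : ℝ) 1 • A)

/-- The identification of `P(ℂ²)` with the boundary of hyperbolic space, i.e. with the rays of the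
positive light cone: the line of `v` goes to the ray of the Hermitian matrix
`v v* = !![t + z, x + i y; x - i y, t - z]`, whose determinant is `t² - x² - y² - z²`. -/
def nullVector (v : Fin 2 → ℂ) : Fin 4 → ℝ :=
  ![(v 0).re * (v 1).re + (v 0).im * (v 1).im,
    (v 0).im * (v 1).re - (v 0).re * (v 1).im,
    (Complex.normSq (v 0) - Complex.normSq (v 1)) / 2,
    (Complex.normSq (v 0) + Complex.normSq (v 1)) / 2]

/-- The ideal geodesic simplex with vertices the lines of `v 0, …, v 3`: the part of hyperbolic
space in the convex cone spanned by the corresponding light rays. -/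
def idealSimplex (v : Fin 4 → Fin 2 → ℂ) : Set (Fin 4 → ℝ) :=
  hyperbolicSpace ∩ {X | ∃ s : Fin 4 → ℝ, (∀ i, 0 ≤ s i) ∧ X = ∑ i, s i • nullVector (v i)}

/-- The signed volume of the ideal simplex with vertices `v 0, …, v 3`, as a function of
homogeneous coordinates of the vertices. The sign is the orientation of the vertices; it is
normalised so that `(∞, 0, 1, z)` is positively oriented for `0 < im z`. -/
def idealVolume (v : Fin 4 → Fin 2 → ℂ) : ℝ :=
  SignType.sign (Matrix.of fun i => nullVector (v i)).det *
    (hyperbolicVolume (idealSimplex v)).toReal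

/-- The signed volume `Vol_{ℍ³}` as a function on `P(ℂ²)⁴`. -/
def volH3 (ξ : Fin 4 → ℙ ℂ (Fin 2 → ℂ)) : ℝ := idealVolume fun i => (ξ i).rep

/-- The maximal volume `v₃` of an ideal simplex in hyperbolic 3-space. -/
def v3 : ℝ := sSup (range volH3)

/-- The boundary action of an isometry of hyperbolic 3-space on `P(ℂ²)`: a projective
transformation (orientation preserving) or an anti-projective one (orientation reversing). -/
def IsBoundaryIsometry (f : ℙ ℂ (Fin 2 → ℂ) → ℙ ℂ (Fin 2 → ℂ)) : Prop :=
  (∃ g : (Fin 2 → ℂ) ≃ₗ[ℂ] (Fin 2 → ℂ), f = Projectivization.map g.toLinearMap g.injective) ∨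
  (∃ g : (Fin 2 → ℂ) ≃ₛₗ[starRingEnd ℂ] (Fin 2 → ℂ),
    f = Projectivization.map g.toLinearMap g.injective)

/-- Four points of `P(ℂ²)` are the vertices of a regular ideal simplex: they are distinct and every
permutation of them is induced by an isometry. -/
def IsRegularIdealSimplex (ξ : Fin 4 → ℙ ℂ (Fin 2 → ℂ)) : Prop :=
  Function.Injective ξ ∧
    ∀ σ : Equiv.Perm (Fin 4), ∃ f, IsBoundaryIsometry f ∧ ∀ i, f (ξ i) = ξ (σ i)

/-! ### Invariance of the ideal volume under `GL(2, ℂ)` -/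

/-- The linear automorphism of `ℂⁿ` given by an invertible matrix. -/
def glEquiv {n : ℕ} (g : GL (Fin n) ℂ) : (Fin n → ℂ) ≃ₗ[ℂ] (Fin n → ℂ) :=
  LinearMap.GeneralLinearGroup.generalLinearEquiv ℂ _ (Matrix.GeneralLinearGroup.toLin g)

theorem glEquiv_apply {n : ℕ} (g : GL (Fin n) ℂ) (v : Fin n → ℂ) :
    glEquiv g v = g.1.mulVec v := rfl

/-- The action `X ↦ g X g*` on Hermitian matrices, in coordinates. -/
def lorentzMatrix (g : Matrix (Fin 2) (Fin 2) ℂ) : Matrix (Fin 4) (Fin 4) ℝ :=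
  let a := (g 0 0).re; let a' := (g 0 0).im; let b := (g 0 1).re; let b' := (g 0 1).im
  let c := (g 1 0).re; let c' := (g 1 0).im; let d := (g 1 1).re; let d' := (g 1 1).im
  !![a*d+a'*d'+b*c+b'*c', a*d'-a'*d+b'*c-b*c', a*c+a'*c'-b*d-b'*d', a*c+a'*c'+b*d+b'*d';
     a'*d-a*d'+b'*c-b*c', a*d+a'*d'-b*c-b'*c', a'*c-a*c'-b'*d+b*d', a'*c-a*c'+b'*d-b*d';
     a*b+a'*b'-c*d-c'*d', a*b'-a'*b-c*d'+c'*d,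
      (a^2+a'^2-b^2-b'^2-c^2-c'^2+d^2+d'^2)/2, (a^2+a'^2+b^2+b'^2-c^2-c'^2-d^2-d'^2)/2;
     a*b+a'*b'+c*d+c'*d', a*b'-a'*b+c*d'-c'*d,
      (a^2+a'^2-b^2-b'^2+c^2+c'^2-d^2-d'^2)/2, (a^2+a'^2+b^2+b'^2+c^2+c'^2+d^2+d'^2)/2]

theorem det_lorentzMatrix (g : Matrix (Fin 2) (Fin 2) ℂ) :
    (lorentzMatrix g).det = Complex.normSq g.det ^ 2 := by
  simp [lorentzMatrix, Matrix.det_succ_row_zero, Fin.sum_univ_succ, Fin.succAbove,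
    Complex.normSq_apply]
  ring

theorem lorentzMatrix_mulVec_nullVector (g : Matrix (Fin 2) (Fin 2) ℂ) (v : Fin 2 → ℂ) :
    (lorentzMatrix g).mulVec (nullVector v) = nullVector (g.mulVec v) := by
  ext i
  fin_cases i <;>
  · simp [lorentzMatrix, nullVector, Matrix.mulVec, dotProduct, Fin.sum_univ_succ,
      Complex.normSq_apply]
    ring

theorem lorentz_lorentzMatrix_mulVec (g : Matrix (Fin 2) (Fin 2) ℂ) (X : Fin 4 → ℝ) :
    lorentz ((lorentzMatrix g).mulVec X) = Complex.normSq g.det * lorentz X := by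
  simp [lorentz, lorentzMatrix, Matrix.mulVec, dotProduct, Fin.sum_univ_succ,
    Complex.normSq_apply, Matrix.det_fin_two]
  ring

theorem lorentz_smul (r : ℝ) (X : Fin 4 → ℝ) : lorentz (r • X) = r ^ 2 * lorentz X := by
  simp [lorentz]; ring

theorem nullVector_nonneg (v : Fin 2 → ℂ) : 0 ≤ nullVector v 3 := by
  simp only [nullVector, Matrix.cons_val]
  have := Complex.normSq_nonneg (v 0)
  have := Complex.normSq_nonneg (v 1)
  positivity

theorem mem_cone_idealSimplex (v : Fin 4 → Fin 2 → ℂ) (Y : Fin 4 → ℝ) :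
    Y ∈ Ioo (0 : ℝ) 1 • idealSimplex v ↔
      (0 < lorentz Y ∧ lorentz Y < 1) ∧
        ∃ s : Fin 4 → ℝ, (∀ i, 0 ≤ s i) ∧ Y = ∑ i, s i • nullVector (v i) := by
  constructor
  · rintro ⟨r, ⟨hr0, hr1⟩, X, ⟨⟨hX, -⟩, s, hs, rfl⟩, rfl⟩
    refine ⟨?_, fun i => r * s i, fun i => mul_nonneg hr0.le (hs i), ?_⟩
    · simp only [lorentz_smul, hX]
      constructor
      · positivity
      · nlinarith
    · simp [Finset.smul_sum, mul_smul]
  · rintro ⟨⟨h0, h1⟩, s, hs, rfl⟩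
    set Y := ∑ i, s i • nullVector (v i) with hY
    have hr : 0 < √(lorentz Y) := Real.sqrt_pos.2 h0
    refine ⟨√(lorentz Y), ⟨hr, ?_⟩, (√(lorentz Y))⁻¹ • Y, ⟨⟨?_, ?_⟩, ?_⟩, ?_⟩
    · rw [Real.sqrt_lt' one_pos]; simpa using h1
    · rw [lorentz_smul, inv_pow, Real.sq_sqrt h0.le, inv_mul_cancel₀ h0.ne']
    · have h3 : 0 ≤ Y 3 := by
        rw [hY, Finset.sum_apply]
        exact Finset.sum_nonneg fun i _ => mul_nonneg (hs i) (nullVector_nonneg _)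
      have : Y 3 ≠ 0 := by
        intro h
        simp only [lorentz, h] at h0
        nlinarith [sq_nonneg (Y 0), sq_nonneg (Y 1), sq_nonneg (Y 2)]
      have : 0 < Y 3 := lt_of_le_of_ne h3 this.symm
      simp only [Pi.smul_apply, smul_eq_mul]
      positivity
    · refine ⟨fun i => (√(lorentz Y))⁻¹ * s i, fun i => mul_nonneg (by positivity) (hs i), ?_⟩
      simp [hY, Finset.smul_sum, mul_smul]
    · simp [smul_smul, hr.ne']

theorem idealVolume_mulVec (g : GL (Fin 2) ℂ) (v : Fin 4 → Fin 2 → ℂ) :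
    idealVolume (fun i => g.1.mulVec (v i)) = idealVolume v := by
  set M := lorentzMatrix g.1 with hM
  set c := Complex.normSq g.1.det with hc
  have hdet : g.1.det ≠ 0 := by
    have := (Matrix.isUnit_iff_isUnit_det _).1 g.isUnit
    exact this.ne_zero
  have hc0 : 0 < c := Complex.normSq_pos.2 hdet
  have hMdet : M.det = c ^ 2 := det_lorentzMatrix _
  have hsign : SignType.sign (Matrix.of fun i => nullVector (g.1.mulVec (v i))).det =
      SignType.sign (Matrix.of fun i => nullVector (v i)).det := by
    have : (Matrix.of fun i => nullVector (g.1.mulVec (v i))) =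
        (Matrix.of fun i => nullVector (v i)) * M.transpose := by
      ext i j
      rw [Matrix.of_apply, ← lorentzMatrix_mulVec_nullVector, Matrix.mul_apply]
      simp only [Matrix.mulVec, dotProduct, Matrix.of_apply, Matrix.transpose_apply, hM]
      exact Finset.sum_congr rfl fun _ _ => mul_comm _ _
    rw [this, Matrix.det_mul, Matrix.det_transpose, sign_mul, hMdet,
      sign_pos (by positivity : 0 < c ^ 2), mul_one]
  have hset : (Matrix.toLin' M) '' (Ioo (0 : ℝ) 1 • idealSimplex v) =
      √c • (Ioo (0 : ℝ) 1 • idealSimplex fun i => g.1.mulVec (v i)) := by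
    have hs : 0 < √c := Real.sqrt_pos.2 hc0
    have key : ∀ s : Fin 4 → ℝ, Matrix.toLin' M (∑ i, s i • nullVector (v i)) =
        ∑ i, s i • nullVector (g.1.mulVec (v i)) := by
      intro s
      simp [map_sum, Matrix.toLin'_apply, hM,
        lorentzMatrix_mulVec_nullVector]
    have key2 : ∀ X, lorentz (Matrix.toLin' M X) = c * lorentz X := fun X => by
      rw [Matrix.toLin'_apply]; exact lorentz_lorentzMatrix_mulVec _ _
    ext Y
    rw [mem_smul_set_iff_inv_smul_mem₀ hs.ne', mem_cone_idealSimplex]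
    constructor
    · rintro ⟨X, hX, rfl⟩
      obtain ⟨h, s, hs0, rfl⟩ := (mem_cone_idealSimplex _ _).1 hX
      refine ⟨?_, fun i => (√c)⁻¹ * s i, fun i => mul_nonneg (by positivity) (hs0 i), ?_⟩
      · rw [lorentz_smul, key2, inv_pow, Real.sq_sqrt hc0.le, inv_mul_cancel_left₀ hc0.ne']
        exact h
      · simp [key, Finset.smul_sum, mul_smul]
    · rintro ⟨h, s, hs0, hY⟩
      have hY' : Y = Matrix.toLin' M (∑ i, (√c * s i) • nullVector (v i)) := by
        rw [key, (inv_smul_eq_iff₀ hs.ne').1 hY]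
        simp [Finset.smul_sum, mul_smul]
      refine ⟨_, (mem_cone_idealSimplex _ _).2 ⟨?_, fun i => √c * s i,
        fun i => mul_nonneg hs.le (hs0 i), rfl⟩, hY'.symm⟩
      rw [lorentz_smul, hY', key2, inv_pow, Real.sq_sqrt hc0.le,
        inv_mul_cancel_left₀ hc0.ne'] at h
      exact h
  have hvol : volume (Ioo (0 : ℝ) 1 • idealSimplex fun i => g.1.mulVec (v i)) =
      volume (Ioo (0 : ℝ) 1 • idealSimplex v) := by
    have h := congrArg volume hset
    rw [Measure.addHaar_image_linearMap, Measure.addHaar_smul, LinearMap.det_toLin', hMdet] at h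
    have h4 : √c ^ Module.finrank ℝ (Fin 4 → ℝ) = c ^ 2 := by
      rw [Module.finrank_fin_fun, show (4 : ℕ) = 2 * 2 from rfl, pow_mul, Real.sq_sqrt hc0.le]
    rw [h4] at h
    refine ((ENNReal.mul_right_inj ?_ ENNReal.ofReal_ne_top).1 h).symm
    have : 0 < |c ^ 2| := by positivity
    simpa using hc0.ne'
  simp only [idealVolume, hyperbolicVolume, hsign, hvol]

/-! ## Configurations of vectors -/

/-- `(k+1)`-tuples of vectors spanning `ℂᵐ`. -/
abbrev Spanning (k m : ℕ) : Type :=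
  {x : Fin (k + 1) → Fin m → ℂ // Submodule.span ℂ (range x) = ⊤}

/-- Two spanning tuples are equivalent if they differ by the diagonal action of `GL(m, ℂ)`. -/
def spanningSetoid (k m : ℕ) : Setoid (Spanning k m) where
  r x y := ∃ g : GL (Fin m) ℂ, ∀ i, glEquiv g (x.1 i) = y.1 i
  iseqv :=
    { refl := fun x => ⟨1, fun i => by simp [glEquiv_apply]⟩
      symm := by
        rintro x y ⟨g, hg⟩
        refine ⟨g⁻¹, fun i => ?_⟩
        rw [← hg i, glEquiv_apply, glEquiv_apply, Matrix.mulVec_mulVec, ← Units.val_mul]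
        simp
      trans := by
        rintro x y z ⟨g, hg⟩ ⟨h, hh⟩
        refine ⟨h * g, fun i => ?_⟩
        rw [← hh i, ← hg i, glEquiv_apply, glEquiv_apply, glEquiv_apply, Matrix.mulVec_mulVec,
          ← Units.val_mul] }

/-- The configuration space `σ_k`, the disjoint union over `m` of the spaces `σ_k(m)` of spanning
`(k+1)`-tuples in `ℂᵐ` modulo `GL(m, ℂ)`. -/
def Config (k : ℕ) : Type := Σ m : ℕ, Quotient (spanningSetoid k m)

/-- The class of a spanning tuple of `ℂᵐ`. -/
def Config.mk {k m : ℕ} (x : Spanning k m) : Config k := ⟨m, Quotient.mk (spanningSetoid k m) x⟩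

section Class

variable {k : ℕ} {V W : Type*} [AddCommGroup V] [Module ℂ V] [AddCommGroup W] [Module ℂ W]

instance finiteDimensional_span_range (x : Fin (k + 1) → V) :
    FiniteDimensional ℂ (Submodule.span ℂ (range x)) :=
  FiniteDimensional.span_of_finite ℂ (finite_range x)

/-- The coordinates of the vectors `x i` in a basis of their span. -/
def spanCoord (x : Fin (k + 1) → V) :
    Spanning k (Module.finrank ℂ (Submodule.span ℂ (range x))) :=
  ⟨fun i => (Module.finBasis ℂ (Submodule.span ℂ (range x))).equivFun
      ⟨x i, Submodule.subset_span (mem_range_self i)⟩, by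
    set b := (Module.finBasis ℂ (Submodule.span ℂ (range x))).equivFun
    have h : Submodule.span ℂ (range fun i =>
        (⟨x i, Submodule.subset_span (mem_range_self i)⟩ : Submodule.span ℂ (range x))) = ⊤ := by
      have := Submodule.span_span_coe_preimage (R := ℂ) (s := range x)
      rw [← this]
      congr 1
      ext ⟨y, hy⟩
      simp
    have h2 := congrArg (Submodule.map b.toLinearMap) h
    rw [Submodule.map_span, ← range_comp, Submodule.map_top, LinearEquiv.range] at h2
    exact h2⟩

/-- The class `[⟨x₀,…,x_k⟩; (x₀,…,x_k)]` in `σ_k` of the span of vectors `x₀,…,x_k` of an arbitrary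
complex vector space, obtained by choosing an isomorphism of the span with some `ℂᵐ`. -/
def Config.of (x : Fin (k + 1) → V) : Config k := Config.mk (spanCoord x)

theorem Config.mk_eq_mk {m m' : ℕ} (x : Spanning k m) (y : Spanning k m')
    (e : (Fin m → ℂ) ≃ₗ[ℂ] (Fin m' → ℂ)) (he : ∀ i, e (x.1 i) = y.1 i) :
    Config.mk x = Config.mk y := by
  have hm : m = m' := by simpa using e.finrank_eq
  subst hm
  refine congrArg (Sigma.mk m) (Quotient.sound ?_)
  refine ⟨Matrix.GeneralLinearGroup.toLin.symm
    ((LinearMap.GeneralLinearGroup.generalLinearEquiv ℂ _).symm e), fun i => ?_⟩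
  rw [← he i]
  simp [glEquiv]

/-- The class depends only on the linear relations between the vectors. -/
theorem Config.of_eq_of (x : Fin (k + 1) → V) (y : Fin (k + 1) → W)
    (h : ∀ c : Fin (k + 1) → ℂ, ∑ i, c i • x i = 0 ↔ ∑ i, c i • y i = 0) :
    Config.of x = Config.of y := by
  have hk : LinearMap.ker (Fintype.linearCombination ℂ x) =
      LinearMap.ker (Fintype.linearCombination ℂ y) := by
    ext c
    simp [Fintype.linearCombination_apply, h]
  have hx := Fintype.range_linearCombination ℂ x
  have hy := Fintype.range_linearCombination ℂ y
  let e : Submodule.span ℂ (range x) ≃ₗ[ℂ] Submodule.span ℂ (range y) :=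
    (LinearEquiv.ofEq _ _ hx.symm).trans <|
    (LinearMap.quotKerEquivRange _).symm.trans <|
    (Submodule.quotEquivOfEq _ _ hk).trans <|
    (LinearMap.quotKerEquivRange _).trans (LinearEquiv.ofEq _ _ hy)
  have he : ∀ i, e ⟨x i, Submodule.subset_span (mem_range_self i)⟩ =
      ⟨y i, Submodule.subset_span (mem_range_self i)⟩ := by
    intro i
    have h1 : (LinearEquiv.ofEq _ _ hx.symm)
        ⟨x i, Submodule.subset_span (mem_range_self i)⟩ =
        LinearMap.quotKerEquivRange (Fintype.linearCombination ℂ x)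
          (Submodule.Quotient.mk (Pi.single i 1)) := by
      ext
      simp [LinearMap.quotKerEquivRange_apply_mk]
    simp only [e, LinearEquiv.trans_apply, h1, LinearEquiv.symm_apply_apply]
    ext
    simp [LinearMap.quotKerEquivRange_apply_mk]
  refine Config.mk_eq_mk _ _ ((Module.finBasis ℂ _).equivFun.symm.trans
    (e.trans (Module.finBasis ℂ _).equivFun)) fun i => ?_
  simp [spanCoord, he]

theorem Config.of_map (x : Fin (k + 1) → V) (e : V ≃ₗ[ℂ] W) :
    Config.of (fun i => e (x i)) = Config.of x := by
  refine Config.of_eq_of _ _ fun c => ?_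
  rw [← e.map_eq_zero_iff (x := ∑ i, c i • x i)]
  simp [map_sum]

end Class

/-- The action of permutations of `{0,…,k}` on `σ_k`. -/
def Config.perm {k : ℕ} (σ : Equiv.Perm (Fin (k + 1))) (τ : Config k) : Config k :=
  Quotient.lift (s := spanningSetoid k τ.1) (fun x => Config.of fun i => x.1 (σ i))
    (by
      rintro x y ⟨g, hg⟩
      simp only [← hg]
      exact (Config.of_map _ _).symm) τ.2

/-- The face map `ε_i : σ_{k+1} → σ_k`, which drops the `i`-th vector and restricts to the span of
the others. -/
def Config.eps {k : ℕ} (i : Fin (k + 2)) (τ : Config (k + 1)) : Config k :=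
  Quotient.lift (s := spanningSetoid (k + 1) τ.1) (fun x => Config.of fun j => x.1 (i.succAbove j))
    (by
      rintro x y ⟨g, hg⟩
      simp only [← hg]
      exact (Config.of_map _ _).symm) τ.2

/-- The face map `η_i : σ_{k+1} → σ_k`, which projects the other vectors to the quotient by the
`i`-th one. -/
def Config.eta {k : ℕ} (i : Fin (k + 2)) (τ : Config (k + 1)) : Config k :=
  Quotient.lift (s := spanningSetoid (k + 1) τ.1)
    (fun x => Config.of fun j => (Submodule.span ℂ {x.1 i}).mkQ (x.1 (i.succAbove j)))
    (by
      rintro x y ⟨g, hg⟩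
      have hs : (Submodule.span ℂ {x.1 i}).map (glEquiv g).toLinearMap =
          Submodule.span ℂ {y.1 i} := by
        rw [Submodule.map_span, image_singleton, ← hg i]; rfl
      rw [← Config.of_map _ (Submodule.Quotient.equiv _ _ (glEquiv g) hs)]
      simp [← hg]) τ.2

/-- Real functions on `σ_k` that are alternating under permutations. -/
def IsAltConfig {k : ℕ} (f : Config k → ℝ) : Prop :=
  ∀ (σ : Equiv.Perm (Fin (k + 1))) (τ : Config k),
    f (τ.perm σ) = ((Equiv.Perm.sign σ : ℤ) : ℝ) * f τ

/-- The coboundary `D*` dual to `D = ∑ (-1)^i ε_i - ∑ (-1)^i η_i`. -/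
def configD {k : ℕ} (f : Config k → ℝ) (τ : Config (k + 1)) : ℝ :=
  ∑ i : Fin (k + 2), (-1) ^ (i : ℕ) * f (τ.eps i) - ∑ i : Fin (k + 2), (-1) ^ (i : ℕ) * f (τ.eta i)

open Classical in
/-- The function `Vol` on `σ_3`: the signed volume of the ideal simplex on `σ_3(2)` when no vector
vanishes, and zero otherwise. -/
def Vol : Config 3 → ℝ
  | ⟨2, τ⟩ => Quotient.lift (s := spanningSetoid 3 2)
      (fun x => if ∀ i, x.1 i ≠ 0 then idealVolume x.1 else 0)
      (by
        rintro x y ⟨g, hg⟩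
        have h : y.1 = fun i => g.1.mulVec (x.1 i) := funext fun i => (hg i).symm
        have h0 : (∀ i, y.1 i ≠ 0) ↔ ∀ i, x.1 i ≠ 0 := by simp [← hg]
        simp only [h0]
        rw [h, idealVolume_mulVec]) τ
  | ⟨_, _⟩ => 0

/-! ## Flags -/

/-- Complete flags `F⁰ ⊂ F¹ ⊂ … ⊂ Fⁿ` in `ℂⁿ`. -/
@[ext]
structure CFlag (n : ℕ) where
  space : Fin (n + 1) → Submodule ℂ (Fin n → ℂ)
  mono : Monotone space
  finrank_space : ∀ j, Module.finrank ℂ (space j) = j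

/-- The action of `GL(n, ℂ)` on flags. -/
instance (n : ℕ) : SMul (GL (Fin n) ℂ) (CFlag n) where
  smul g F :=
    { space := fun j => (F.space j).map (glEquiv g).toLinearMap
      mono := fun _ _ h => Submodule.map_mono (F.mono h)
      finrank_space := fun j => by
        rw [← F.finrank_space j]; exact LinearEquiv.finrank_map_eq _ _ }

/-- Affine flags `(F, v)`; `v j` is the vector usually written `v^{j+1}`. -/
structure AffineFlag (n : ℕ) extends CFlag n where
  v : Fin n → Fin n → ℂ
  space_succ : ∀ j : Fin n, space j.succ = Submodule.span ℂ {v j} ⊔ space j.castSucc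

theorem exists_affineFlag {n : ℕ} (F : CFlag n) : ∃ A : AffineFlag n, A.toCFlag = F := by
  have h : ∀ j : Fin n, ∃ v, F.space j.succ = Submodule.span ℂ {v} ⊔ F.space j.castSucc := by
    intro j
    have hle : F.space j.castSucc ≤ F.space j.succ := F.mono (Fin.castSucc_le_succ j)
    have h1 := F.finrank_space j.castSucc
    have h2 := F.finrank_space j.succ
    simp only [Fin.val_castSucc, Fin.val_succ] at h1 h2
    have hlt : F.space j.castSucc < F.space j.succ := by
      refine lt_of_le_of_ne hle fun h => ?_
      rw [h] at h1; omega
    obtain ⟨v, hv, hv'⟩ := SetLike.exists_of_lt hlt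
    refine ⟨v, (Submodule.eq_of_le_of_finrank_le ?_ ?_).symm⟩
    · exact sup_le (by simpa using hv) hle
    · have : F.space j.castSucc < Submodule.span ℂ {v} ⊔ F.space j.castSucc := by
        refine lt_of_le_of_ne le_sup_right fun h => hv' ?_
        rw [h]
        exact Submodule.mem_sup_left (Submodule.mem_span_singleton_self v)
      have := Submodule.finrank_lt_finrank_of_lt this
      omega
  choose v hv using h
  exact ⟨⟨F, v, hv⟩, rfl⟩

/-- The flag of a basis of `ℂⁿ`. -/
def CFlag.ofBasis {n : ℕ} (b : Module.Basis (Fin n) ℂ (Fin n → ℂ)) : CFlag n where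
  space := b.flag
  mono := b.flag_mono
  finrank_space := fun j => by
    have hli : LinearIndependent ℂ fun i : {i : Fin n // i.castSucc < j} => b i :=
      b.linearIndependent.comp _ Subtype.val_injective
    have h := finrank_span_eq_card hli
    have h2 : b.flag j = Submodule.span ℂ (range fun i : {i : Fin n // i.castSucc < j} => b i) := by
      rw [Module.Basis.flag, image_eq_range]; rfl
    rw [h2, h, Fintype.card_subtype]
    have : (Finset.univ.filter fun i : Fin n => i.castSucc < j) =
        Finset.univ.filter fun i : Fin n => (i : ℕ) < j := rfl
    rw [this, Fin.card_filter_val_lt]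
    have := j.2
    omega

/-- The flag whose `j`-th space is spanned by the first `j` columns of an invertible matrix. -/
def CFlag.ofGL {n : ℕ} (g : GL (Fin n) ℂ) : CFlag n :=
  CFlag.ofBasis ((Pi.basisFun ℂ (Fin n)).map (glEquiv g))

/-- The topology of the flag manifold, as the quotient of `GL(n, ℂ)` by the stabiliser of the
standard flag. -/
instance (n : ℕ) : TopologicalSpace (CFlag n) :=
  TopologicalSpace.coinduced (CFlag.ofGL (n := n)) inferInstance

instance (n : ℕ) : MeasurableSpace (CFlag n) := borel _

instance (n : ℕ) : BorelSpace (CFlag n) := ⟨rfl⟩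

/-! ## The Veronese embedding -/

/-- The `k`-th vector `(0,…,0, x^i, i x^{i-1} y, …, C(i,l) x^{i-l} y^l, …, y^i, 0,…,0)` (with `k`
leading zeros) of the basis of the `(n-i)`-dimensional space of the Veronese flag of `[x : y]`. -/
def veroneseVector (n i : ℕ) (p : Fin 2 → ℂ) (k : ℕ) : Fin n → ℂ := fun m =>
  if k ≤ m then (i.choose (m - k) : ℂ) * p 0 ^ (i - (m - k)) * p 1 ^ ((m : ℕ) - k) else 0

/-- The `j`-dimensional space of the Veronese flag of the point with homogeneous coordinates `p`. -/
def veroneseSpace (n : ℕ) (p : Fin 2 → ℂ) (j : ℕ) : Submodule ℂ (Fin n → ℂ) :=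
  Submodule.span ℂ (veroneseVector n (n - j) p '' {k | k < j})

theorem veroneseVector_succ (n i : ℕ) (p : Fin 2 → ℂ) (k : ℕ) :
    veroneseVector n (i + 1) p k =
      p 0 • veroneseVector n i p k + p 1 • veroneseVector n i p (k + 1) := by
  ext m
  simp only [veroneseVector, Pi.add_apply, Pi.smul_apply, smul_eq_mul]
  by_cases h : k ≤ m
  · obtain ⟨l, hl⟩ := Nat.exists_eq_add_of_le h
    rcases l with _ | l
    · have h1 : (m : ℕ) - k = 0 := by omega
      have h2 : ¬ k + 1 ≤ m := by omega
      simp [h, h1, h2]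
      ring
    · have h1 : (m : ℕ) - k = l + 1 := by omega
      have h2 : k + 1 ≤ m := by omega
      have h3 : (m : ℕ) - (k + 1) = l := by omega
      simp only [h, h1, h2, h3, if_true, Nat.choose_succ_succ, Nat.add_sub_add_right]
      push_cast
      rcases lt_or_ge l i with hi | hi
      · have : i - l = i - (l + 1) + 1 := by omega
        rw [this]; ring
      · rw [Nat.choose_eq_zero_of_lt (show i < l + 1 by omega)]
        push_cast
        ring
  · have h2 : ¬ k + 1 ≤ m := by omega
    simp [h, h2]

theorem veroneseSpace_le_succ {n : ℕ} (p : Fin 2 → ℂ) {j : ℕ} (hj : j < n) :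
    veroneseSpace n p j ≤ veroneseSpace n p (j + 1) := by
  rw [veroneseSpace, Submodule.span_le]
  rintro _ ⟨k, hk, rfl⟩
  have hk : k < j := hk
  rw [show n - j = n - (j + 1) + 1 by omega, veroneseVector_succ]
  refine Submodule.add_mem _ (Submodule.smul_mem _ _ (Submodule.subset_span ⟨k, ?_, rfl⟩))
    (Submodule.smul_mem _ _ (Submodule.subset_span ⟨k + 1, ?_, rfl⟩))
  · show k < j + 1; omega
  · show k + 1 < j + 1; omega

theorem finrank_veroneseSpace_succ_le {n : ℕ} {p : Fin 2 → ℂ} (hp : p ≠ 0) {j : ℕ} (hj : j < n) :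
    Module.finrank ℂ (veroneseSpace n p (j + 1)) ≤ Module.finrank ℂ (veroneseSpace n p j) + 1 := by
  have hmem : ∀ k < j, p 0 • veroneseVector n (n - (j + 1)) p k +
      p 1 • veroneseVector n (n - (j + 1)) p (k + 1) ∈ veroneseSpace n p j := by
    intro k hk
    rw [← veroneseVector_succ, show n - (j + 1) + 1 = n - j by omega]
    exact Submodule.subset_span ⟨k, hk, rfl⟩
  suffices h : ∃ w, veroneseSpace n p (j + 1) ≤ veroneseSpace n p j ⊔ Submodule.span ℂ {w} by
    obtain ⟨w, hw⟩ := h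
    refine (Submodule.finrank_mono hw).trans
      ((Submodule.finrank_add_le_finrank_add_finrank _ _).trans ?_)
    gcongr
    simpa using finrank_span_le_card (R := ℂ) ({w} : Set (Fin n → ℂ))
  by_cases h1 : p 1 = 0
  · have h0 : p 0 ≠ 0 := by
      intro h0
      apply hp
      ext i
      fin_cases i <;> simp [h0, h1]
    refine ⟨veroneseVector n (n - (j + 1)) p j, ?_⟩
    rw [veroneseSpace, Submodule.span_le]
    rintro _ ⟨k, hk, rfl⟩
    have hk : k < j + 1 := hk
    rcases Nat.lt_succ_iff_lt_or_eq.1 hk with hk | rfl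
    · have := hmem k hk
      rw [h1, zero_smul, add_zero] at this
      exact Submodule.mem_sup_left ((Submodule.smul_mem_iff _ h0).1 this)
    · exact Submodule.mem_sup_right (Submodule.mem_span_singleton_self _)
  · refine ⟨veroneseVector n (n - (j + 1)) p 0, ?_⟩
    rw [veroneseSpace, Submodule.span_le]
    rintro _ ⟨k, hk, rfl⟩
    have hk : k < j + 1 := hk
    induction k with
    | zero => exact Submodule.mem_sup_right (Submodule.mem_span_singleton_self _)
    | succ k ih =>
      have h2 := ih (by show k < j + 1; omega) (by omega)
      have h3 := Submodule.mem_sup_left (T := Submodule.span ℂ {veroneseVector n (n - (j + 1)) p 0})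
        (hmem k (by omega))
      refine (Submodule.smul_mem_iff _ h1).1 ?_
      exact (Submodule.add_mem_iff_right _ (Submodule.smul_mem _ _ h2)).1 h3

theorem veroneseSpace_top (n : ℕ) (p : Fin 2 → ℂ) : veroneseSpace n p n = ⊤ := by
  rw [eq_top_iff, ← (Pi.basisFun ℂ (Fin n)).span_eq, Submodule.span_le]
  rintro _ ⟨i, rfl⟩
  refine Submodule.subset_span ⟨i, i.2, ?_⟩
  ext m
  simp only [veroneseVector, Nat.sub_self, Pi.basisFun_apply, Pi.single_apply]
  by_cases h : m = i
  · simp [h]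
  · by_cases h' : (i : ℕ) ≤ m
    · have : (m : ℕ) - i ≠ 0 := by
        have : (m : ℕ) ≠ i := fun h2 => h (Fin.ext h2)
        omega
      simp [h, h', Nat.choose_eq_zero_of_lt (Nat.pos_of_ne_zero this)]
    · simp [h, h']

theorem finrank_veroneseSpace {n : ℕ} {p : Fin 2 → ℂ} (hp : p ≠ 0) {j : ℕ} (hj : j ≤ n) :
    Module.finrank ℂ (veroneseSpace n p j) = j := by
  have hup : ∀ j, j ≤ n → Module.finrank ℂ (veroneseSpace n p j) ≤ j := by
    intro j
    induction j with
    | zero =>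
      intro _
      have : {k : ℕ | k < 0} = ∅ := by ext; simp
      rw [veroneseSpace, this]
      simp
    | succ j ih =>
      intro h
      have := finrank_veroneseSpace_succ_le hp (show j < n by omega)
      have := ih (by omega)
      omega
  have hdown : ∀ d, d ≤ n → n - d ≤ Module.finrank ℂ (veroneseSpace n p (n - d)) := by
    intro d
    induction d with
    | zero =>
      intro _
      rw [Nat.sub_zero, veroneseSpace_top]
      simp
    | succ d ih =>
      intro h
      have h1 := finrank_veroneseSpace_succ_le hp (show n - (d + 1) < n by omega)
      rw [show n - (d + 1) + 1 = n - d by omega] at h1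
      have := ih (by omega)
      omega
  have := hdown (n - j) (by omega)
  rw [show n - (n - j) = j by omega] at this
  exact le_antisymm (hup j hj) this

/-- The Veronese embedding `P(ℂ²) → F(ℂⁿ)`. -/
def veronese (n : ℕ) (ξ : ℙ ℂ (Fin 2 → ℂ)) : CFlag n where
  space := fun j => veroneseSpace n ξ.rep j
  mono := Fin.monotone_iff_le_succ.2 fun i => veroneseSpace_le_succ _ i.2
  finrank_space := fun j => finrank_veroneseSpace ξ.rep_nonzero (Nat.lt_succ_iff.1 j.2)

/-! ## The cocycle -/

/-- The configuration
`t_J = [⟨F_0^{j_0+1},…,F_k^{j_k+1}⟩ / ⟨F_0^{j_0},…,F_k^{j_k}⟩; (v_0^{j_0+1},…,v_k^{j_k+1})]`.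
The numerator modulo the denominator is the span of the vectors `v_i^{j_i+1}` in the quotient of
`ℂⁿ` by the denominator. -/
def tConfig {n k : ℕ} (J : Fin (k + 1) → Fin n) (A : Fin (k + 1) → AffineFlag n) : Config k :=
  Config.of fun i => (⨆ l, (A l).space (J l).castSucc).mkQ ((A i).v (J i))

/-- The map `T*_k` from functions on `σ_k` to functions on `(k+1)`-tuples of affine flags, dual to
`T_k = ∑_J t_J`. -/
def pullT (n : ℕ) {k : ℕ} (f : Config k → ℝ) (A : Fin (k + 1) → AffineFlag n) : ℝ :=
  ∑ J : Fin (k + 1) → Fin n, f (tConfig J A)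

/-- The homogeneous coboundary `∂*` on functions of tuples in a set `X`. -/
def coboundary {X : Type*} {k : ℕ} (c : (Fin (k + 1) → X) → ℝ) (x : Fin (k + 2) → X) : ℝ :=
  ∑ i : Fin (k + 2), (-1) ^ (i : ℕ) * c fun j => x (i.succAbove j)

/-- The function `B_n = T*_3 Vol` on 4-tuples of affine flags. -/
def borelAffine (n : ℕ) : (Fin 4 → AffineFlag n) → ℝ := pullT n Vol

/-- The function `B_n` on 4-tuples of flags: the value of `B_n` on affine flags lifting them. -/
def borelCocycle (n : ℕ) (F : Fin 4 → CFlag n) : ℝ :=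
  borelAffine n fun i => (exists_affineFlag (F i)).choose

end BorelCocycle

end

open Set MeasureTheory
open scoped Pointwise LinearAlgebra.Projectivization

noncomputable section

namespace BorelCocycle

/-! ## Linear relations and the face maps -/

section Relations

variable {k : ℕ} {V : Type*} [AddCommGroup V] [Module ℂ V]

/-! A class in `Config` is determined by the linear relations among its vectors (`Config.of_eq_of`),
so faces, permutations and iterated quotients are all computed on relations. Fix the indices of all
flags but one: the faces of the two kinds are then consecutive terms of a single sequence in the
remaining index. The sum telescopes to the term with that flag omitted minus the zero class, and the
zero classes drop out for alternating functions (`coboundary_pullT`).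

That `Vol` is a cocycle (`configD_Vol`) is, in rank two, the five-term relation for ideal simplices
(`sum_idealVolume_succAbove`). In rank three it is the same relation for the Gale dual
configuration, because Gale duality preserves cross ratios (`idealVolume_eq_of_gale`). In the
degenerate cases the faces vanish or cancel in pairs.

For the vertices `∞, 0, 1, z` the coordinates given by the four light rays turn the volume into an
explicit integral. At fixed argument of `z` it strictly decreases in `‖z‖ + 1/‖z‖`, so it grows when
`z` is replaced by `z/‖z‖`. Alternating this step with a rotation of three vertices drives the angle
to `π/3`; hence the regular simplex is the only maximum up to orientation
(`abs_idealVolume_normalForm_eq_iff`).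

For the bound, a multi-index with nonzero volume can be recovered from the dimensions of the partial
sums of the spaces it selects (`dimCode_injOn`). These dimensions encode a composition of `n - 2`
into four nonnegative parts, and there are `n(n²-1)/6` of those; each term is at most `v3` in
absolute value.

In the case of equality every composition occurs. This forces the flags into general position, so
that all indices `(p, q, m, 0)` and `(p, q, 0, m)` of sum `n - 2` contribute
(`IsMaximal.spVol_ne_zero`), each with the same value `s = ±v3`. The linear group is transitive on
two flags and a line in such position (`exists_gl_map_eq`), and the known cross ratios then
determine the third and the fourth flag one dimension at a time (`sp_two_succ_eq`). So the quadruple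
is unique up to a linear automorphism once `s` is given (`exists_smul_eq_of_spVol_eq`).

Veronese quadruples supply the model. Viewing `ℂⁿ` as binary forms, polar derivations project the
quotient for every index of sum `n - 2` onto `ℂ²` with the original four points
(`exists_veronese_projection`). Each such index therefore contributes exactly the volume of the
original simplex.

Measurability is checked on matrices, where linear algebra is explicit through Gram determinants and
orthogonal projections. It descends along the Borel surjection from four invertible matrices to four
flags (`measurable_borelCocycle`). -/

theorem sum_spanCoord_eq_zero_iff (x : Fin (k + 1) → V) (c : Fin (k + 1) → ℂ) :
    ∑ i, c i • (spanCoord x).1 i = 0 ↔ ∑ i, c i • x i = 0 := by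
  have h : ∑ i, c i • (spanCoord x).1 i =
      (Module.finBasis ℂ (Submodule.span ℂ (range x))).equivFun
        (∑ i, c i • ⟨x i, Submodule.subset_span (mem_range_self i)⟩) := by
    rw [map_sum]
    simp only [map_smul]
    rfl
  rw [h, LinearEquiv.map_eq_zero_iff, ← Subtype.coe_inj]
  simp

theorem sum_succAbove_smul (x : Fin (k + 2) → V) (i : Fin (k + 2)) (c : Fin (k + 1) → ℂ) :
    ∑ j, c j • x (i.succAbove j) = ∑ l, (i.insertNth (α := fun _ => ℂ) 0 c) l • x l := by
  rw [Fin.sum_univ_succAbove _ i]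
  simp

/-- A relation modulo `x i` lifts by moving the multiple of `x i` to the other side. Passing to the
quotient thus leaves the `i`-th coefficient free, whereas dropping the vector forces it to be zero.
-/
theorem sum_smul_mkQ_eq_zero_iff (x : Fin (k + 2) → V) (i : Fin (k + 2)) (c : Fin (k + 1) → ℂ) :
    ∑ j, c j • (Submodule.span ℂ {x i}).mkQ (x (i.succAbove j)) = 0 ↔
      ∃ a : ℂ, ∑ l, (i.insertNth (α := fun _ => ℂ) a c) l • x l = 0 := by
  have h : ∑ j, c j • (Submodule.span ℂ {x i}).mkQ (x (i.succAbove j)) =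
      (Submodule.span ℂ {x i}).mkQ (∑ j, c j • x (i.succAbove j)) := by simp [map_sum]
  rw [h, Submodule.mkQ_apply, Submodule.Quotient.mk_eq_zero, Submodule.mem_span_singleton]
  simp only [Fin.sum_univ_succAbove _ i, Fin.insertNth_apply_same, Fin.insertNth_apply_succAbove]
  constructor
  · rintro ⟨a, ha⟩
    exact ⟨-a, by rw [← ha]; simp⟩
  · rintro ⟨a, ha⟩
    exact ⟨-a, by rw [neg_smul, neg_eq_iff_add_eq_zero]; exact ha⟩

/-- The face maps are defined through the chosen coordinates `spanCoord`. As these have the same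
relations as `x`, the faces can be computed on any vectors of any space. -/
theorem Config.eps_of (x : Fin (k + 2) → V) (i : Fin (k + 2)) :
    (Config.of x).eps i = Config.of fun j => x (i.succAbove j) := by
  refine Config.of_eq_of (fun j => (spanCoord x).1 (i.succAbove j)) _ fun c => ?_
  rw [sum_succAbove_smul, sum_succAbove_smul, sum_spanCoord_eq_zero_iff]

theorem Config.eta_of (x : Fin (k + 2) → V) (i : Fin (k + 2)) :
    (Config.of x).eta i =
      Config.of fun j => (Submodule.span ℂ {x i}).mkQ (x (i.succAbove j)) := by
  refine Config.of_eq_of (fun j => (Submodule.span ℂ {(spanCoord x).1 i}).mkQ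
    ((spanCoord x).1 (i.succAbove j))) _ fun c => ?_
  simp only [sum_smul_mkQ_eq_zero_iff, sum_spanCoord_eq_zero_iff]

theorem Config.perm_of (x : Fin (k + 1) → V) (σ : Equiv.Perm (Fin (k + 1))) :
    (Config.of x).perm σ = Config.of fun j => x (σ j) := by
  refine Config.of_eq_of (fun j => (spanCoord x).1 (σ j)) _ fun c => ?_
  have h : ∑ j, c j • (spanCoord x).1 (σ j) = ∑ j, c (σ.symm j) • (spanCoord x).1 j := by
    rw [← Equiv.sum_comp σ (fun j => c (σ.symm j) • (spanCoord x).1 j)]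
    simp
  have h' : ∑ j, c j • x (σ j) = ∑ j, c (σ.symm j) • x j := by
    rw [← Equiv.sum_comp σ (fun j => c (σ.symm j) • x j)]
    simp
  rw [h, h', sum_spanCoord_eq_zero_iff]

/-- Every configuration is the class of a spanning tuple. -/
theorem Config.mk_eq_of {m : ℕ} (x : Spanning k m) : Config.mk x = Config.of x.1 := by
  set b := Module.finBasis ℂ (Submodule.span ℂ (range x.1))
  let e : (Fin m → ℂ) ≃ₗ[ℂ] (Fin _ → ℂ) :=
    (Submodule.topEquiv.symm.trans (LinearEquiv.ofEq _ _ x.2.symm)).trans b.equivFun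
  exact Config.mk_eq_mk x (spanCoord x.1) e fun i => rfl

theorem Config.exists_of (τ : Config k) :
    ∃ (m : ℕ) (x : Fin (k + 1) → Fin m → ℂ),
      Submodule.span ℂ (range x) = ⊤ ∧ τ = Config.of x := by
  obtain ⟨m, q⟩ := τ
  induction q using Quotient.inductionOn with
  | h x => exact ⟨m, x.1, x.2, Config.mk_eq_of x⟩

theorem Config.of_mkQ_eq_of_mkQ {W : Type*} [AddCommGroup W] [Module ℂ W]
    (U : Submodule ℂ V) (U' : Submodule ℂ W) (x : Fin (k + 1) → V) (y : Fin (k + 1) → W)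
    (h : ∀ c : Fin (k + 1) → ℂ, ∑ i, c i • x i ∈ U ↔ ∑ i, c i • y i ∈ U') :
    Config.of (fun i => U.mkQ (x i)) = Config.of fun i => U'.mkQ (y i) := by
  refine Config.of_eq_of _ _ fun c => ?_
  have h1 : ∑ i, c i • U.mkQ (x i) = U.mkQ (∑ i, c i • x i) := by simp [map_sum]
  have h2 : ∑ i, c i • U'.mkQ (y i) = U'.mkQ (∑ i, c i • y i) := by simp [map_sum]
  rw [h1, h2, Submodule.mkQ_apply, Submodule.mkQ_apply, Submodule.Quotient.mk_eq_zero,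
    Submodule.Quotient.mk_eq_zero, h]

theorem Config.of_mkQ_congr {U U' : Submodule ℂ V} (hU : U = U') {x y : Fin (k + 1) → V}
    (hx : x = y) : Config.of (fun i => U.mkQ (x i)) = Config.of fun i => U'.mkQ (y i) := by
  subst hU hx
  rfl

/-- The third isomorphism theorem, read on relations; it lets the denominators of `tConfig` grow by
one vector at a time. -/
theorem Config.eta_of_mkQ (U : Submodule ℂ V) (x : Fin (k + 2) → V) (i : Fin (k + 2)) :
    (Config.of fun j => U.mkQ (x j)).eta i =
      Config.of fun j => (Submodule.span ℂ {x i} ⊔ U).mkQ (x (i.succAbove j)) := by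
  rw [Config.eta_of]
  refine Config.of_eq_of _ _ fun c => ?_
  have h1 : ∑ j, c j • (Submodule.span ℂ {x i} ⊔ U).mkQ (x (i.succAbove j)) =
      (Submodule.span ℂ {x i} ⊔ U).mkQ (∑ j, c j • x (i.succAbove j)) := by simp [map_sum]
  rw [sum_smul_mkQ_eq_zero_iff (fun j => U.mkQ (x j)), h1, Submodule.mkQ_apply,
    Submodule.Quotient.mk_eq_zero]
  have h2 : ∀ d : Fin (k + 2) → ℂ, ∑ l, d l • U.mkQ (x l) = U.mkQ (∑ l, d l • x l) := by
    intro d; simp [map_sum]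
  simp only [h2]
  simp only [Submodule.mkQ_apply, Submodule.Quotient.mk_eq_zero,
    Fin.sum_univ_succAbove _ i, Fin.insertNth_apply_same, Fin.insertNth_apply_succAbove]
  rw [Submodule.mem_sup]
  constructor
  · rintro ⟨a, ha⟩
    exact ⟨(-a) • x i, Submodule.smul_mem _ _ (Submodule.mem_span_singleton_self _), _, ha,
      by simp⟩
  · rintro ⟨y, hy, z, hz, hyz⟩
    obtain ⟨a, rfl⟩ := Submodule.mem_span_singleton.1 hy
    refine ⟨-a, ?_⟩
    rw [← hyz]
    simpa using hz

end Relations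

/-! ## The pull-back to affine flags is a morphism of complexes -/

theorem Fin.iSup_succAbove {α : Type*} [CompleteLattice α] {k : ℕ} (i : Fin (k + 1))
    (f : Fin (k + 1) → α) : ⨆ l, f l = f i ⊔ ⨆ j, f (i.succAbove j) := by
  apply le_antisymm
  · refine iSup_le fun l => ?_
    rcases Fin.eq_self_or_eq_succAbove i l with rfl | ⟨j, rfl⟩
    · exact le_sup_left
    · exact le_sup_of_le_right (le_iSup (fun j => f (i.succAbove j)) j)
  · exact sup_le (le_iSup f i) (iSup_le fun j => le_iSup f _)

theorem CFlag.space_zero {n : ℕ} (F : CFlag n) : F.space 0 = ⊥ := by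
  have := F.finrank_space 0
  exact Submodule.finrank_eq_zero.1 (by simpa using this)

theorem CFlag.space_last {n : ℕ} (F : CFlag n) : F.space (Fin.last n) = ⊤ := by
  have := F.finrank_space (Fin.last n)
  exact Submodule.eq_top_of_finrank_eq (by simpa using this)

/-- The configuration of all flags but the `i`-th, in the quotient by the `a`-th space of the
latter. -/
def partialConfig {n k : ℕ} (A : Fin (k + 2) → AffineFlag n) (i : Fin (k + 2))
    (J : Fin (k + 1) → Fin n) (a : Fin (n + 1)) : Config k :=
  Config.of fun j => ((A i).space a ⊔ ⨆ l, (A (i.succAbove l)).space (J l).castSucc).mkQ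
    ((A (i.succAbove j)).v (J j))

theorem eps_tConfig_insertNth {n k : ℕ} (A : Fin (k + 2) → AffineFlag n) (i : Fin (k + 2))
    (J : Fin (k + 1) → Fin n) (a : Fin n) :
    (tConfig (i.insertNth (α := fun _ => Fin n) a J) A).eps i =
      partialConfig A i J a.castSucc := by
  rw [tConfig, Config.eps_of]
  refine Config.of_mkQ_congr ?_ (by simp)
  rw [Fin.iSup_succAbove i]
  simp

theorem eta_tConfig_insertNth {n k : ℕ} (A : Fin (k + 2) → AffineFlag n) (i : Fin (k + 2))
    (J : Fin (k + 1) → Fin n) (a : Fin n) :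
    (tConfig (i.insertNth (α := fun _ => Fin n) a J) A).eta i =
      partialConfig A i J a.succ := by
  rw [tConfig, Config.eta_of_mkQ]
  refine Config.of_mkQ_congr ?_ (by simp)
  rw [Fin.iSup_succAbove i, ← sup_assoc, ← (A i).space_succ]
  simp

theorem partialConfig_zero {n k : ℕ} (A : Fin (k + 2) → AffineFlag n) (i : Fin (k + 2))
    (J : Fin (k + 1) → Fin n) :
    partialConfig A i J 0 = tConfig J fun j => A (i.succAbove j) := by
  refine Config.of_mkQ_congr ?_ rfl
  rw [CFlag.space_zero, bot_sup_eq]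

/-- The last space is everything, so all vectors die in the quotient. The class of zero vectors in
`ℂ` serves as one common name for the result, independent of the flags. -/
theorem partialConfig_last {n k : ℕ} (A : Fin (k + 2) → AffineFlag n) (i : Fin (k + 2))
    (J : Fin (k + 1) → Fin n) :
    partialConfig A i J (Fin.last n) = Config.of fun _ : Fin (k + 1) => (0 : ℂ) := by
  have h : ((A i).space (Fin.last n) ⊔ ⨆ l, (A (i.succAbove l)).space (J l).castSucc) = ⊤ := by
    simp [CFlag.space_last]
  rw [partialConfig, Config.of_mkQ_congr h rfl]
  refine Config.of_eq_of _ _ fun c => ?_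
  simp [Subsingleton.elim _ (0 : (Fin n → ℂ) ⧸ (⊤ : Submodule ℂ (Fin n → ℂ)))]

/-- For `k = 0` the two signs cancel. For larger `k` a transposition fixes the zero class, so an
alternating function vanishes there. This disposes of the far ends of the telescoping sums. -/
theorem sum_neg_one_pow_mul_zeroConfig {k : ℕ} {f : Config k → ℝ} (hf : IsAltConfig f) :
    ∑ i : Fin (k + 2), (-1 : ℝ) ^ (i : ℕ) * f (Config.of fun _ : Fin (k + 1) => (0 : ℂ)) = 0 := by
  rcases k with _ | k
  · simp [Fin.sum_univ_succ]
  · have h := hf (Equiv.swap 0 1) (Config.of fun _ => (0 : ℂ))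
    rw [Config.perm_of, Equiv.Perm.sign_swap (by simp)] at h
    have h0 : f (Config.of fun _ : Fin (k + 1 + 1) => (0 : ℂ)) = 0 := by
      simp only [Units.val_neg, Units.val_one, Int.cast_neg, Int.cast_one] at h
      linarith
    simp [h0]

theorem coboundary_pullT (n : ℕ) {k : ℕ} (f : Config k → ℝ) (hf : IsAltConfig f) :
    coboundary (pullT n f) = pullT n (configD f) := by
  funext A
  have hi : ∀ i : Fin (k + 2), ∑ J : Fin (k + 2) → Fin n,
      (f ((tConfig J A).eps i) - f ((tConfig J A).eta i)) =
      pullT n f (fun j => A (i.succAbove j)) -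
        Fintype.card (Fin (k + 1) → Fin n) * f (Config.of fun _ => (0 : ℂ)) := by
    intro i
    rw [← Equiv.sum_comp (Fin.insertNthEquiv (fun _ => Fin n) i), Fintype.sum_prod_type_right]
    have : ∀ J : Fin (k + 1) → Fin n, ∑ a : Fin n,
        (f ((tConfig (Fin.insertNthEquiv (fun _ => Fin n) i (a, J)) A).eps i) -
          f ((tConfig (Fin.insertNthEquiv (fun _ => Fin n) i (a, J)) A).eta i)) =
        f (tConfig J fun j => A (i.succAbove j)) - f (Config.of fun _ => (0 : ℂ)) := by
      intro J
      have h0 : ∀ a, Fin.insertNthEquiv (fun _ => Fin n) i (a, J) =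
          i.insertNth (α := fun _ => Fin n) a J := fun a => rfl
      simp only [h0, eps_tConfig_insertNth, eta_tConfig_insertNth]
      rw [Finset.sum_sub_distrib]
      -- Both expansions describe the sum over all `n + 1` spaces of the `i`-th flag: one splits off
      -- the last space, the other the zero space. Their difference is the telescoped sum.
      have h1 := Fin.sum_univ_castSucc fun a => f (partialConfig A i J a)
      have h2 := Fin.sum_univ_succ fun a => f (partialConfig A i J a)
      rw [partialConfig_zero] at h2
      rw [partialConfig_last] at h1
      linarith
    simp only [this, Finset.sum_sub_distrib, Finset.sum_const, nsmul_eq_mul]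
    rfl
  have h0 := sum_neg_one_pow_mul_zeroConfig hf
  calc coboundary (pullT n f) A
      = ∑ i : Fin (k + 2), (-1) ^ (i : ℕ) * ∑ J : Fin (k + 2) → Fin n,
          (f ((tConfig J A).eps i) - f ((tConfig J A).eta i)) := by
        simp only [hi, mul_sub, Finset.sum_sub_distrib, coboundary]
        rw [eq_comm, sub_eq_self]
        rw [← mul_zero ((Fintype.card (Fin (k + 1) → Fin n) : ℝ)), ← h0, Finset.mul_sum]
        exact Finset.sum_congr rfl fun _ _ => by ring
    _ = pullT n (configD f) A := by
        simp only [Finset.mul_sum]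
        rw [Finset.sum_comm]
        refine Finset.sum_congr rfl fun J _ => ?_
        simp only [mul_sub, Finset.sum_sub_distrib, configD]

/-! ## The ideal volume in homogeneous coordinates -/

/-- The determinant of two vectors of `ℂ²`. -/
def bracket (v w : Fin 2 → ℂ) : ℂ := v 0 * w 1 - v 1 * w 0

theorem bracket_swap (v w : Fin 2 → ℂ) : bracket w v = -bracket v w := by
  simp only [bracket]; ring

theorem bracket_self (v : Fin 2 → ℂ) : bracket v v = 0 := by
  simp only [bracket]; ring

theorem bracket_plucker (a b c d : Fin 2 → ℂ) :
    bracket a b * bracket c d - bracket a c * bracket b d + bracket a d * bracket b c = 0 := by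
  simp only [bracket]; ring

theorem det_fin_four {R : Type*} [CommRing R] (M : Matrix (Fin 4) (Fin 4) R) :
    M.det = M 0 0 * (M 1 1 * (M 2 2 * M 3 3 - M 2 3 * M 3 2) -
        M 1 2 * (M 2 1 * M 3 3 - M 2 3 * M 3 1) + M 1 3 * (M 2 1 * M 3 2 - M 2 2 * M 3 1)) -
      M 0 1 * (M 1 0 * (M 2 2 * M 3 3 - M 2 3 * M 3 2) -
        M 1 2 * (M 2 0 * M 3 3 - M 2 3 * M 3 0) + M 1 3 * (M 2 0 * M 3 2 - M 2 2 * M 3 0)) +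
      M 0 2 * (M 1 0 * (M 2 1 * M 3 3 - M 2 3 * M 3 1) -
        M 1 1 * (M 2 0 * M 3 3 - M 2 3 * M 3 0) + M 1 3 * (M 2 0 * M 3 1 - M 2 1 * M 3 0)) -
      M 0 3 * (M 1 0 * (M 2 1 * M 3 2 - M 2 2 * M 3 1) -
        M 1 1 * (M 2 0 * M 3 2 - M 2 2 * M 3 0) + M 1 2 * (M 2 0 * M 3 1 - M 2 1 * M 3 0)) := by
  simp [Matrix.det_succ_row_zero, Fin.sum_univ_succ, Fin.succAbove]
  ring

/-- The value is `Im (A * conj B) / 2` for two terms `A`, `B` of the Plücker relation, which ties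
the orientation of a simplex to the imaginary part of its cross ratio. -/
theorem det_nullVector (y : Fin 4 → Fin 2 → ℂ) :
    (Matrix.of fun i => nullVector (y i)).det =
      (bracket (y 0) (y 1) * bracket (y 2) (y 3) *
        (starRingEnd ℂ) (bracket (y 0) (y 2) * bracket (y 1) (y 3))).im / 2 := by
  rw [det_fin_four]
  simp only [bracket, nullVector, Matrix.of_apply, Matrix.cons_val, Complex.normSq_apply,
    Complex.sub_re, Complex.sub_im, Complex.mul_re, Complex.mul_im, Complex.conj_re,
    Complex.conj_im]
  ring

theorem nullVector_smul (c : ℂ) (v : Fin 2 → ℂ) :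
    nullVector (c • v) = Complex.normSq c • nullVector v := by
  ext i
  fin_cases i <;> simp [nullVector, Complex.normSq_apply] <;> ring

theorem idealVolume_of_det_eq_zero {y : Fin 4 → Fin 2 → ℂ}
    (h : (Matrix.of fun i => nullVector (y i)).det = 0) : idealVolume y = 0 := by
  simp [idealVolume, h]

/-- A vanishing bracket kills one of the three Plücker terms `A`, `B`, `C`. If it is `C`, then `A =
B` and `A * conj B` is real. -/
theorem det_nullVector_eq_zero {y : Fin 4 → Fin 2 → ℂ} {i j : Fin 4} (hij : i ≠ j)
    (h : bracket (y i) (y j) = 0) : (Matrix.of fun i => nullVector (y i)).det = 0 := by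
  have hA : ∀ A B C : ℂ, A - B + C = 0 → A = 0 ∨ B = 0 ∨ C = 0 →
      (A * (starRingEnd ℂ) B).im / 2 = 0 := by
    rintro A B C h0 (rfl | rfl | rfl)
    · simp
    · simp
    · have : A = B := by linear_combination h0
      rw [this, Complex.mul_conj]
      simp
  rw [det_nullVector]
  refine hA _ _ _ (bracket_plucker (y 0) (y 1) (y 2) (y 3)) ?_
  have h' : bracket (y j) (y i) = 0 := by rw [bracket_swap, h, neg_zero]
  fin_cases i <;> fin_cases j <;> simp_all

theorem idealVolume_eq_zero {y : Fin 4 → Fin 2 → ℂ} {i j : Fin 4} (hij : i ≠ j)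
    (h : bracket (y i) (y j) = 0) : idealVolume y = 0 :=
  idealVolume_of_det_eq_zero (det_nullVector_eq_zero hij h)

theorem bracket_ne_zero_of_idealVolume {y : Fin 4 → Fin 2 → ℂ} (h : idealVolume y ≠ 0)
    {i j : Fin 4} (hij : i ≠ j) : bracket (y i) (y j) ≠ 0 :=
  fun h0 => h (idealVolume_eq_zero hij h0)

theorem idealSimplex_smul {c : Fin 4 → ℂ} (hc : ∀ i, c i ≠ 0) (y : Fin 4 → Fin 2 → ℂ) :
    idealSimplex (fun i => c i • y i) = idealSimplex y := by
  have hpos : ∀ i, 0 < Complex.normSq (c i) := fun i => Complex.normSq_pos.2 (hc i)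
  ext X
  simp only [idealSimplex, mem_inter_iff, mem_ofPred_eq, nullVector_smul]
  refine and_congr_right fun _ => ⟨?_, ?_⟩
  · rintro ⟨s, hs, rfl⟩
    exact ⟨fun i => s i * Complex.normSq (c i), fun i => mul_nonneg (hs i) (hpos i).le,
      by simp [smul_smul]⟩
  · rintro ⟨s, hs, rfl⟩
    exact ⟨fun i => s i / Complex.normSq (c i), fun i => div_nonneg (hs i) (hpos i).le,
      by simp [smul_smul, (hpos _).ne']⟩

theorem idealVolume_smul {c : Fin 4 → ℂ} (hc : ∀ i, c i ≠ 0) (y : Fin 4 → Fin 2 → ℂ) :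
    idealVolume (fun i => c i • y i) = idealVolume y := by
  have hdet : (Matrix.of fun i => nullVector (c i • y i)).det =
      (∏ i, Complex.normSq (c i)) * (Matrix.of fun i => nullVector (y i)).det := by
    rw [← Matrix.det_mul_column]
    simp only [nullVector_smul]
    rfl
  have hpos : 0 < ∏ i, Complex.normSq (c i) :=
    Finset.prod_pos fun i _ => Complex.normSq_pos.2 (hc i)
  simp only [idealVolume, idealSimplex_smul hc, hdet, sign_mul, sign_pos hpos, one_mul]

theorem idealVolume_perm (σ : Equiv.Perm (Fin 4)) (y : Fin 4 → Fin 2 → ℂ) :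
    idealVolume (fun i => y (σ i)) = ((Equiv.Perm.sign σ : ℤ) : ℝ) * idealVolume y := by
  have hS : idealSimplex (fun i => y (σ i)) = idealSimplex y := by
    ext X
    simp only [idealSimplex, mem_inter_iff, mem_ofPred_eq]
    refine and_congr_right fun _ => ⟨?_, ?_⟩
    · rintro ⟨s, hs, rfl⟩
      refine ⟨fun i => s (σ.symm i), fun i => hs _, ?_⟩
      rw [← Equiv.sum_comp σ (fun x => s (σ.symm x) • nullVector (y x))]
      simp
    · rintro ⟨s, hs, rfl⟩
      refine ⟨fun i => s (σ i), fun i => hs _, ?_⟩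
      rw [← Equiv.sum_comp σ]
  have hdet : (Matrix.of fun i => nullVector (y (σ i))).det =
      ((Equiv.Perm.sign σ : ℤ) : ℝ) * (Matrix.of fun i => nullVector (y i)).det :=
    Matrix.det_permute σ (Matrix.of fun i => nullVector (y i))
  simp only [idealVolume, hS, hdet]
  rcases Int.units_eq_one_or (Equiv.Perm.sign σ) with h | h <;> simp [h, Left.sign_neg]

/-- The Lorentzian form in the coordinates `s` given by the null vectors of `y`. -/
def nullForm (y : Fin 4 → Fin 2 → ℂ) (s : Fin 4 → ℝ) : ℝ :=
  Complex.normSq (bracket (y 0) (y 1)) * (s 0 * s 1) +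
  Complex.normSq (bracket (y 0) (y 2)) * (s 0 * s 2) +
  Complex.normSq (bracket (y 0) (y 3)) * (s 0 * s 3) +
  Complex.normSq (bracket (y 1) (y 2)) * (s 1 * s 2) +
  Complex.normSq (bracket (y 1) (y 3)) * (s 1 * s 3) +
  Complex.normSq (bracket (y 2) (y 3)) * (s 2 * s 3)

/-- The form vanishes on each null vector, so only mixed terms remain; the polarisation of two null
vectors is the squared modulus of their bracket. -/
theorem lorentz_sum_nullVector (y : Fin 4 → Fin 2 → ℂ) (s : Fin 4 → ℝ) :
    lorentz (∑ i, s i • nullVector (y i)) = nullForm y s := by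
  simp only [lorentz, nullForm, nullVector, bracket, Fin.sum_univ_four, Pi.add_apply,
    Pi.smul_apply, smul_eq_mul, Matrix.cons_val, Complex.normSq_apply, Complex.sub_re,
    Complex.sub_im, Complex.mul_re, Complex.mul_im]
  ring

/-- The cone over an ideal simplex, in the coordinates given by the null vectors of the vertices. -/
def coneRegion (y : Fin 4 → Fin 2 → ℂ) : Set (Fin 4 → ℝ) :=
  {s | (∀ i, 0 ≤ s i) ∧ 0 < nullForm y s ∧ nullForm y s < 1}

theorem cone_idealSimplex_eq_image (y : Fin 4 → Fin 2 → ℂ) :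
    Ioo (0 : ℝ) 1 • idealSimplex y =
      Matrix.toLin' (Matrix.of fun i => nullVector (y i)).transpose '' coneRegion y := by
  have key : ∀ s : Fin 4 → ℝ,
      Matrix.toLin' (Matrix.of fun i => nullVector (y i)).transpose s =
        ∑ i, s i • nullVector (y i) := by
    intro s
    rw [Matrix.toLin'_apply, Matrix.mulVec_transpose, Matrix.vecMul_eq_sum]
    rfl
  ext Y
  rw [mem_cone_idealSimplex]
  constructor
  · rintro ⟨⟨h0, h1⟩, s, hs, rfl⟩
    rw [lorentz_sum_nullVector] at h0 h1
    exact ⟨s, ⟨hs, h0, h1⟩, key s⟩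
  · rintro ⟨s, ⟨hs, h0, h1⟩, rfl⟩
    rw [key, lorentz_sum_nullVector]
    exact ⟨⟨h0, h1⟩, s, hs, rfl⟩

theorem volume_cone_idealSimplex (y : Fin 4 → Fin 2 → ℂ) :
    volume (Ioo (0 : ℝ) 1 • idealSimplex y) =
      ENNReal.ofReal |(Matrix.of fun i => nullVector (y i)).det| * volume (coneRegion y) := by
  rw [cone_idealSimplex_eq_image, Measure.addHaar_image_linearMap, LinearMap.det_toLin',
    Matrix.det_transpose]

/-- The change to light-ray coordinates contributes `|det|`, which the orientation sign turns into
`det` itself. The result has no case distinction and serves both for explicit integration and for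
measurability. -/
theorem idealVolume_eq (y : Fin 4 → Fin 2 → ℂ) :
    idealVolume y = (Matrix.of fun i => nullVector (y i)).det *
      (4 * (volume (coneRegion y)).toReal) := by
  rw [idealVolume, hyperbolicVolume, volume_cone_idealSimplex, ENNReal.toReal_mul,
    ENNReal.toReal_mul, ENNReal.toReal_ofReal (abs_nonneg _)]
  have := sign_mul_abs (Matrix.of fun i => nullVector (y i)).det
  rw [show (ENNReal.toReal 4) = 4 by simp]
  linear_combination (4 * (volume (coneRegion y)).toReal) * this

theorem measurableSet_coneRegion (y : Fin 4 → Fin 2 → ℂ) : MeasurableSet (coneRegion y) := by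
  have hc : Continuous (nullForm y) := by unfold nullForm; fun_prop
  refine MeasurableSet.inter ?_ (MeasurableSet.inter ?_ ?_)
  · exact (isClosed_le continuous_const continuous_id).measurableSet
  · exact (isOpen_lt continuous_const hc).measurableSet
  · exact (isOpen_lt hc continuous_const).measurableSet

/-! ## The cone over an ideal simplex in normal form -/

theorem lintegral_fin_succ {n : ℕ} {f : (Fin (n + 1) → ℝ) → ENNReal} (hf : Measurable f) :
    ∫⁻ s, f s = ∫⁻ a, ∫⁻ t : Fin n → ℝ, f (Matrix.vecCons a t) := by
  have h := (volume_preserving_piFinSuccAbove (fun _ : Fin (n + 1) => ℝ) 0).symm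
  rw [← h.lintegral_comp hf, Measure.volume_eq_prod, lintegral_prod]
  · simp [MeasurableEquiv.piFinSuccAbove, Fin.insertNthEquiv, Matrix.vecCons]
  · exact (hf.comp h.measurable).aemeasurable

theorem lintegral_fin_four {f : (Fin 4 → ℝ) → ENNReal} (hf : Measurable f) :
    ∫⁻ s, f s = ∫⁻ a, ∫⁻ b, ∫⁻ c, ∫⁻ d, f ![a, b, c, d] := by
  have hcons : ∀ (n : ℕ) (a : ℝ), Measurable fun t : Fin n → ℝ => (Matrix.vecCons a t) := by
    intro n a
    refine measurable_pi_iff.2 fun i => ?_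
    refine Fin.cases ?_ (fun j => ?_) i
    · simp
    · simpa using measurable_pi_apply j
  rw [lintegral_fin_succ hf]
  refine lintegral_congr fun a => ?_
  have hf1 : Measurable fun t => f (Matrix.vecCons a t) := hf.comp (hcons _ a)
  rw [lintegral_fin_succ hf1]
  refine lintegral_congr fun b => ?_
  have hf2 : Measurable fun t => f (Matrix.vecCons a (Matrix.vecCons b t)) :=
    hf1.comp (hcons _ b)
  rw [lintegral_fin_succ hf2]
  refine lintegral_congr fun c => ?_
  have hf3 : Measurable fun t => f (Matrix.vecCons a (Matrix.vecCons b (Matrix.vecCons c t))) :=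
    hf2.comp (hcons _ c)
  rw [lintegral_fin_succ hf3]
  refine lintegral_congr fun d => ?_
  rw [lintegral_unique]
  have h0 : volume (univ : Set (Fin 0 → ℝ)) = 1 := by
    rw [volume_pi, Measure.pi_of_empty (x := isEmptyElim)]
    simp
  have h1 : ∀ e : Fin 0 → ℝ, f (Matrix.vecCons a (Matrix.vecCons b (Matrix.vecCons c
      (Matrix.vecCons d e)))) = f ![a, b, c, d] := fun e => by rw [Subsingleton.elim e ![]]
  rw [h0, mul_one, h1]

theorem lintegral_Ioi_comp_mul {t : ℝ} (ht : 0 < t) {f : ℝ → ENNReal} (hf : Measurable f) :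
    ∫⁻ x in Ioi 0, f x = ∫⁻ x in Ioi 0, ENNReal.ofReal t * f (t * x) := by
  have h := Real.smul_map_volume_mul_left ht.ne'
  have hm : Measurable fun x => f (t * x) := hf.comp (measurable_const_mul t)
  rw [lintegral_const_mul _ hm, ← lintegral_indicator
    measurableSet_Ioi, ← lintegral_indicator measurableSet_Ioi]
  nth_rewrite 1 [← h]
  rw [lintegral_smul_measure, lintegral_map (hf.indicator measurableSet_Ioi)
    (measurable_const_mul t), abs_of_pos ht, smul_eq_mul]
  congr 1
  refine lintegral_congr fun x => ?_
  by_cases hx : 0 < x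
  · rw [indicator_of_mem (by exact mul_pos ht hx), indicator_of_mem (by exact hx)]
  · rw [indicator_of_notMem, indicator_of_notMem (by exact hx)]
    simp only [mem_Ioi, not_lt] at hx ⊢
    exact mul_nonpos_of_nonneg_of_nonpos ht.le hx

/-- Homogeneous coordinates of the points `∞, 0, 1, z`. -/
def normalForm (z : ℂ) : Fin 4 → Fin 2 → ℂ := ![![1, 0], ![0, 1], ![1, 1], ![z, 1]]

theorem nullForm_normalForm (z : ℂ) (s : Fin 4 → ℝ) :
    nullForm (normalForm z) s = s 0 * s 1 + s 0 * s 2 + s 0 * s 3 + s 1 * s 2 +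
      Complex.normSq z * (s 1 * s 3) + Complex.normSq (1 - z) * (s 2 * s 3) := by
  simp [nullForm, normalForm, bracket]

theorem det_normalForm (z : ℂ) :
    (Matrix.of fun i => nullVector (normalForm z i)).det = z.im / 2 := by
  rw [det_nullVector]
  simp [normalForm, bracket]
  ring

/-- The coordinate hyperplanes are null sets, and on the open orthant the form is automatically
positive. -/
theorem volume_coneRegion_normalForm_eq_pos (z : ℂ) :
    volume (coneRegion (normalForm z)) =
      volume {s : Fin 4 → ℝ | (∀ i, 0 < s i) ∧ nullForm (normalForm z) s < 1} := by
  have hpos : ∀ s : Fin 4 → ℝ, (∀ i, 0 < s i) → 0 < nullForm (normalForm z) s := by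
    intro s hs
    rw [nullForm_normalForm]
    have h0 := hs 0
    have h1 := hs 1
    have h2 := hs 2
    have h3 := hs 3
    have := Complex.normSq_nonneg z
    have := Complex.normSq_nonneg (1 - z)
    positivity
  apply le_antisymm
  · have hsub : coneRegion (normalForm z) ⊆
        {s : Fin 4 → ℝ | (∀ i, 0 < s i) ∧ nullForm (normalForm z) s < 1} ∪
          ⋃ i : Fin 4, {s : Fin 4 → ℝ | s i = 0} := by
      rintro s ⟨h0, -, h1⟩
      by_cases h : ∀ i, 0 < s i
      · exact Or.inl ⟨h, h1⟩
      · push Not at h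
        obtain ⟨i, hi⟩ := h
        exact Or.inr (mem_iUnion.2 ⟨i, le_antisymm hi (h0 i)⟩)
    refine (measure_mono hsub).trans ((measure_union_le _ _).trans ?_)
    have : volume (⋃ i : Fin 4, {s : Fin 4 → ℝ | s i = 0}) = 0 :=
      measure_iUnion_null fun i => Measure.pi_hyperplane _ i 0
    rw [this, add_zero]
  · refine measure_mono ?_
    rintro s ⟨h0, h1⟩
    exact ⟨fun i => (h0 i).le, hpos s h0, h1⟩

theorem lintegral_Ioi_mul_one_sub_sq {q l : ℝ} (hq : 0 < q) (hl : 0 < l) :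
    ∫⁻ t in Ioi (0 : ℝ), ENNReal.ofReal (t * (1 - t ^ 2 * q) / l) =
      ENNReal.ofReal (1 / (4 * (q * l))) := by
  -- The integrand changes sign at `r`; beyond it `ENNReal.ofReal` truncates to zero.
  set r := (√q)⁻¹ with hr
  have hr0 : 0 < r := inv_pos.2 (Real.sqrt_pos.2 hq)
  have hr2 : r ^ 2 * q = 1 := by
    rw [hr, inv_pow, Real.sq_sqrt hq.le, inv_mul_cancel₀ hq.ne']
  have hsplit : Ioi (0 : ℝ) = Ioc 0 r ∪ Ioi r := (Ioc_union_Ioi_eq_Ioi hr0.le).symm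
  have hz : ∫⁻ t in Ioi r, ENNReal.ofReal (t * (1 - t ^ 2 * q) / l) = 0 := by
    rw [setLIntegral_congr_fun (g := fun _ => 0) measurableSet_Ioi, lintegral_zero]
    intro t ht
    have ht : r < t := ht
    have h1 : 1 < t ^ 2 * q := by
      rw [← hr2]
      have : r ^ 2 < t ^ 2 := by nlinarith
      nlinarith
    refine ENNReal.ofReal_of_nonpos (div_nonpos_of_nonpos_of_nonneg ?_ hl.le)
    exact mul_nonpos_of_nonneg_of_nonpos (hr0.trans ht).le (by linarith)
  have hcont : Continuous fun t : ℝ => t * (1 - t ^ 2 * q) / l := by fun_prop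
  rw [hsplit, lintegral_union measurableSet_Ioi (Ioc_disjoint_Ioi le_rfl), hz, add_zero,
    ← ofReal_integral_eq_lintegral_ofReal]
  · rw [← intervalIntegral.integral_of_le hr0.le]
    have hd : ∀ t ∈ uIcc 0 r, HasDerivAt (fun t : ℝ => (t ^ 2 / 2 - t ^ 4 * q / 4) / l)
        (t * (1 - t ^ 2 * q) / l) t := by
      intro t _
      have h1 := ((hasDerivAt_pow 2 t).div_const 2).sub
        (((hasDerivAt_pow 4 t).mul_const q).div_const 4)
      exact (h1.div_const l).congr_deriv (by push_cast; ring)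
    rw [intervalIntegral.integral_eq_sub_of_hasDerivAt hd (hcont.intervalIntegrable _ _)]
    congr 1
    have h4 : r ^ 4 * q = r ^ 2 := by rw [show r ^ 4 * q = r ^ 2 * (r ^ 2 * q) by ring, hr2, mul_one]
    have h2 : r ^ 2 = 1 / q := by field_simp; linarith
    rw [h4, h2]
    field_simp
    norm_num
  · exact (hcont.integrableOn_Icc).mono_set Ioc_subset_Icc_self
  · refine (ae_restrict_iff' measurableSet_Ioc).2 (Filter.Eventually.of_forall fun t ht => ?_)
    have h1 : t ^ 2 * q ≤ 1 := by
      rw [← hr2]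
      have : t ^ 2 ≤ r ^ 2 := by nlinarith [ht.1, ht.2]
      nlinarith
    exact div_nonneg (mul_nonneg ht.1.le (by linarith)) hl.le

/-- The form is affine in the last coordinate, so the slices are intervals starting at zero whose
length is the displayed quotient. Where the quotient is negative the interval is empty and
`ENNReal.ofReal` gives zero. -/
theorem volume_coneRegion_normalForm_eq_lintegral (z : ℂ) :
    volume (coneRegion (normalForm z)) =
      ∫⁻ t in Ioi (0 : ℝ), ∫⁻ x in Ioi (0 : ℝ), ∫⁻ y in Ioi (0 : ℝ),
        ENNReal.ofReal ((1 - (t * x + t * y + x * y)) /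
          (t + Complex.normSq z * x + Complex.normSq (1 - z) * y)) := by
  have ha := Complex.normSq_nonneg z
  have hb := Complex.normSq_nonneg (1 - z)
  set a := Complex.normSq z
  set b := Complex.normSq (1 - z)
  set S : Set (Fin 4 → ℝ) := {s | (∀ i, 0 < s i) ∧ nullForm (normalForm z) s < 1} with hS
  have hcont : Continuous (nullForm (normalForm z)) := by unfold nullForm; fun_prop
  have hSm : MeasurableSet S := by
    have : S = (⋂ i, {s | 0 < s i}) ∩ {s | nullForm (normalForm z) s < 1} := by
      ext; simp [hS]
    rw [this]
    exact (MeasurableSet.iInter fun i =>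
      (isOpen_lt continuous_const (continuous_apply i)).measurableSet).inter
      (isOpen_lt hcont continuous_const).measurableSet
  have hmem : ∀ t x y d : ℝ, ![t, x, y, d] ∈ S ↔ 0 < t ∧ 0 < x ∧ 0 < y ∧ 0 < d ∧
      (t * x + t * y + x * y) + d * (t + a * x + b * y) < 1 := by
    intro t x y d
    have h1 : nullForm (normalForm z) ![t, x, y, d] =
        (t * x + t * y + x * y) + d * (t + a * x + b * y) := by
      rw [nullForm_normalForm]
      simp only [Matrix.cons_val]
      ring
    rw [hS, mem_ofPred_eq, h1]
    simp only [Fin.forall_fin_succ, Matrix.cons_val]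
    simp
    tauto
  have hzero : ∀ t x y : ℝ, ¬ (0 < t ∧ 0 < x ∧ 0 < y) →
      ∫⁻ d, S.indicator 1 ![t, x, y, d] = 0 := by
    intro t x y h
    have : ∀ d, S.indicator (1 : (Fin 4 → ℝ) → ENNReal) ![t, x, y, d] = 0 := fun d =>
      indicator_of_notMem (fun hd => h ⟨((hmem _ _ _ _).1 hd).1, ((hmem _ _ _ _).1 hd).2.1,
        ((hmem _ _ _ _).1 hd).2.2.1⟩) _
    simp [this]
  rw [volume_coneRegion_normalForm_eq_pos, ← lintegral_indicator_one hSm,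
    lintegral_fin_four (measurable_one.indicator hSm), ← lintegral_indicator measurableSet_Ioi]
  refine lintegral_congr fun t => ?_
  by_cases ht : 0 < t
  swap
  · rw [indicator_of_notMem (by exact ht)]
    simp [hzero t _ _ fun h => ht h.1]
  rw [indicator_of_mem (by exact ht), ← lintegral_indicator measurableSet_Ioi]
  refine lintegral_congr fun x => ?_
  by_cases hx : 0 < x
  swap
  · rw [indicator_of_notMem (by exact hx)]
    simp [hzero t x _ fun h => hx h.2.1]
  rw [indicator_of_mem (by exact hx), ← lintegral_indicator measurableSet_Ioi]
  refine lintegral_congr fun y => ?_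
  by_cases hy : 0 < y
  swap
  · rw [indicator_of_notMem (by exact hy), hzero t x y fun h => hy h.2.2]
  rw [indicator_of_mem (by exact hy)]
  have hl : 0 < t + a * x + b * y := by positivity
  have hIoo : ∀ d, S.indicator (1 : (Fin 4 → ℝ) → ENNReal) ![t, x, y, d] =
      (Ioo 0 ((1 - (t * x + t * y + x * y)) / (t + a * x + b * y))).indicator 1 d := by
    intro d
    have : ![t, x, y, d] ∈ S ↔
        d ∈ Ioo 0 ((1 - (t * x + t * y + x * y)) / (t + a * x + b * y)) := by
      rw [hmem, mem_Ioo, lt_div_iff₀ hl]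
      constructor
      · rintro ⟨-, -, -, h, h'⟩
        exact ⟨h, by linarith⟩
      · rintro ⟨h, h'⟩
        exact ⟨ht, hx, hy, h, by linarith⟩
    by_cases hd : ![t, x, y, d] ∈ S
    · rw [indicator_of_mem hd, indicator_of_mem (this.1 hd)]
      rfl
    · rw [indicator_of_notMem hd, indicator_of_notMem (mt this.2 hd)]
  simp only [hIoo]
  rw [lintegral_indicator_one measurableSet_Ioo, Real.volume_Ioo, sub_zero]

/-- The integrand of the volume of an ideal simplex with a dihedral angle of cosine `c`; the
parameter `κ` measures the asymmetry of the two other dihedral angles. -/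
def simplexIntegrand (c κ : ℝ) (p : ℝ × ℝ) : ℝ :=
  1 / ((1 + p.2) * (p.1 ^ 2 + 2 * c * p.1 + 1 + κ * p.1 * (1 + p.2)))

/-- The integral of `simplexIntegrand` over the positive quadrant. -/
def simplexIntegral (c κ : ℝ) : ENNReal :=
  ∫⁻ p in Ioi (0 : ℝ) ×ˢ Ioi (0 : ℝ), ENNReal.ofReal (simplexIntegrand c κ p)

theorem measurable_simplexIntegrand (c κ : ℝ) : Measurable (simplexIntegrand c κ) := by
  unfold simplexIntegrand
  fun_prop

theorem simplexIntegral_eq (c κ : ℝ) : simplexIntegral c κ =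
    ∫⁻ x in Ioi (0 : ℝ), ∫⁻ w in Ioi (0 : ℝ), ENNReal.ofReal (simplexIntegrand c κ (x, w)) := by
  rw [simplexIntegral, Measure.volume_eq_prod, setLIntegral_prod]
  exact (measurable_simplexIntegrand c κ).ennreal_ofReal.aemeasurable

theorem volume_coneRegion_normalForm {z : ℂ} (hz : z ≠ 0) :
    volume (coneRegion (normalForm z)) = ENNReal.ofReal (1 / (4 * ‖z‖)) *
      simplexIntegral (z.re / ‖z‖) (Complex.normSq (1 - z) / ‖z‖) := by
  have ha := Complex.normSq_nonneg z
  have hb := Complex.normSq_nonneg (1 - z)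
  have hab : 1 + Complex.normSq z - Complex.normSq (1 - z) = 2 * z.re := by
    simp [Complex.normSq_apply]; ring
  have hn : 0 < ‖z‖ := norm_pos_iff.2 hz
  have han : Complex.normSq z = ‖z‖ ^ 2 := Complex.normSq_eq_norm_sq z
  rw [volume_coneRegion_normalForm_eq_lintegral]
  set a := Complex.normSq z
  set b := Complex.normSq (1 - z)
  -- Scaling `x` and `y` by `t` makes the quadratic part homogeneous, so that the integral over `t`
  -- becomes elementary once the order of integration is exchanged.
  have hscale : ∀ t ∈ Ioi (0 : ℝ), ∫⁻ x in Ioi (0 : ℝ), ∫⁻ y in Ioi (0 : ℝ),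
      ENNReal.ofReal ((1 - (t * x + t * y + x * y)) / (t + a * x + b * y)) =
      ∫⁻ x in Ioi (0 : ℝ), ∫⁻ y in Ioi (0 : ℝ),
        ENNReal.ofReal (t * (1 - t ^ 2 * (x + y + x * y)) / (1 + a * x + b * y)) := by
    intro t ht
    have ht : 0 < t := ht
    have hm : Measurable fun p : ℝ × ℝ => ENNReal.ofReal
        ((1 - (t * p.1 + t * p.2 + p.1 * p.2)) / (t + a * p.1 + b * p.2)) := by fun_prop
    rw [lintegral_Ioi_comp_mul ht hm.lintegral_prod_right']
    refine setLIntegral_congr_fun measurableSet_Ioi fun x hx => ?_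
    have hx : 0 < x := hx
    simp only
    rw [lintegral_Ioi_comp_mul ht (by fun_prop), ← lintegral_const_mul _ (by fun_prop)]
    refine setLIntegral_congr_fun measurableSet_Ioi fun y hy => ?_
    have hy : 0 < y := hy
    rw [← ENNReal.ofReal_mul ht.le, ← ENNReal.ofReal_mul ht.le]
    congr 1
    have h1 : 0 < 1 + a * x + b * y := by positivity
    have h2 : t + a * (t * x) + b * (t * y) = t * (1 + a * x + b * y) := by ring
    rw [h2]
    field_simp
  rw [setLIntegral_congr_fun measurableSet_Ioi hscale]
  have hm3 : Measurable fun p : (ℝ × ℝ) × ℝ => ENNReal.ofReal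
      (p.1.1 * (1 - p.1.1 ^ 2 * (p.1.2 + p.2 + p.1.2 * p.2)) / (1 + a * p.1.2 + b * p.2)) := by
    fun_prop
  rw [lintegral_lintegral_swap hm3.lintegral_prod_right'.aemeasurable]
  have hinner : ∀ x ∈ Ioi (0 : ℝ), ∫⁻ t in Ioi (0 : ℝ), ∫⁻ y in Ioi (0 : ℝ),
      ENNReal.ofReal (t * (1 - t ^ 2 * (x + y + x * y)) / (1 + a * x + b * y)) =
      ∫⁻ w in Ioi (0 : ℝ), ENNReal.ofReal (1 / (4 * ((1 + w) *
        (a * x ^ 2 + 2 * z.re * x + 1 + b * x * (1 + w))))) := by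
    intro x hx
    have hx : 0 < x := hx
    rw [lintegral_lintegral_swap (by
      simp only [Function.uncurry_def]
      fun_prop)]
    have h1 : ∀ y ∈ Ioi (0 : ℝ), ∫⁻ t in Ioi (0 : ℝ),
        ENNReal.ofReal (t * (1 - t ^ 2 * (x + y + x * y)) / (1 + a * x + b * y)) =
        ENNReal.ofReal (1 / (4 * ((x + y + x * y) * (1 + a * x + b * y)))) := by
      intro y hy
      have hy : 0 < y := hy
      exact lintegral_Ioi_mul_one_sub_sq (by positivity) (by positivity)
    -- The substitution `y = x / (x + 1) * w` turns `x + y + x * y` into `x * (1 + w)`, which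
    -- separates the first factor of the denominator.
    rw [setLIntegral_congr_fun measurableSet_Ioi h1,
      lintegral_Ioi_comp_mul (t := x / (x + 1)) (by positivity) (by fun_prop)]
    refine setLIntegral_congr_fun measurableSet_Ioi fun w hw => ?_
    have hw : 0 < w := hw
    rw [← ENNReal.ofReal_mul (by positivity)]
    congr 1
    have h2 : a * x ^ 2 + 2 * z.re * x + 1 + b * x * (1 + w) =
        (1 + a * x) * (x + 1) + b * x * w := by rw [← hab]; ring
    rw [h2]
    have h3 : x + x / (x + 1) * w + x * (x / (x + 1) * w) = x * (1 + w) := by field_simp; ring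
    have h4 : 1 + a * x + b * (x / (x + 1) * w) = ((1 + a * x) * (x + 1) + b * x * w) / (x + 1) := by
      field_simp
    rw [h3, h4]
    have h5 : 0 < (1 + a * x) * (x + 1) + b * x * w := by positivity
    field_simp
  rw [setLIntegral_congr_fun measurableSet_Ioi hinner, simplexIntegral_eq]
  have hm2 : Measurable fun p : ℝ × ℝ => ENNReal.ofReal (1 / (4 * ((1 + p.2) *
        (a * p.1 ^ 2 + 2 * z.re * p.1 + 1 + b * p.1 * (1 + p.2))))) := by fun_prop
  have hm4 : Measurable fun p : ℝ × ℝ =>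
      ENNReal.ofReal (simplexIntegrand (z.re / ‖z‖) (b / ‖z‖) (p.1, p.2)) :=
    (measurable_simplexIntegrand _ _).ennreal_ofReal
  -- Scaling `x` by `‖z‖⁻¹` normalises the coefficient of `x ^ 2` to one. Then only the cosine of
  -- the argument and the asymmetry parameter remain.
  rw [lintegral_Ioi_comp_mul (inv_pos.2 hn) hm2.lintegral_prod_right',
    ← lintegral_const_mul _ hm4.lintegral_prod_right']
  refine setLIntegral_congr_fun measurableSet_Ioi fun x hx => ?_
  simp only
  have hm5 : Measurable fun w => ENNReal.ofReal (simplexIntegrand (z.re / ‖z‖) (b / ‖z‖) (x, w)) :=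
    hm4.comp measurable_prodMk_left
  rw [← lintegral_const_mul _ (by fun_prop), ← lintegral_const_mul _ hm5]
  refine setLIntegral_congr_fun measurableSet_Ioi fun w hw => ?_
  simp only [simplexIntegrand]
  rw [← ENNReal.ofReal_mul (by positivity), ← ENNReal.ofReal_mul (by positivity)]
  congr 1
  have h6 : a * (‖z‖⁻¹ * x) ^ 2 + 2 * z.re * (‖z‖⁻¹ * x) + 1 + b * (‖z‖⁻¹ * x) * (1 + w) =
      x ^ 2 + 2 * (z.re / ‖z‖) * x + 1 + b / ‖z‖ * x * (1 + w) := by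
    rw [han]
    field_simp
  rw [h6]
  simp only [one_div, mul_inv]
  ring

/-! ### Finiteness and monotonicity of the simplex integral -/

theorem lintegral_inv_one_add_mul_sqrt_lt_top :
    ∫⁻ x in Ioi (0 : ℝ), ENNReal.ofReal (1 / ((1 + x) * √x)) < ⊤ := by
  have h : IntegrableOn (fun x : ℝ => 1 / ((1 + x) * √x)) (Ioi 0) := by
    refine integrableOn_Ioi_deriv_of_nonneg (g := fun x => 2 * Real.arctan √x)
      (l := 2 * (Real.pi / 2)) ?_ ?_ ?_ ?_
    · exact ((Real.continuous_arctan.comp Real.continuous_sqrt).const_smul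
        (2 : ℝ)).continuousWithinAt
    · intro x hx
      have hx : 0 < x := hx
      have h1 := ((Real.hasDerivAt_sqrt hx.ne').arctan).const_mul 2
      refine h1.congr_deriv ?_
      rw [Real.sq_sqrt hx.le]
      have := Real.sqrt_pos.2 hx
      field_simp
    · intro x hx
      have hx : 0 < x := hx
      positivity
    · exact (((Real.tendsto_arctan_atTop.mono_right nhdsWithin_le_nhds).comp
        Real.tendsto_sqrt_atTop).const_mul 2)
  exact h.lintegral_lt_top

theorem lintegral_inv_one_add_mul_sqrt_one_add_lt_top :
    ∫⁻ w in Ioi (0 : ℝ), ENNReal.ofReal (1 / ((1 + w) * √(1 + w))) < ⊤ := by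
  have h : IntegrableOn (fun w : ℝ => 1 / ((1 + w) * √(1 + w))) (Ioi 0) := by
    refine integrableOn_Ioi_deriv_of_nonneg (g := fun w => -2 * (√(1 + w))⁻¹)
      (l := -2 * 0) ?_ ?_ ?_ ?_
    · refine ContinuousAt.continuousWithinAt ?_
      refine continuousAt_const.mul (ContinuousAt.inv₀ ?_ (by simp))
      exact (Real.continuous_sqrt.comp (continuous_const.add continuous_id)).continuousAt
    · intro w hw
      have hw : 0 < w := hw
      have h0 : HasDerivAt (fun w : ℝ => 1 + w) 1 w := (hasDerivAt_id w).const_add 1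
      have hp : 0 < 1 + w := by linarith
      have hs := Real.sqrt_pos.2 hp
      have h1 := ((h0.sqrt hp.ne').inv hs.ne').const_mul (-2)
      refine h1.congr_deriv ?_
      rw [Real.sq_sqrt hp.le]
      field_simp
    · intro w hw
      have hw : 0 < w := hw
      positivity
    · refine Filter.Tendsto.const_mul _ (Filter.Tendsto.comp tendsto_inv_atTop_zero ?_)
      exact Real.tendsto_sqrt_atTop.comp (Filter.tendsto_atTop_add_const_left _ _ Filter.tendsto_id)
  exact h.lintegral_lt_top

/-- When `c = -|c|` the difference of the two sides is exactly `(1 + |c|) / 2 * (x - 1) ^ 2`; a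
larger `c` only helps because `x` is nonnegative. -/
theorem sq_add_mul_add_one_ge {c x : ℝ} (hx : 0 ≤ x) :
    (1 - |c|) / 2 * (1 + x) ^ 2 ≤ x ^ 2 + 2 * c * x + 1 := by
  have h1 : -|c| ≤ c := neg_abs_le c
  have h2 : 0 ≤ (1 + |c|) / 2 * (x - 1) ^ 2 := by positivity
  nlinarith [mul_le_mul_of_nonneg_right h1 hx]

/-- The inequality of arithmetic and geometric means bounds the quadratic factor below by a product
of a function of `x` and a function of `w`. The integrand is then dominated by a product of two
integrable functions of one variable. -/
theorem simplexIntegral_lt_top {c κ : ℝ} (hc : |c| < 1) (hκ : 0 < κ) :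
    simplexIntegral c κ < ⊤ := by
  set k := (1 - |c|) / 2 with hk
  have hk0 : 0 < k := by rw [hk]; linarith
  set C := 1 / (2 * √(k * κ)) with hC
  have hC0 : 0 ≤ C := by positivity
  have hbound : ∀ p ∈ Ioi (0 : ℝ) ×ˢ Ioi (0 : ℝ), ENNReal.ofReal (simplexIntegrand c κ p) ≤
      ENNReal.ofReal C * (ENNReal.ofReal (1 / ((1 + p.1) * √p.1)) *
        ENNReal.ofReal (1 / ((1 + p.2) * √(1 + p.2)))) := by
    rintro ⟨x, w⟩ ⟨hx, hw⟩
    have hx : 0 < x := hx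
    have hw : 0 < w := hw
    simp only [simplexIntegrand]
    rw [← ENNReal.ofReal_mul (by positivity), ← ENNReal.ofReal_mul hC0]
    refine ENNReal.ofReal_le_ofReal ?_
    have h1 := sq_add_mul_add_one_ge (c := c) hx.le
    rw [← hk] at h1
    have h2 : 2 * (√(k * κ) * ((1 + x) * √x * √(1 + w))) ≤
        x ^ 2 + 2 * c * x + 1 + κ * x * (1 + w) := by
      have e1 : (√k * (1 + x)) ^ 2 = k * (1 + x) ^ 2 := by rw [mul_pow, Real.sq_sqrt hk0.le]
      have e2 : (√κ * √x * √(1 + w)) ^ 2 = κ * x * (1 + w) := by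
        rw [mul_pow, mul_pow, Real.sq_sqrt hκ.le, Real.sq_sqrt hx.le,
          Real.sq_sqrt (by linarith)]
      have e3 : √(k * κ) = √k * √κ := Real.sqrt_mul hk0.le κ
      have h3 := two_mul_le_add_sq (√k * (1 + x)) (√κ * √x * √(1 + w))
      rw [e3]
      nlinarith
    have hsq : 0 < √(k * κ) := Real.sqrt_pos.2 (by positivity)
    have hsx := Real.sqrt_pos.2 hx
    have hsw : 0 < √(1 + w) := Real.sqrt_pos.2 (by linarith)
    have h4 : C * (1 / ((1 + x) * √x) * (1 / ((1 + w) * √(1 + w)))) =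
        1 / ((1 + w) * (2 * (√(k * κ) * ((1 + x) * √x * √(1 + w))))) := by
      rw [hC]
      field_simp
    rw [h4]
    gcongr
  refine (setLIntegral_mono' (measurableSet_Ioi.prod measurableSet_Ioi) hbound).trans_lt ?_
  have hm1 : Measurable fun x : ℝ => ENNReal.ofReal (1 / ((1 + x) * √x)) := by fun_prop
  have hm2 : Measurable fun w : ℝ => ENNReal.ofReal (1 / ((1 + w) * √(1 + w))) := by fun_prop
  rw [lintegral_const_mul _ (by fun_prop), Measure.volume_eq_prod, ← Measure.prod_restrict, lintegral_prod_mul hm1.aemeasurable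
    hm2.aemeasurable]
  exact ENNReal.mul_lt_top ENNReal.ofReal_lt_top (ENNReal.mul_lt_top
    lintegral_inv_one_add_mul_sqrt_lt_top lintegral_inv_one_add_mul_sqrt_one_add_lt_top)

theorem simplexIntegrand_pos {c κ : ℝ} (hc : |c| < 1) (hκ : 0 ≤ κ) {p : ℝ × ℝ}
    (hp : p ∈ Ioi (0 : ℝ) ×ˢ Ioi (0 : ℝ)) :
    0 < p.1 ^ 2 + 2 * c * p.1 + 1 + κ * p.1 * (1 + p.2) := by
  have h1 : 0 < p.1 := hp.1
  have h2 : 0 < p.2 := hp.2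
  have h3 := sq_add_mul_add_one_ge (c := c) h1.le
  have h4 : 0 < (1 - |c|) / 2 * (1 + p.1) ^ 2 := by
    have : 0 < 1 - |c| := by linarith
    positivity
  have : 0 ≤ κ * p.1 * (1 + p.2) := by positivity
  linarith

theorem volume_quadrant_ne_zero :
    volume (Ioi (0 : ℝ) ×ˢ Ioi (0 : ℝ)) ≠ 0 := by
  rw [Measure.volume_eq_prod, Measure.prod_prod]
  simp

/-- The integrand strictly decreases in `κ` at every point, and finiteness carries the strictness
over to the integrals. The uniqueness of the maximal simplex rests on this. -/
theorem simplexIntegral_strictAnti {c κ κ' : ℝ} (hc : |c| < 1) (hκ : 0 < κ) (h : κ < κ') :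
    simplexIntegral c κ' < simplexIntegral c κ := by
  refine setLIntegral_strict_mono (measurableSet_Ioi.prod measurableSet_Ioi)
    volume_quadrant_ne_zero (measurable_simplexIntegrand c κ).ennreal_ofReal
    (simplexIntegral_lt_top hc (hκ.trans h)).ne (Filter.Eventually.of_forall fun p hp => ?_)
  have h1 : 0 < p.1 := hp.1
  have h2 : 0 < p.2 := hp.2
  have h3 := simplexIntegrand_pos hc hκ.le hp
  have h4 := simplexIntegrand_pos hc (hκ.trans h).le hp
  refine (ENNReal.ofReal_lt_ofReal_iff_of_nonneg ?_).2 ?_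
  · unfold simplexIntegrand
    positivity
  · unfold simplexIntegrand
    refine one_div_lt_one_div_of_lt (by positivity) ?_
    gcongr

theorem simplexIntegral_pos {c κ : ℝ} (hc : |c| < 1) (hκ : 0 < κ) : 0 < simplexIntegral c κ :=
  bot_le.trans_lt (simplexIntegral_strictAnti hc hκ (lt_add_one κ))

theorem abs_idealVolume_normalForm {z : ℂ} (hz : z ≠ 0) :
    |idealVolume (normalForm z)| = |z.im| / (2 * ‖z‖) *
      (simplexIntegral (z.re / ‖z‖) (Complex.normSq (1 - z) / ‖z‖)).toReal := by
  have hn : 0 < ‖z‖ := norm_pos_iff.2 hz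
  rw [idealVolume_eq, det_normalForm, volume_coneRegion_normalForm hz, ENNReal.toReal_mul,
    ENNReal.toReal_ofReal (by positivity), abs_mul, abs_div, abs_two,
    abs_of_nonneg (a := 4 * _) (by positivity)]
  field_simp

theorem abs_re_div_norm_lt_one {z : ℂ} (hz : z.im ≠ 0) : |z.re / ‖z‖| < 1 := by
  have h0 : z ≠ 0 := by rintro rfl; simp at hz
  rw [abs_div, abs_norm, div_lt_one (norm_pos_iff.2 h0)]
  exact Complex.abs_re_lt_norm.2 hz

/-- The asymmetry parameter is `r + 1/r - 2 cos θ` with `r = ‖z‖`. At a fixed argument it is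
therefore smallest exactly on the unit circle. -/
theorem normSq_one_sub_div_norm {z : ℂ} (hz : z ≠ 0) :
    Complex.normSq (1 - z) / ‖z‖ = 1 / ‖z‖ + ‖z‖ - 2 * (z.re / ‖z‖) := by
  have hn : 0 < ‖z‖ := norm_pos_iff.2 hz
  have h : Complex.normSq (1 - z) = 1 + ‖z‖ ^ 2 - 2 * z.re := by
    rw [← Complex.normSq_eq_norm_sq]
    simp [Complex.normSq_apply]
    ring
  rw [h]
  field_simp

/-- Making the angles at two of the vertices equal increases the volume. -/
theorem abs_idealVolume_le_normalize {z : ℂ} (hz : z.im ≠ 0) :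
    |idealVolume (normalForm z)| ≤ |idealVolume (normalForm (z / ‖z‖))| ∧
      (‖z‖ ≠ 1 → |idealVolume (normalForm z)| < |idealVolume (normalForm (z / ‖z‖))|) := by
  have h0 : z ≠ 0 := by rintro rfl; simp at hz
  have hn : 0 < ‖z‖ := norm_pos_iff.2 h0
  by_cases h1 : ‖z‖ = 1
  · simp [h1]
  suffices h : |idealVolume (normalForm z)| < |idealVolume (normalForm (z / ‖z‖))| from
    ⟨h.le, fun _ => h⟩
  have hu0 : z / ‖z‖ ≠ 0 := div_ne_zero h0 (by exact_mod_cast hn.ne')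
  have hun : ‖z / ‖z‖‖ = 1 := by
    rw [norm_div, Complex.norm_real, norm_norm, div_self hn.ne']
  have hure : (z / ‖z‖).re = z.re / ‖z‖ := Complex.div_ofReal_re z ‖z‖
  have huim : (z / ‖z‖).im = z.im / ‖z‖ := Complex.div_ofReal_im z ‖z‖
  have hc := abs_re_div_norm_lt_one hz
  rw [abs_idealVolume_normalForm h0, abs_idealVolume_normalForm hu0, normSq_one_sub_div_norm h0,
    normSq_one_sub_div_norm hu0, hun, hure, huim]
  simp only [div_one, mul_one]
  have hκ : 0 < 1 + 1 - 2 * (z.re / ‖z‖) := by linarith [abs_lt.1 hc]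
  have hκ' : 1 + 1 - 2 * (z.re / ‖z‖) < 1 / ‖z‖ + ‖z‖ - 2 * (z.re / ‖z‖) := by
    have : 0 < (‖z‖ - 1) ^ 2 / ‖z‖ := by
      have : ‖z‖ - 1 ≠ 0 := sub_ne_zero.2 h1
      positivity
    have e : (‖z‖ - 1) ^ 2 / ‖z‖ = 1 / ‖z‖ + ‖z‖ - 2 := by field_simp; ring
    linarith
  have hlt := (ENNReal.toReal_lt_toReal (simplexIntegral_lt_top hc (hκ.trans hκ')).ne
    (simplexIntegral_lt_top hc hκ).ne).2 (simplexIntegral_strictAnti hc hκ hκ')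
  have e : |z.im / ‖z‖| / 2 = |z.im| / (2 * ‖z‖) := by
    rw [abs_div, abs_norm]; field_simp
  rw [e]
  have : 0 < |z.im| / (2 * ‖z‖) := by positivity
  gcongr

/-! ## Cross ratios and the maximal volume -/

/-- The cross ratio of four points of `P(ℂ²)`, in homogeneous coordinates. -/
def crossRatio (y : Fin 4 → Fin 2 → ℂ) : ℂ :=
  bracket (y 0) (y 2) * bracket (y 1) (y 3) / (bracket (y 0) (y 3) * bracket (y 1) (y 2))

/-- Points with pairwise nonzero brackets are a normal form up to `GL(2, ℂ)` and scaling. -/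
theorem exists_eq_smul_normalForm {y : Fin 4 → Fin 2 → ℂ}
    (h : ∀ i j, i ≠ j → bracket (y i) (y j) ≠ 0) :
    ∃ (g : GL (Fin 2) ℂ) (c : Fin 4 → ℂ), (∀ i, c i ≠ 0) ∧
      y = fun i => c i • g.1.mulVec (normalForm (crossRatio y) i) := by
  have h01 := h 0 1 (by decide)
  have h02 := h 0 2 (by decide)
  have h03 := h 0 3 (by decide)
  have h12 := h 1 2 (by decide)
  set p := bracket (y 0) (y 1) with hp
  -- The columns are the multiples of `y 0` and `y 1`, found by Cramer's rule, whose sum is `y 2`;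
  -- so `∞, 0, 1` go to the first three lines.
  set M : Matrix (Fin 2) (Fin 2) ℂ :=
    !![-bracket (y 1) (y 2) / p * y 0 0, bracket (y 0) (y 2) / p * y 1 0;
      -bracket (y 1) (y 2) / p * y 0 1, bracket (y 0) (y 2) / p * y 1 1] with hM
  have hdet : M.det ≠ 0 := by
    have : M.det = -bracket (y 1) (y 2) / p * (bracket (y 0) (y 2) / p) * p := by
      have hp' : p = y 0 0 * y 1 1 - y 0 1 * y 1 0 := rfl
      rw [hM, Matrix.det_fin_two_of]
      linear_combination (bracket (y 1) (y 2) / p * (bracket (y 0) (y 2) / p)) * hp'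
    rw [this]
    exact mul_ne_zero (mul_ne_zero (div_ne_zero (neg_ne_zero.2 h12) h01) (div_ne_zero h02 h01)) h01
  refine ⟨Matrix.GeneralLinearGroup.mkOfDetNeZero M hdet,
    ![-p / bracket (y 1) (y 2), p / bracket (y 0) (y 2), 1,
      bracket (y 0) (y 3) / bracket (y 0) (y 2)], ?_, ?_⟩
  · intro i
    fin_cases i
    · exact div_ne_zero (neg_ne_zero.2 h01) h12
    · exact div_ne_zero h01 h02
    · exact one_ne_zero
    · exact div_ne_zero h03 h02
  · have hval : (Matrix.GeneralLinearGroup.mkOfDetNeZero M hdet).1 = M := rfl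
    rw [hval]
    funext i
    fin_cases i <;> ext l <;> fin_cases l
    all_goals
      simp only [hM, normalForm, crossRatio, Matrix.mulVec, dotProduct, Fin.sum_univ_two,
        Matrix.cons_val, Matrix.of_apply, Pi.smul_apply, smul_eq_mul, Fin.zero_eta, Fin.mk_one,
        Fin.reduceFinMk, Fin.isValue, mul_zero, mul_one, add_zero, zero_add, one_mul]
    all_goals field_simp
    all_goals simp only [hp, bracket]
    all_goals ring

theorem idealVolume_eq_normalForm {y : Fin 4 → Fin 2 → ℂ}
    (h : ∀ i j, i ≠ j → bracket (y i) (y j) ≠ 0) :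
    idealVolume y = idealVolume (normalForm (crossRatio y)) := by
  obtain ⟨g, c, hc, hy⟩ := exists_eq_smul_normalForm h
  nth_rewrite 1 [hy]
  rw [idealVolume_smul hc, idealVolume_mulVec]

theorem bracket_normalForm_ne_zero {z : ℂ} (h0 : z ≠ 0) (h1 : z ≠ 1) (i j : Fin 4) (hij : i ≠ j) :
    bracket (normalForm z i) (normalForm z j) ≠ 0 := by
  have h2 : 1 - z ≠ 0 := sub_ne_zero.2 h1.symm
  have h3 : z - 1 ≠ 0 := sub_ne_zero.2 h1
  fin_cases i <;> fin_cases j <;> simp [normalForm, bracket, h0, h2, h3] at hij ⊢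

theorem abs_idealVolume_perm (σ : Equiv.Perm (Fin 4)) (y : Fin 4 → Fin 2 → ℂ) :
    |idealVolume (fun i => y (σ i))| = |idealVolume y| := by
  rw [idealVolume_perm, abs_mul]
  rcases Int.units_eq_one_or (Equiv.Perm.sign σ) with h | h <;> simp [h]

/-- Rotating the three vertices other than `∞` changes the cross ratio from `z` to `1 / (1 - z)`.
This brings another dihedral angle into the role of the argument. -/
theorem abs_idealVolume_normalForm_rotate {z : ℂ} (h0 : z ≠ 0) (h1 : z ≠ 1) :
    |idealVolume (normalForm (1 / (1 - z)))| = |idealVolume (normalForm z)| := by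
  set σ : Equiv.Perm (Fin 4) := Equiv.swap 1 2 * Equiv.swap 2 3 with hσ
  have e0 : σ 0 = 0 := by decide
  have e1 : σ 1 = 2 := by decide
  have e2 : σ 2 = 3 := by decide
  have e3 : σ 3 = 1 := by decide
  have hcr : crossRatio (fun i => normalForm z (σ i)) = 1 / (1 - z) := by
    simp [crossRatio, e0, e1, e2, e3, normalForm, bracket]
  rw [← abs_idealVolume_perm σ (normalForm z), idealVolume_eq_normalForm
    (y := fun i => normalForm z (σ i)) fun i j hij =>
    bracket_normalForm_ne_zero h0 h1 _ _ (σ.injective.ne hij), hcr]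

/-- The vertex `ω = exp(iπ/3)` completing `∞, 0, 1` to a regular ideal simplex. -/
def omega : ℂ := Complex.exp ((Real.pi / 3 : ℝ) * Complex.I)

theorem im_exp_mul_I_pos {θ : ℝ} (h0 : 0 < θ) (h1 : θ < Real.pi) :
    0 < (Complex.exp (θ * Complex.I)).im := by
  rw [Complex.exp_ofReal_mul_I_im]
  exact Real.sin_pos_of_pos_of_lt_pi h0 h1

theorem mul_exp_div_norm {r φ : ℝ} (hr : 0 < r) :
    (r * Complex.exp (φ * Complex.I)) / ‖(r * Complex.exp (φ * Complex.I))‖ =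
      Complex.exp (φ * Complex.I) := by
  rw [norm_mul, Complex.norm_exp_ofReal_mul_I, Complex.norm_real, Real.norm_of_nonneg hr.le,
    mul_one, mul_div_cancel_left₀]
  exact_mod_cast hr.ne'

/-- In the isosceles triangle `0, 1, exp(iθ)` the base has length `2 sin(θ/2)` and the base angles
are `(π - θ)/2`. -/
theorem one_div_one_sub_exp {θ : ℝ} (h0 : 0 < θ) (h1 : θ < Real.pi) :
    1 / (1 - Complex.exp (θ * Complex.I)) =
      ((1 / (2 * Real.sin (θ / 2)) : ℝ) : ℂ) *
        Complex.exp (((Real.pi - θ) / 2 : ℝ) * Complex.I) := by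
  have hs : 0 < Real.sin (θ / 2) := Real.sin_pos_of_pos_of_lt_pi (by linarith) (by linarith)
  have key : (1 - Complex.exp (θ * Complex.I)) *
      Complex.exp (((Real.pi - θ) / 2 : ℝ) * Complex.I) = ((2 * Real.sin (θ / 2) : ℝ) : ℂ) := by
    have e1 : Real.cos ((Real.pi - θ) / 2) = Real.sin (θ / 2) := by
      rw [← Real.cos_pi_div_two_sub]; congr 1; ring
    have e2 : Real.sin ((Real.pi - θ) / 2) = Real.cos (θ / 2) := by
      rw [← Real.sin_pi_div_two_sub]; congr 1; ring
    have e3 : Real.cos θ = 1 - 2 * Real.sin (θ / 2) ^ 2 := by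
      rw [Real.sin_sq_eq_half_sub, mul_div_cancel₀ θ two_ne_zero]; ring
    have e4 : Real.sin θ = 2 * Real.sin (θ / 2) * Real.cos (θ / 2) := by
      rw [← Real.sin_two_mul, mul_div_cancel₀ θ two_ne_zero]
    have e5 := Real.sin_sq_add_cos_sq (θ / 2)
    apply Complex.ext
    · simp only [Complex.mul_re, Complex.sub_re, Complex.sub_im, Complex.one_re, Complex.one_im,
        Complex.exp_ofReal_mul_I_re, Complex.exp_ofReal_mul_I_im, Complex.ofReal_re, e1, e2, e3, e4]
      linear_combination (2 * Real.sin (θ / 2)) * e5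
    · simp only [Complex.mul_im, Complex.sub_re, Complex.sub_im, Complex.one_re, Complex.one_im,
        Complex.exp_ofReal_mul_I_re, Complex.exp_ofReal_mul_I_im, Complex.ofReal_im, e1, e2, e3, e4]
      ring
  have hne : ((2 * Real.sin (θ / 2) : ℝ) : ℂ) ≠ 0 := by
    exact_mod_cast (by positivity : (2 * Real.sin (θ / 2)) ≠ 0)
  have hne' : 1 - Complex.exp (θ * Complex.I) ≠ 0 := fun h => hne (by rw [← key, h, zero_mul])
  rw [Complex.ofReal_div, Complex.ofReal_one, div_mul_eq_mul_div, one_mul,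
    div_eq_div_iff hne' hne, ← key]
  ring

/-- Rotate, so that a base angle becomes the argument, and then make the simplex symmetric about
that angle; only the second move changes the volume. -/
theorem abs_idealVolume_exp_le_step {θ : ℝ} (h0 : 0 < θ) (h1 : θ < Real.pi) :
    |idealVolume (normalForm (Complex.exp (θ * Complex.I)))| ≤
      |idealVolume (normalForm (Complex.exp (((Real.pi - θ) / 2 : ℝ) * Complex.I)))| := by
  have him := im_exp_mul_I_pos h0 h1
  have hne1 : Complex.exp (θ * Complex.I) ≠ 1 := by intro h; simp [h] at him
  have hs : 0 < Real.sin (θ / 2) := Real.sin_pos_of_pos_of_lt_pi (by linarith) (by linarith)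
  rw [← abs_idealVolume_normalForm_rotate (Complex.exp_ne_zero _) hne1, one_div_one_sub_exp h0 h1]
  refine (abs_idealVolume_le_normalize ?_).1.trans (le_of_eq ?_)
  · rw [Complex.im_ofReal_mul]
    have := im_exp_mul_I_pos (θ := (Real.pi - θ) / 2) (by linarith) (by linarith)
    positivity
  · rw [mul_exp_div_norm (by positivity)]

/-- A crude bound, sharp at `c = 1/2`, whose right side is visibly continuous there. It replaces a
proof that the volume depends continuously on the angle. -/
theorem simplexIntegral_le_of_symmetric {c : ℝ} (hc : |c| < 1) :
    (simplexIntegral c (2 - 2 * c)).toReal ≤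
      1 / min 1 (2 - 2 * c) * (simplexIntegral (1 / 2) 1).toReal := by
  have hc1 := abs_lt.1 hc
  have hm : 0 < min 1 (2 - 2 * c) := lt_min one_pos (by linarith)
  have hfin : simplexIntegral (1 / 2) 1 < ⊤ :=
    simplexIntegral_lt_top (by rw [abs_of_pos] <;> norm_num) one_pos
  have h : simplexIntegral c (2 - 2 * c) ≤
      ENNReal.ofReal (1 / min 1 (2 - 2 * c)) * simplexIntegral (1 / 2) 1 := by
    rw [simplexIntegral, simplexIntegral,
      ← lintegral_const_mul _ (measurable_simplexIntegrand _ _).ennreal_ofReal]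
    refine setLIntegral_mono' (measurableSet_Ioi.prod measurableSet_Ioi) ?_
    rintro ⟨x, w⟩ ⟨hx, hw⟩
    have hx : 0 < x := hx
    have hw : 0 < w := hw
    rw [← ENNReal.ofReal_mul (by positivity)]
    refine ENNReal.ofReal_le_ofReal ?_
    simp only [simplexIntegrand]
    have e1 : x ^ 2 + 2 * c * x + 1 + (2 - 2 * c) * x * (1 + w) =
        (1 + x) ^ 2 + (2 - 2 * c) * (x * w) := by ring
    have e2 : x ^ 2 + 2 * (1 / 2) * x + 1 + 1 * x * (1 + w) = (1 + x) ^ 2 + x * w := by ring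
    rw [e1, e2, one_div_mul_one_div]
    refine one_div_le_one_div_of_le (by positivity) ?_
    have h1 : min 1 (2 - 2 * c) * (1 + x) ^ 2 ≤ 1 * (1 + x) ^ 2 := by
      gcongr; exact min_le_left _ _
    have h2 : min 1 (2 - 2 * c) * (x * w) ≤ (2 - 2 * c) * (x * w) := by
      gcongr; exact min_le_right _ _
    calc min 1 (2 - 2 * c) * ((1 + w) * ((1 + x) ^ 2 + x * w))
        = (1 + w) * (min 1 (2 - 2 * c) * (1 + x) ^ 2 + min 1 (2 - 2 * c) * (x * w)) := by ring
      _ ≤ (1 + w) * ((1 + x) ^ 2 + (2 - 2 * c) * (x * w)) := by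
        gcongr
        linarith
  have := ENNReal.toReal_mono (ENNReal.mul_lt_top ENNReal.ofReal_lt_top hfin).ne h
  rwa [ENNReal.toReal_mul, ENNReal.toReal_ofReal (by positivity)] at this

theorem abs_idealVolume_exp {θ : ℝ} (h0 : 0 < θ) (h1 : θ < Real.pi) :
    |idealVolume (normalForm (Complex.exp (θ * Complex.I)))| =
      Real.sin θ / 2 * (simplexIntegral (Real.cos θ) (2 - 2 * Real.cos θ)).toReal := by
  rw [abs_idealVolume_normalForm (Complex.exp_ne_zero _),
    normSq_one_sub_div_norm (Complex.exp_ne_zero _), Complex.norm_exp_ofReal_mul_I,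
    Complex.exp_ofReal_mul_I_re, Complex.exp_ofReal_mul_I_im,
    abs_of_pos (Real.sin_pos_of_pos_of_lt_pi h0 h1)]
  norm_num

/-- The map `θ ↦ (π - θ)/2` contracts towards `π/3` by the factor `-1/2`, and the volume does not
decrease along its orbit. A majorant continuous at `π/3` and exact there bounds the starting value.
-/
theorem abs_idealVolume_exp_le {θ : ℝ} (h0 : 0 < θ) (h1 : θ < Real.pi) :
    |idealVolume (normalForm (Complex.exp (θ * Complex.I)))| ≤
      |idealVolume (normalForm omega)| := by
  set ang : ℕ → ℝ := fun n => Real.pi / 3 + (-1 / 2) ^ n * (θ - Real.pi / 3) with hang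
  have hsucc : ∀ n, ang (n + 1) = (Real.pi - ang n) / 2 := by
    intro n
    simp only [hang, pow_succ]
    ring
  have hmem : ∀ n, 0 < ang n ∧ ang n < Real.pi := by
    intro n
    induction n with
    | zero => simp [hang, h0, h1]
    | succ n ih =>
      rw [hsucc]
      constructor <;> linarith [ih.1, ih.2]
  have hle : ∀ n, |idealVolume (normalForm (Complex.exp (θ * Complex.I)))| ≤
      |idealVolume (normalForm (Complex.exp (ang n * Complex.I)))| := by
    intro n
    induction n with
    | zero => simp [hang]
    | succ n ih =>
      rw [hsucc]
      exact ih.trans (abs_idealVolume_exp_le_step (hmem n).1 (hmem n).2)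
  set J0 := (simplexIntegral (1 / 2) 1).toReal
  -- At `φ = π/3` the minimum equals one, so the majorant takes the value of the regular simplex.
  set G : ℝ → ℝ := fun φ => Real.sin φ / 2 * (1 / min 1 (2 - 2 * Real.cos φ) * J0) with hG
  have hleG : ∀ n, |idealVolume (normalForm (Complex.exp (θ * Complex.I)))| ≤ G (ang n) := by
    intro n
    obtain ⟨ha, hb⟩ := hmem n
    refine (hle n).trans ?_
    rw [abs_idealVolume_exp ha hb]
    have hs := Real.sin_pos_of_pos_of_lt_pi ha hb
    refine mul_le_mul_of_nonneg_left (simplexIntegral_le_of_symmetric ?_) (by positivity)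
    have := im_exp_mul_I_pos ha hb
    have := abs_re_div_norm_lt_one this.ne'
    rwa [Complex.norm_exp_ofReal_mul_I, div_one, Complex.exp_ofReal_mul_I_re] at this
  have hpi := Real.pi_pos
  have hGω : G (Real.pi / 3) = |idealVolume (normalForm omega)| := by
    rw [omega, abs_idealVolume_exp (by linarith) (by linarith)]
    simp only [hG, Real.cos_pi_div_three]
    norm_num [J0]
  rw [← hGω]
  have hlim : Filter.Tendsto ang Filter.atTop (nhds (Real.pi / 3)) := by
    have := (tendsto_pow_atTop_nhds_zero_of_abs_lt_one (r := (-1 / 2 : ℝ))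
      (by rw [abs_lt]; constructor <;> norm_num)).mul_const (θ - Real.pi / 3)
    simpa [hang] using this.const_add (Real.pi / 3)
  have hcont : ContinuousAt G (Real.pi / 3) := by
    refine (Real.continuous_sin.div_const 2).continuousAt.mul (ContinuousAt.mul ?_ continuousAt_const)
    refine continuousAt_const.div (Continuous.continuousAt (by fun_prop)) ?_
    rw [Real.cos_pi_div_three]
    norm_num
  exact ge_of_tendsto' (hcont.tendsto.comp hlim) hleG

theorem omega_eq : omega = ⟨1 / 2, √3 / 2⟩ := by
  apply Complex.ext
  · rw [omega, Complex.exp_ofReal_mul_I_re, Real.cos_pi_div_three]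
  · rw [omega, Complex.exp_ofReal_mul_I_im, Real.sin_pi_div_three]

/-- The unit circles about `0` and `1` meet in exactly two points. -/
theorem eq_omega_iff {z : ℂ} :
    (z = omega ∨ z = (starRingEnd ℂ) omega) ↔ Complex.normSq z = 1 ∧ Complex.normSq (1 - z) = 1 := by
  have h3 : (√3 : ℝ) ^ 2 = 3 := Real.sq_sqrt (by norm_num)
  rw [omega_eq]
  constructor
  · rintro (rfl | rfl) <;>
    · simp [Complex.normSq_apply]
      constructor <;> nlinarith
  · rintro ⟨h1, h2⟩
    simp only [Complex.normSq_apply, Complex.sub_re, Complex.sub_im, Complex.one_re,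
      Complex.one_im] at h1 h2
    have hre : z.re = 1 / 2 := by nlinarith
    rw [hre] at h1
    have him : (z.im - √3 / 2) * (z.im + √3 / 2) = 0 := by nlinarith
    rcases mul_eq_zero.1 him with h | h
    · exact Or.inl (Complex.ext hre (by simp; linarith))
    · exact Or.inr (Complex.ext (by simpa using hre) (by simp; linarith))

theorem omega_im_pos : 0 < omega.im := by
  rw [omega_eq]; positivity

theorem idealVolume_normalForm_omega_pos : 0 < idealVolume (normalForm omega) := by
  have hpi := Real.pi_pos
  have h : 0 < |idealVolume (normalForm omega)| := by
    rw [omega, abs_idealVolume_exp (by linarith) (by linarith), Real.cos_pi_div_three]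
    have hc : |(1 / 2 : ℝ)| < 1 := by rw [abs_of_pos] <;> norm_num
    have h1 := ENNReal.toReal_pos (simplexIntegral_pos hc (κ := 2 - 2 * (1 / 2)) (by norm_num)).ne'
      (simplexIntegral_lt_top hc (by norm_num)).ne
    have := Real.sin_pos_of_pos_of_lt_pi (x := Real.pi / 3) (by linarith) (by linarith)
    positivity
  have h2 : 0 ≤ idealVolume (normalForm omega) := by
    rw [idealVolume_eq, det_normalForm]
    have := omega_im_pos
    positivity
  rwa [abs_of_nonneg h2] at h

theorem abs_idealVolume_normalForm_conj (z : ℂ) :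
    |idealVolume (normalForm ((starRingEnd ℂ) z))| = |idealVolume (normalForm z)| := by
  rcases eq_or_ne z 0 with rfl | hz
  · simp
  · have h : Complex.normSq (1 - (starRingEnd ℂ) z) = Complex.normSq (1 - z) := by
      simp [Complex.normSq_apply]
    rw [abs_idealVolume_normalForm hz, abs_idealVolume_normalForm (by simpa using hz), h]
    simp

theorem abs_idealVolume_normalForm_le_of_im_pos {z : ℂ} (hz : 0 < z.im) :
    |idealVolume (normalForm (z / ‖z‖))| ≤ |idealVolume (normalForm omega)| := by
  have h0 : z ≠ 0 := by rintro rfl; simp at hz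
  have hn : 0 < ‖z‖ := norm_pos_iff.2 h0
  have hs : 0 < Real.sin z.arg := by rw [Complex.sin_arg]; positivity
  have h1 : 0 < z.arg := by
    by_contra h
    exact hs.not_ge (Real.sin_nonpos_of_nonpos_of_neg_pi_le (not_lt.1 h) (Complex.neg_pi_lt_arg z).le)
  have h2 : z.arg < Real.pi := by
    refine lt_of_le_of_ne (Complex.arg_le_pi z) fun h => ?_
    rw [h, Real.sin_pi] at hs
    exact lt_irrefl _ hs
  have h3 : z / ‖z‖ = Complex.exp (z.arg * Complex.I) := by
    rw [div_eq_iff (by exact_mod_cast hn.ne'), mul_comm, Complex.norm_mul_exp_arg_mul_I]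
  rw [h3]
  exact abs_idealVolume_exp_le h1 h2

theorem idealVolume_normalForm_of_im_eq_zero {z : ℂ} (hz : z.im = 0) :
    idealVolume (normalForm z) = 0 :=
  idealVolume_of_det_eq_zero (by rw [det_normalForm, hz, zero_div])

theorem abs_idealVolume_normalize_le {z : ℂ} (hz : z.im ≠ 0) :
    |idealVolume (normalForm (z / ‖z‖))| ≤ |idealVolume (normalForm omega)| := by
  rcases lt_or_gt_of_ne hz with h | h
  · have h1 := abs_idealVolume_normalForm_le_of_im_pos (z := (starRingEnd ℂ) z) (by simpa using h)
    rw [← abs_idealVolume_normalForm_conj (z / ‖z‖)]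
    simpa using h1
  · exact abs_idealVolume_normalForm_le_of_im_pos h

theorem abs_idealVolume_normalForm_le (z : ℂ) :
    |idealVolume (normalForm z)| ≤ idealVolume (normalForm omega) := by
  rw [← abs_of_pos idealVolume_normalForm_omega_pos]
  rcases eq_or_ne z.im 0 with h | h
  · rw [idealVolume_normalForm_of_im_eq_zero h, abs_zero]
    exact abs_nonneg _
  · exact (abs_idealVolume_le_normalize h).1.trans (abs_idealVolume_normalize_le h)

theorem norm_eq_one_of_maximal {z : ℂ}
    (h : |idealVolume (normalForm z)| = idealVolume (normalForm omega)) :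
    z.im ≠ 0 ∧ ‖z‖ = 1 := by
  have him : z.im ≠ 0 := by
    intro h0
    rw [idealVolume_normalForm_of_im_eq_zero h0, abs_zero] at h
    exact idealVolume_normalForm_omega_pos.ne h
  refine ⟨him, ?_⟩
  by_contra hn
  have h1 := (abs_idealVolume_le_normalize him).2 hn
  have h2 := abs_idealVolume_normalize_le him
  rw [abs_of_pos idealVolume_normalForm_omega_pos] at h2
  linarith

/-- The volume of the ideal simplex `∞, 0, 1, z` is maximal exactly for `z = exp(±iπ/3)`. -/
theorem abs_idealVolume_normalForm_eq_iff {z : ℂ} :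
    |idealVolume (normalForm z)| = idealVolume (normalForm omega) ↔
      z = omega ∨ z = (starRingEnd ℂ) omega := by
  constructor
  · intro h
    obtain ⟨him, hn⟩ := norm_eq_one_of_maximal h
    have h0 : z ≠ 0 := by rintro rfl; simp at him
    have h1 : z ≠ 1 := by rintro rfl; simp at him
    -- The rotated simplex is maximal as well, which puts `1 - z` on the unit circle too.
    obtain ⟨-, hn'⟩ := norm_eq_one_of_maximal (z := 1 / (1 - z))
      ((abs_idealVolume_normalForm_rotate h0 h1).trans h)
    rw [eq_omega_iff, Complex.normSq_eq_norm_sq, Complex.normSq_eq_norm_sq, hn]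
    rw [norm_div, norm_one, one_div, inv_eq_one] at hn'
    rw [hn']
    norm_num
  · rintro (rfl | rfl)
    · exact abs_of_pos idealVolume_normalForm_omega_pos
    · rw [abs_idealVolume_normalForm_conj, abs_of_pos idealVolume_normalForm_omega_pos]

/-! ## The five-term relation -/

/-- By the Plücker relation the cross ratio is `B / (B - A)` with `A`, `B` as in `det_nullVector`,
and the imaginary part of `B * conj (B - A)` is that of `A * conj B`. -/
theorem crossRatio_im {y : Fin 4 → Fin 2 → ℂ} :
    (crossRatio y).im = 2 * (Matrix.of fun i => nullVector (y i)).det /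
      Complex.normSq (bracket (y 0) (y 3) * bracket (y 1) (y 2)) := by
  have hA := bracket_plucker (y 0) (y 1) (y 2) (y 3)
  rw [crossRatio, det_nullVector]
  have hA' : bracket (y 0) (y 3) * bracket (y 1) (y 2) =
      bracket (y 0) (y 2) * bracket (y 1) (y 3) - bracket (y 0) (y 1) * bracket (y 2) (y 3) := by
    linear_combination hA
  rw [hA']
  generalize bracket (y 0) (y 2) * bracket (y 1) (y 3) = B
  generalize bracket (y 0) (y 1) * bracket (y 2) (y 3) = A
  rw [Complex.div_im]
  simp only [Complex.sub_re, Complex.sub_im, Complex.mul_im, Complex.conj_re, Complex.conj_im]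
  ring

theorem bracket_ne_zero_of_det {y : Fin 4 → Fin 2 → ℂ}
    (h : (Matrix.of fun i => nullVector (y i)).det ≠ 0) (i j : Fin 4) (hij : i ≠ j) :
    bracket (y i) (y j) ≠ 0 :=
  fun h0 => h (det_nullVector_eq_zero hij h0)

theorem idealVolume_ne_zero {y : Fin 4 → Fin 2 → ℂ}
    (h : (Matrix.of fun i => nullVector (y i)).det ≠ 0) : idealVolume y ≠ 0 := by
  have hb := bracket_ne_zero_of_det h
  have him : (crossRatio y).im ≠ 0 := by
    rw [crossRatio_im]
    refine div_ne_zero (mul_ne_zero two_ne_zero h) ?_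
    simpa using ⟨hb 0 3 (by decide), hb 1 2 (by decide)⟩
  have h0 : crossRatio y ≠ 0 := by intro h0; simp [h0] at him
  have h1 : crossRatio y ≠ 1 := by intro h0; simp [h0] at him
  have hκ : 0 < Complex.normSq (1 - crossRatio y) / ‖crossRatio y‖ :=
    div_pos (Complex.normSq_pos.2 (sub_ne_zero.2 h1.symm)) (norm_pos_iff.2 h0)
  have hc := abs_re_div_norm_lt_one him
  rw [idealVolume_eq_normalForm hb, ← abs_pos, abs_idealVolume_normalForm h0]
  have := ENNReal.toReal_pos (simplexIntegral_pos hc hκ).ne' (simplexIntegral_lt_top hc hκ).ne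
  have := norm_pos_iff.2 h0
  positivity

/-- No new estimate is needed: `toReal` sends `⊤` to zero, whereas the ideal volume is already known
to be nonzero. -/
theorem volume_cone_idealSimplex_ne_top {y : Fin 4 → Fin 2 → ℂ}
    (h : (Matrix.of fun i => nullVector (y i)).det ≠ 0) :
    volume (Ioo (0 : ℝ) 1 • idealSimplex y) ≠ ⊤ := by
  intro htop
  apply idealVolume_ne_zero h
  rw [idealVolume, hyperbolicVolume, htop]
  simp

theorem measurableSet_cone_idealSimplex {y : Fin 4 → Fin 2 → ℂ}
    (h : (Matrix.of fun i => nullVector (y i)).det ≠ 0) :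
    MeasurableSet (Ioo (0 : ℝ) 1 • idealSimplex y) := by
  rw [cone_idealSimplex_eq_image]
  refine (measurableSet_coneRegion y).image_of_continuousOn_injOn
    (LinearMap.continuous_of_finiteDimensional _).continuousOn (Function.Injective.injOn ?_)
  have : Function.Injective ((Matrix.of fun i => nullVector (y i)).transpose).mulVec := by
    rw [Matrix.mulVec_injective_iff_isUnit, Matrix.isUnit_iff_isUnit_det, Matrix.det_transpose]
    exact h.isUnit
  exact this

/-- The signed count of the two ends of the interval of `τ` with `s - τ r ≥ 0`. -/
theorem sum_sign_mul_ite_eq_zero {ι : Type*} [Fintype ι] (r s : ι → ℝ) (hpos : ∃ i, 0 < r i)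
    (hneg : ∃ i, r i < 0) (hgen : ∀ (τ : ℝ) (i j : ι), s i = τ * r i → s j = τ * r j → i = j)
    [∀ i, Decidable (r i ≠ 0 ∧ ∀ j, 0 ≤ s j - s i / r i * r j)] :
    ∑ i, (SignType.sign (r i) : ℝ) *
      (if r i ≠ 0 ∧ ∀ j, 0 ≤ s j - s i / r i * r j then 1 else 0) = 0 := by
  classical
  set P : ι → Prop := fun i => r i ≠ 0 ∧ ∀ j, 0 ≤ s j - s i / r i * r j with hP
  -- One end of the segment forces the other. The factor `ε = ±1` lets the same argument treat both
  -- orientations of the line.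
  have hexists : ∀ (r' : ι → ℝ) (ε : ℝ), (∀ j, r' j = ε * r j) → ε ^ 2 = 1 →
      (∃ i, P i ∧ 0 < r' i) → (∃ i, r' i < 0) → ∃ i, P i ∧ r' i < 0 := by
    rintro r' ε hr' hε ⟨i, ⟨hi0, hi⟩, hi'⟩ hn
    have hε0 : ε ≠ 0 := by rintro rfl; simp at hε
    have hr : ∀ j, r j = ε * r' j := fun j => by rw [hr', ← mul_assoc, ← sq, hε, one_mul]
    have hτ : ∀ a b, s a / r a * r b = s a / r' a * r' b := by
      intro a b
      rw [hr a, hr b]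
      by_cases ha : r' a = 0
      · simp [ha]
      · field_simp
    -- Each negative coefficient bounds `τ` from below by `s j / r' j`; the largest of these bounds
    -- is the lower end.
    obtain ⟨k, hk, hmax⟩ := Finset.exists_max_image (Finset.univ.filter fun j => r' j < 0)
      (fun j => s j / r' j) (by obtain ⟨j, hj⟩ := hn; exact ⟨j, by simpa using hj⟩)
    simp only [Finset.mem_filter, Finset.mem_univ, true_and] at hk hmax
    refine ⟨k, ⟨by rw [hr]; exact mul_ne_zero hε0 hk.ne, fun j => ?_⟩, hk⟩
    have hij := hi j
    have hik := hi k
    rw [hτ] at hij hik ⊢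
    have hle : s k / r' k ≤ s i / r' i := by
      rw [div_le_iff_of_neg hk]; linarith
    rcases lt_trichotomy (r' j) 0 with h | h | h
    · have := hmax j h
      rw [div_le_iff_of_neg h] at this
      linarith
    · rw [h] at hij ⊢
      simpa using hij
    · have : s k / r' k * r' j ≤ s i / r' i * r' j := by gcongr
      linarith
  -- Two ends with coefficients of the same sign have the same parameter `τ`, and then two
  -- coordinates vanish at once, which `hgen` allows only for equal indices.
  have hunique : ∀ (ε : ℝ) i j, P i → P j → 0 < ε * r i → 0 < ε * r j → i = j := by
    rintro ε i j ⟨hi0, hi⟩ ⟨hj0, hj⟩ hi1 hj1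
    have key : ∀ a b, r a ≠ 0 → r b ≠ 0 → 0 ≤ s b - s a / r a * r b → 0 < ε * r b →
        ε * (s a / r a) * r b ^ 2 ≤ ε * (s b / r b) * r b ^ 2 := by
      intro a b ha hb h h1
      have : 0 ≤ (ε * r b) * (s b - s a / r a * r b) := mul_nonneg h1.le h
      have e : (ε * r b) * (s b - s a / r a * r b) =
          ε * (s b / r b) * r b ^ 2 - ε * (s a / r a) * r b ^ 2 := by field_simp
      linarith
    have h1 := le_of_mul_le_mul_right (key i j hi0 hj0 (hi j) hj1) (by positivity)
    have h2 := le_of_mul_le_mul_right (key j i hj0 hi0 (hj i) hi1) (by positivity)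
    have hε0 : ε ≠ 0 := by rintro rfl; simp at hi1
    have h3 : s i / r i = s j / r j := mul_left_cancel₀ hε0 (le_antisymm h1 h2)
    refine hgen (s i / r i) i j (by field_simp) ?_
    rw [h3]
    field_simp
  by_cases hE : ∃ i, P i
  swap
  · push Not at hE
    exact Finset.sum_eq_zero fun i _ => by rw [if_neg (hE i), mul_zero]
  have h1 : ∃ i, P i ∧ 0 < r i := by
    obtain ⟨i, hi⟩ := hE
    rcases lt_or_gt_of_ne hi.1 with h | h
    · obtain ⟨k, hk, hk'⟩ := hexists (fun j => -1 * r j) (-1) (fun _ => rfl) (by norm_num)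
        ⟨i, hi, by linarith⟩ (by obtain ⟨j, hj⟩ := hpos; exact ⟨j, by linarith⟩)
      exact ⟨k, hk, by linarith⟩
    · exact ⟨i, hi, h⟩
  have h2 : ∃ i, P i ∧ r i < 0 := hexists r 1 (fun _ => (one_mul _).symm) (by norm_num) h1 hneg
  obtain ⟨a, ha, ha'⟩ := h1
  obtain ⟨b, hb, hb'⟩ := h2
  have hab : a ≠ b := by rintro rfl; linarith
  rw [Fintype.sum_eq_add a b hab, if_pos ha, if_pos hb, sign_pos ha', sign_neg hb']
  · simp
  · rintro c ⟨hca, hcb⟩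
    by_cases hc : P c
    · exfalso
      rcases lt_or_gt_of_ne hc.1 with h | h
      · exact hcb (hunique (-1) c b hc hb (by linarith) (by linarith))
      · exact hca (hunique 1 c a hc ha (by linarith) (by linarith))
    · rw [if_neg hc, mul_zero]

/-- The coefficients of the linear relation between five vectors of `ℝ⁴`. -/
def relationCoeff (N : Fin 5 → Fin 4 → ℝ) (i : Fin 5) : ℝ :=
  (-1) ^ (i : ℕ) * (Matrix.of fun j => N (i.succAbove j)).det

/-- Repeat the `k`-th coordinate as an extra first column: the five by five determinant vanishes,
and its expansion along that column is the `k`-th component of the relation. -/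
theorem sum_relationCoeff_smul (N : Fin 5 → Fin 4 → ℝ) : ∑ i, relationCoeff N i • N i = 0 := by
  ext k
  have h : (Matrix.of fun i : Fin 5 => (Fin.cons (N i k) (N i) : Fin 5 → ℝ)).det = 0 :=
    Matrix.det_zero_of_column_eq (i := 0) (j := k.succ) (Fin.succ_ne_zero k).symm
      (fun i => by simp)
  rw [Matrix.det_succ_column_zero] at h
  rw [Finset.sum_apply, Pi.zero_apply, ← h]
  refine Finset.sum_congr rfl fun i _ => ?_
  simp only [relationCoeff, Pi.smul_apply, smul_eq_mul, Matrix.of_apply, Fin.cons_zero]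
  have : (Matrix.of fun i : Fin 5 => (Fin.cons (N i k) (N i) : Fin 5 → ℝ)).submatrix
      i.succAbove Fin.succ = Matrix.of fun j => N (i.succAbove j) := by
    ext a b
    simp
  rw [this]
  ring

theorem eq_of_sum_smul_eq {N : Fin 5 → Fin 4 → ℝ} {i : Fin 5}
    (hi : (Matrix.of fun j => N (i.succAbove j)).det ≠ 0) {s t : Fin 5 → ℝ} (hs : s i = t i)
    (h : ∑ j, s j • N j = ∑ j, t j • N j) : s = t := by
  have hli : LinearIndependent ℝ fun j => N (i.succAbove j) :=
    Matrix.linearIndependent_rows_of_det_ne_zero hi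
  rw [Fin.sum_univ_succAbove _ i, Fin.sum_univ_succAbove _ i, hs, add_right_inj] at h
  have h2 := Fintype.linearIndependent_iff.1 hli (fun j => s (i.succAbove j) - t (i.succAbove j))
    (by simp only [sub_smul, Finset.sum_sub_distrib, h, sub_self])
  funext l
  rcases Fin.eq_self_or_eq_succAbove i l with rfl | ⟨j, rfl⟩
  · exact hs
  · exact sub_eq_zero.1 (h2 j)

/-- Only three vectors remain, too few to span `ℝ⁴`. Outside these null sets no solution has two
vanishing coordinates. -/
theorem volume_span_pair_compl_eq_zero (N : Fin 5 → Fin 4 → ℝ) {i k : Fin 5} (hik : i ≠ k) :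
    volume (Submodule.span ℝ (range fun j : {j : Fin 5 // j ≠ i ∧ j ≠ k} => N j) :
      Set (Fin 4 → ℝ)) = 0 := by
  refine Measure.addHaar_submodule _ _ fun h => ?_
  have h1 := finrank_range_le_card (R := ℝ) (fun j : {j : Fin 5 // j ≠ i ∧ j ≠ k} => N j)
  rw [Set.finrank, h, finrank_top, Module.finrank_fin_fun] at h1
  have h2 : ∀ i k : Fin 5, i ≠ k → Fintype.card {j : Fin 5 // j ≠ i ∧ j ≠ k} = 3 := by decide
  rw [h2 i k hik] at h1
  omega

theorem nullVector_pos {v : Fin 2 → ℂ} (hv : v ≠ 0) : 0 < nullVector v 3 := by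
  refine lt_of_le_of_ne (nullVector_nonneg v) fun h => hv ?_
  simp only [nullVector, Matrix.cons_val] at h
  have h0 := Complex.normSq_nonneg (v 0)
  have h1 := Complex.normSq_nonneg (v 1)
  ext i
  fin_cases i
  · exact Complex.normSq_eq_zero.1 (by show Complex.normSq (v 0) = 0; linarith)
  · exact Complex.normSq_eq_zero.1 (by show Complex.normSq (v 1) = 0; linarith)

/-- The signed indicator functions of the five cones add up to zero almost everywhere. The
representations of a generic point by the five null vectors form a line, the nonnegative ones a
segment. Lying in the `i`-th cone means that an end of the segment has `i`-th coordinate zero, and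
the two ends carry opposite signs. -/
theorem sum_idealVolume_succAbove {w : Fin 5 → Fin 2 → ℂ} (hw : ∀ i, w i ≠ 0) :
    ∑ i : Fin 5, (-1) ^ (i : ℕ) * idealVolume (fun j => w (i.succAbove j)) = 0 := by
  classical
  set N : Fin 5 → Fin 4 → ℝ := fun i => nullVector (w i) with hN
  set r := relationCoeff N with hr
  have hrel : ∑ i, r i • N i = 0 := sum_relationCoeff_smul N
  by_cases hr0 : ∀ i, r i = 0
  · refine Finset.sum_eq_zero fun i _ => ?_
    have : (Matrix.of fun j => nullVector (w (i.succAbove j))).det = 0 := by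
      have := hr0 i
      simp only [hr, relationCoeff] at this
      rcases mul_eq_zero.1 this with h | h
      · exact absurd h (by positivity)
      · exact h
    rw [idealVolume_of_det_eq_zero this, mul_zero]
  push Not at hr0
  obtain ⟨i₀, hi₀⟩ := hr0
  have hdet : ∀ i, r i ≠ 0 → (Matrix.of fun j => N (i.succAbove j)).det ≠ 0 :=
    fun i h h0 => h (by rw [hr, relationCoeff, h0, mul_zero])
  -- the relation has coefficients of both signs
  have hsum : ∑ i, r i * N i 3 = 0 := by
    have := congrFun hrel 3
    simpa using this
  have hNpos : ∀ i, 0 < N i 3 := fun i => nullVector_pos (hw i)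
  have hpos : ∃ i, 0 < r i := by
    by_contra! h
    have h1 := (Finset.sum_eq_zero_iff_of_nonpos fun i _ =>
      mul_nonpos_of_nonpos_of_nonneg (h i) (hNpos i).le).1 hsum i₀ (Finset.mem_univ _)
    exact hi₀ ((mul_eq_zero.1 h1).resolve_right (hNpos i₀).ne')
  have hneg : ∃ i, r i < 0 := by
    by_contra! h
    have h1 := (Finset.sum_eq_zero_iff_of_nonneg fun i _ =>
      mul_nonneg (h i) (hNpos i).le).1 hsum i₀ (Finset.mem_univ _)
    exact hi₀ ((mul_eq_zero.1 h1).resolve_right (hNpos i₀).ne')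
  -- A degenerate simplex carries the sign zero anyway; taking its cone to be empty keeps all five
  -- sets measurable and of finite volume.
  set A : Fin 5 → Set (Fin 4 → ℝ) := fun i =>
    if r i = 0 then ∅ else Ioo (0 : ℝ) 1 • idealSimplex fun j => w (i.succAbove j) with hA
  have hAm : ∀ i, MeasurableSet (A i) := by
    intro i
    simp only [hA]
    split_ifs with h
    · exact MeasurableSet.empty
    · exact measurableSet_cone_idealSimplex (hdet i h)
  have hAfin : ∀ i, volume (A i) ≠ ⊤ := by
    intro i
    simp only [hA]
    split_ifs with h
    · simp
    · exact volume_cone_idealSimplex_ne_top (hdet i h)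
  have hterm : ∀ i : Fin 5, (-1) ^ (i : ℕ) * idealVolume (fun j => w (i.succAbove j)) =
      4 * ∫ Y, (SignType.sign (r i) : ℝ) * (A i).indicator 1 Y := by
    intro i
    rw [integral_const_mul, integral_indicator_one (hAm i), Measure.real]
    by_cases h : r i = 0
    · have : (Matrix.of fun j => nullVector (w (i.succAbove j))).det = 0 := by
        simp only [hr, relationCoeff] at h
        exact (mul_eq_zero.1 h).resolve_left (by positivity)
      rw [idealVolume_of_det_eq_zero this, h]
      simp
    · simp only [hA, if_neg h, idealVolume, hyperbolicVolume, ENNReal.toReal_mul]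
      have hs : (SignType.sign (r i) : ℝ) = (-1) ^ (i : ℕ) *
          (SignType.sign (Matrix.of fun j => nullVector (w (i.succAbove j))).det : ℝ) := by
        simp only [hr, relationCoeff, sign_mul, hN]
        rcases neg_one_pow_eq_or ℝ (i : ℕ) with h | h <;> simp [h]
      rw [hs, show (ENNReal.toReal 4) = 4 by simp]
      ring
  simp only [hterm]
  rw [← Finset.mul_sum, ← integral_finsetSum]
  swap
  · intro i _
    exact ((integrable_indicator_iff (hAm i)).2
      (integrableOn_const (hs := hAfin i))).const_mul _
  rw [integral_eq_zero_of_ae, mul_zero]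
  have hbad : ∀ᵐ Y : Fin 4 → ℝ, ∀ p : {p : Fin 5 × Fin 5 // p.1 ≠ p.2},
      Y ∉ Submodule.span ℝ (range fun j : {j : Fin 5 // j ≠ p.1.1 ∧ j ≠ p.1.2} => N j) := by
    rw [ae_all_iff]
    intro p
    exact measure_eq_zero_iff_ae_notMem.1 (volume_span_pair_compl_eq_zero N p.2)
  filter_upwards [hbad] with Y hY
  -- a solution of `∑ s i • N i = Y`
  obtain ⟨s, hs⟩ : ∃ s : Fin 5 → ℝ, ∑ i, s i • N i = Y := by
    have hli : LinearIndependent ℝ fun j => N (i₀.succAbove j) :=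
      Matrix.linearIndependent_rows_of_det_ne_zero (hdet i₀ hi₀)
    have hspan := hli.span_eq_top_of_card_eq_finrank' (by simp)
    have hmem : Y ∈ Submodule.span ℝ (range fun j => N (i₀.succAbove j)) := by
      rw [hspan]; trivial
    obtain ⟨c, hc⟩ := (Submodule.mem_span_range_iff_exists_fun ℝ).1 hmem
    refine ⟨i₀.insertNth (α := fun _ => ℝ) 0 c, ?_⟩
    rw [Fin.sum_univ_succAbove _ i₀]
    simpa using hc
  have hsτ : ∀ τ : ℝ, ∑ i, (s i - τ * r i) • N i = Y := by
    intro τ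
    simp only [sub_smul, mul_smul, Finset.sum_sub_distrib, hs, ← Finset.smul_sum, hrel]
    simp
  -- Two vanishing coordinates would put `Y` in the span of the other three null vectors, which was
  -- excluded.
  have hgen : ∀ (τ : ℝ) (i j : Fin 5), s i = τ * r i → s j = τ * r j → i = j := by
    intro τ i j hi hj
    by_contra hij
    refine hY ⟨(i, j), hij⟩ ?_
    rw [← hsτ τ]
    refine Submodule.sum_mem _ fun l _ => ?_
    by_cases hl : l ≠ i ∧ l ≠ j
    · exact Submodule.smul_mem _ _ (Submodule.subset_span ⟨⟨l, hl⟩, rfl⟩)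
    · have : s l - τ * r l = 0 := by
        rw [not_and_or, not_not, not_not] at hl
        rcases hl with rfl | rfl <;> linarith
      rw [this, zero_smul]
      exact Submodule.zero_mem _
  by_cases hL : 0 < lorentz Y ∧ lorentz Y < 1
  swap
  · refine Finset.sum_eq_zero fun i _ => ?_
    rw [indicator_of_notMem, mul_zero]
    simp only [hA]
    split_ifs with h
    · simp
    · rw [mem_cone_idealSimplex]
      exact fun h => hL h.1
  -- The representation of `Y` without the `i`-th null vector is the point `τ = s i / r i` of the
  -- line.
  have hmemA : ∀ i, Y ∈ A i ↔ (r i ≠ 0 ∧ ∀ j, 0 ≤ s j - s i / r i * r j) := by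
    intro i
    simp only [hA]
    split_ifs with h
    · simp [h]
    rw [mem_cone_idealSimplex]
    constructor
    · rintro ⟨-, t, ht, hYt⟩
      refine ⟨h, ?_⟩
      have h1 : (i.insertNth (α := fun _ => ℝ) 0 t) = fun j => s j - s i / r i * r j := by
        refine eq_of_sum_smul_eq (N := N) (hdet i h) ?_ ?_
        · simp only [Fin.insertNth_apply_same]
          field_simp
          simp
        · rw [hsτ, hYt, Fin.sum_univ_succAbove _ i]
          simp [hN]
      intro j
      have h2 := congrFun h1 j
      rw [← h2]
      rcases Fin.eq_self_or_eq_succAbove i j with rfl | ⟨l, rfl⟩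
      · simp
      · simpa using ht l
    · rintro ⟨-, hj⟩
      refine ⟨hL, fun j => s (i.succAbove j) - s i / r i * r (i.succAbove j), fun j => hj _, ?_⟩
      rw [← hsτ (s i / r i), Fin.sum_univ_succAbove _ i]
      have : s i - s i / r i * r i = 0 := by field_simp; simp
      rw [this, zero_smul, zero_add]
  have := sum_sign_mul_ite_eq_zero r s hpos hneg hgen
  rw [Pi.zero_apply, ← this]
  refine Finset.sum_congr rfl fun i _ => ?_
  congr 1
  simp only [indicator, hmemA, Pi.one_apply]

/-! ## Regular ideal simplices -/

theorem abs_idealVolume_le (y : Fin 4 → Fin 2 → ℂ) :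
    |idealVolume y| ≤ idealVolume (normalForm omega) := by
  by_cases h : ∀ i j, i ≠ j → bracket (y i) (y j) ≠ 0
  · rw [idealVolume_eq_normalForm h]
    exact abs_idealVolume_normalForm_le _
  · push Not at h
    obtain ⟨i, j, hij, h0⟩ := h
    rw [idealVolume_eq_zero hij h0, abs_zero]
    exact idealVolume_normalForm_omega_pos.le

theorem normalForm_ne_zero (z : ℂ) (i : Fin 4) : normalForm z i ≠ 0 := by
  intro h
  have h0 := congrFun h 0
  have h1 := congrFun h 1
  fin_cases i <;> simp [normalForm] at h0 h1

theorem volH3_mk {y : Fin 4 → Fin 2 → ℂ} (hy : ∀ i, y i ≠ 0) :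
    volH3 (fun i => Projectivization.mk ℂ (y i) (hy i)) = idealVolume y := by
  have h : ∀ i, ∃ a : ℂˣ, a • y i = (Projectivization.mk ℂ (y i) (hy i)).rep :=
    fun i => Projectivization.exists_smul_eq_mk_rep ℂ (y i) (hy i)
  choose a ha using h
  rw [volH3]
  simp only [← ha]
  exact idealVolume_smul (c := fun i => (a i : ℂ)) (fun i => (a i).ne_zero) y

theorem v3_eq : v3 = idealVolume (normalForm omega) := by
  refine IsGreatest.csSup_eq ⟨⟨_, volH3_mk (normalForm_ne_zero omega)⟩, ?_⟩
  rintro _ ⟨ξ, rfl⟩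
  exact (le_abs_self _).trans (abs_idealVolume_le _)

theorem v3_pos : 0 < v3 := v3_eq ▸ idealVolume_normalForm_omega_pos

theorem abs_idealVolume_eq_v3_iff {y : Fin 4 → Fin 2 → ℂ} :
    |idealVolume y| = v3 ↔ (∀ i j, i ≠ j → bracket (y i) (y j) ≠ 0) ∧
      (crossRatio y = omega ∨ crossRatio y = (starRingEnd ℂ) omega) := by
  constructor
  · intro h
    have h0 : idealVolume y ≠ 0 := by
      intro h0
      rw [h0, abs_zero] at h
      exact v3_pos.ne h
    have hb : ∀ i j, i ≠ j → bracket (y i) (y j) ≠ 0 :=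
      fun i j hij => bracket_ne_zero_of_idealVolume h0 hij
    rw [idealVolume_eq_normalForm hb, v3_eq] at h
    exact ⟨hb, abs_idealVolume_normalForm_eq_iff.1 h⟩
  · rintro ⟨hb, h⟩
    rw [idealVolume_eq_normalForm hb, v3_eq]
    exact abs_idealVolume_normalForm_eq_iff.2 h

/-- Maximality leaves only `omega` and its conjugate, and the sign of the volume tells these two
apart. -/
theorem crossRatio_eq_of_idealVolume_eq {y y' : Fin 4 → Fin 2 → ℂ} (h : |idealVolume y| = v3)
    (h' : idealVolume y = idealVolume y') : crossRatio y = crossRatio y' := by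
  have hneg : idealVolume (normalForm ((starRingEnd ℂ) omega)) ≤ 0 := by
    rw [idealVolume_eq, det_normalForm, Complex.conj_im]
    have := omega_im_pos
    refine mul_nonpos_of_nonpos_of_nonneg (by linarith) (by positivity)
  have hpos := idealVolume_normalForm_omega_pos
  obtain ⟨hb, hz⟩ := abs_idealVolume_eq_v3_iff.1 h
  obtain ⟨hb', hz'⟩ := abs_idealVolume_eq_v3_iff.1 (h' ▸ h)
  rw [idealVolume_eq_normalForm hb, idealVolume_eq_normalForm hb'] at h'
  rcases hz with hz | hz <;> rcases hz' with hz' | hz' <;> rw [hz, hz'] at h' ⊢ <;> linarith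

theorem bracket_eq_zero_iff {v w : Fin 2 → ℂ} (hv : v ≠ 0) (hw : w ≠ 0) :
    bracket v w = 0 ↔ ∃ a : ℂˣ, a • w = v := by
  constructor
  · intro h
    simp only [bracket] at h
    by_cases h0 : w 0 = 0
    · have h1 : w 1 ≠ 0 := fun h1 => hw (by ext i; fin_cases i <;> simp [h0, h1])
      have hv0 : v 0 = 0 := by simpa [h0, h1] using h
      have hv1 : v 1 ≠ 0 := fun h1 => hv (by ext i; fin_cases i <;> simp [hv0, h1])
      refine ⟨Units.mk0 (v 1 / w 1) (div_ne_zero hv1 h1), ?_⟩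
      ext i
      fin_cases i <;> simp [Units.smul_def, h0, hv0, h1]
    · have hv0 : v 0 ≠ 0 := by
        intro hv0
        have : v 1 = 0 := by simpa [hv0, h0] using h
        exact hv (by ext i; fin_cases i <;> simp [hv0, this])
      refine ⟨Units.mk0 (v 0 / w 0) (div_ne_zero hv0 h0), ?_⟩
      ext i
      fin_cases i
      · simp [Units.smul_def, h0]
      · simp only [Units.smul_def, Units.val_mk0, Fin.mk_one, Pi.smul_apply, smul_eq_mul]
        field_simp
        linear_combination h
  · rintro ⟨a, rfl⟩
    simp only [bracket, Units.smul_def, Pi.smul_apply, smul_eq_mul]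
    ring

theorem bracket_smul_smul (a b : ℂ) (v w : Fin 2 → ℂ) :
    bracket (a • v) (b • w) = a * b * bracket v w := by
  simp only [bracket, Pi.smul_apply, smul_eq_mul]; ring

theorem crossRatio_smul {c : Fin 4 → ℂ} (hc : ∀ i, c i ≠ 0) (y : Fin 4 → Fin 2 → ℂ) :
    crossRatio (fun i => c i • y i) = crossRatio y := by
  simp only [crossRatio, bracket_smul_smul]
  rw [show c 0 * c 2 * bracket (y 0) (y 2) * (c 1 * c 3 * bracket (y 1) (y 3)) =
    (c 0 * c 1 * c 2 * c 3) * (bracket (y 0) (y 2) * bracket (y 1) (y 3)) by ring,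
    show c 0 * c 3 * bracket (y 0) (y 3) * (c 1 * c 2 * bracket (y 1) (y 2)) =
    (c 0 * c 1 * c 2 * c 3) * (bracket (y 0) (y 3) * bracket (y 1) (y 2)) by ring,
    mul_div_mul_left]
  have h0 := hc 0
  have h1 := hc 1
  have h2 := hc 2
  have h3 := hc 3
  positivity

/-- A semilinear map of `ℂ²` multiplies brackets by a constant. -/
theorem exists_bracket_semilinear {σ : ℂ →+* ℂ} (g : (Fin 2 → ℂ) →ₛₗ[σ] (Fin 2 → ℂ)) :
    ∃ d : ℂ, ∀ v w, bracket (g v) (g w) = d * σ (bracket v w) := by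
  refine ⟨bracket (g ![1, 0]) (g ![0, 1]), fun v w => ?_⟩
  have hv : ∀ v : Fin 2 → ℂ, g v = σ (v 0) • g ![1, 0] + σ (v 1) • g ![0, 1] := by
    intro v
    rw [← map_smulₛₗ, ← map_smulₛₗ, ← map_add]
    congr 1
    ext i
    fin_cases i <;> simp
  rw [hv v, hv w]
  simp only [bracket, Pi.add_apply, Pi.smul_apply, smul_eq_mul, map_sub, map_mul]
  ring

theorem crossRatio_semilinear {σ : ℂ →+* ℂ} (g : (Fin 2 → ℂ) →ₛₗ[σ] (Fin 2 → ℂ))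
    (y : Fin 4 → Fin 2 → ℂ) (h : bracket (g (y 0)) (g (y 1)) ≠ 0) :
    crossRatio (fun i => g (y i)) = σ (crossRatio y) := by
  obtain ⟨d, hd⟩ := exists_bracket_semilinear g
  have hd0 : d ≠ 0 := by
    rintro rfl
    rw [hd, zero_mul] at h
    exact h rfl
  simp only [crossRatio, hd, map_div₀, map_mul]
  simp only [mul_mul_mul_comm d _ d _]
  rw [mul_div_mul_left]
  exact mul_ne_zero hd0 hd0

theorem bracket_rep_ne_zero {ξ ξ' : ℙ ℂ (Fin 2 → ℂ)} (h : ξ ≠ ξ') :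
    bracket ξ.rep ξ'.rep ≠ 0 := by
  intro h0
  apply h
  rw [← ξ.mk_rep, ← ξ'.mk_rep, Projectivization.mk_eq_mk_iff]
  exact (bracket_eq_zero_iff ξ.rep_nonzero ξ'.rep_nonzero).1 h0

/-- The representatives of image points are known only up to scalars, which cancel in the cross
ratio; a semilinear map acts on it through its field homomorphism. -/
theorem crossRatio_of_isBoundaryIsometry {ξ : Fin 4 → ℙ ℂ (Fin 2 → ℂ)}
    (hξ : Function.Injective ξ) {σ : Equiv.Perm (Fin 4)}
    {f : ℙ ℂ (Fin 2 → ℂ) → ℙ ℂ (Fin 2 → ℂ)} (hf : IsBoundaryIsometry f)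
    (h : ∀ i, f (ξ i) = ξ (σ i)) :
    crossRatio (fun i => (ξ (σ i)).rep) = crossRatio (fun i => (ξ i).rep) ∨
      crossRatio (fun i => (ξ (σ i)).rep) =
        (starRingEnd ℂ) (crossRatio fun i => (ξ i).rep) := by
  have key : ∀ (τ : ℂ →+* ℂ) (g : (Fin 2 → ℂ) →ₛₗ[τ] (Fin 2 → ℂ)) (hg : Function.Injective g),
      (∀ i, Projectivization.map g hg (ξ i) = ξ (σ i)) →
      crossRatio (fun i => (ξ (σ i)).rep) = τ (crossRatio fun i => (ξ i).rep) := by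
    intro τ g hg hmap
    have h1 : ∀ i, ∃ a : ℂˣ, a • (ξ (σ i)).rep = g (ξ i).rep := by
      intro i
      have h2 := hmap i
      rw [← (ξ i).mk_rep, Projectivization.map_mk, ← (ξ (σ i)).mk_rep,
        Projectivization.mk_eq_mk_iff] at h2
      simpa using h2
    choose a ha using h1
    have hne : bracket (g (ξ 0).rep) (g (ξ 1).rep) ≠ 0 := by
      rw [← ha, ← ha, Units.smul_def, Units.smul_def, bracket_smul_smul]
      refine mul_ne_zero (mul_ne_zero (a 0).ne_zero (a 1).ne_zero) (bracket_rep_ne_zero ?_)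
      exact hξ.ne (σ.injective.ne (by decide))
    rw [← crossRatio_semilinear g (fun i => (ξ i).rep) hne]
    simp only [← ha]
    exact (crossRatio_smul (c := fun i => (a i : ℂ)) (fun i => (a i).ne_zero) _).symm
  rcases hf with ⟨g, rfl⟩ | ⟨g, rfl⟩
  · exact Or.inl (key _ g.toLinearMap g.injective h)
  · exact Or.inr (key _ g.toLinearMap g.injective h)

/-- Complex conjugation of the coordinates. -/
def conjEquiv : (Fin 2 → ℂ) ≃ₛₗ[starRingEnd ℂ] (Fin 2 → ℂ) where
  toFun v i := (starRingEnd ℂ) (v i)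
  invFun v i := (starRingEnd ℂ) (v i)
  map_add' v w := by ext; simp
  map_smul' c v := by ext; simp
  left_inv v := by ext; simp
  right_inv v := by ext; simp

theorem conjEquiv_normalForm (z : ℂ) (i : Fin 4) :
    conjEquiv (normalForm z i) = normalForm ((starRingEnd ℂ) z) i := by
  ext l
  fin_cases i <;> fin_cases l <;> simp [conjEquiv, normalForm]

/-- Pass from either quadruple to its normal form. The two normal forms are equal or exchanged by
complex conjugation of the coordinates. -/
theorem exists_isBoundaryIsometry {ξ ξ' : Fin 4 → ℙ ℂ (Fin 2 → ℂ)}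
    (hξ : ∀ i j, i ≠ j → bracket (ξ i).rep (ξ j).rep ≠ 0)
    (hξ' : ∀ i j, i ≠ j → bracket (ξ' i).rep (ξ' j).rep ≠ 0)
    (h : crossRatio (fun i => (ξ' i).rep) = crossRatio (fun i => (ξ i).rep) ∨
      crossRatio (fun i => (ξ' i).rep) = (starRingEnd ℂ) (crossRatio fun i => (ξ i).rep)) :
    ∃ f, IsBoundaryIsometry f ∧ ∀ i, f (ξ i) = ξ' i := by
  obtain ⟨g, c, hc, hy⟩ := exists_eq_smul_normalForm hξ
  obtain ⟨g', c', hc', hy'⟩ := exists_eq_smul_normalForm hξ'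
  set z := crossRatio fun i => (ξ i).rep
  set z' := crossRatio fun i => (ξ' i).rep
  have hg : ∀ i, (glEquiv g).symm (ξ i).rep = c i • normalForm z i := by
    intro i
    rw [LinearEquiv.symm_apply_eq, map_smul, glEquiv_apply]
    exact congrFun hy i
  have hg' : ∀ i, (ξ' i).rep = c' i • glEquiv g' (normalForm z' i) := fun i => congrFun hy' i
  have key : ∀ (τ : ℂ →+* ℂ) (k : (Fin 2 → ℂ) →ₛₗ[τ] (Fin 2 → ℂ)) (hk : Function.Injective k),
      (∀ i, k (ξ i).rep = τ (c i) • glEquiv g' (normalForm z' i)) →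
      ∀ i, Projectivization.map k hk (ξ i) = ξ' i := by
    intro τ k hk hki i
    have h0 : τ (c i) / c' i ≠ 0 := div_ne_zero (by simpa using hc i) (hc' i)
    have h1 : Projectivization.map k hk (Projectivization.mk ℂ (ξ i).rep (ξ i).rep_nonzero) =
        Projectivization.mk ℂ (ξ' i).rep (ξ' i).rep_nonzero := by
      rw [Projectivization.map_mk, Projectivization.mk_eq_mk_iff]
      refine ⟨Units.mk0 _ h0, ?_⟩
      rw [Units.smul_def, Units.val_mk0, hki, hg' i, smul_smul, div_mul_cancel₀ _ (hc' i)]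
    simpa using h1
  rcases h with h | h
  · refine ⟨_, Or.inl ⟨(glEquiv g).symm.trans (glEquiv g'), rfl⟩, key _ _ _ fun i => ?_⟩
    simp [hg, h]
  · refine ⟨_, Or.inr ⟨((glEquiv g).symm.trans conjEquiv).trans (glEquiv g'), rfl⟩,
      key _ _ _ fun i => ?_⟩
    simp only [LinearEquiv.coe_coe, LinearEquiv.trans_apply, hg, map_smulₛₗ, conjEquiv_normalForm,
      h]
    rfl

theorem crossRatio_swap_two_three (y : Fin 4 → Fin 2 → ℂ) :
    crossRatio (fun i => y (Equiv.swap 2 3 i)) = (crossRatio y)⁻¹ := by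
  have e0 : (Equiv.swap 2 3 : Equiv.Perm (Fin 4)) 0 = 0 := by decide
  have e1 : (Equiv.swap 2 3 : Equiv.Perm (Fin 4)) 1 = 1 := by decide
  have e2 : (Equiv.swap 2 3 : Equiv.Perm (Fin 4)) 2 = 3 := by decide
  have e3 : (Equiv.swap 2 3 : Equiv.Perm (Fin 4)) 3 = 2 := by decide
  simp only [crossRatio, e0, e1, e2, e3, inv_div]

theorem crossRatio_swap_one_two {y : Fin 4 → Fin 2 → ℂ} (h03 : bracket (y 0) (y 3) ≠ 0)
    (h12 : bracket (y 1) (y 2) ≠ 0) :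
    crossRatio (fun i => y (Equiv.swap 1 2 i)) = 1 - crossRatio y := by
  have e0 : (Equiv.swap 1 2 : Equiv.Perm (Fin 4)) 0 = 0 := by decide
  have e1 : (Equiv.swap 1 2 : Equiv.Perm (Fin 4)) 1 = 2 := by decide
  have e2 : (Equiv.swap 1 2 : Equiv.Perm (Fin 4)) 2 = 1 := by decide
  have e3 : (Equiv.swap 1 2 : Equiv.Perm (Fin 4)) 3 = 3 := by decide
  simp only [crossRatio, e0, e1, e2, e3]
  rw [bracket_swap (y 1) (y 2)]
  field_simp
  linear_combination (-1 : ℂ) * bracket_plucker (y 0) (y 1) (y 2) (y 3)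

/-- Two transpositions of vertices send the cross ratio `z` to `1/z` and to `1 - z`, and an isometry
fixes or conjugates `z`. The fixed cases are contradictory, so `‖z‖ = 1` and `1 - z = conj z`, which
gives `z = exp(±iπ/3)`. Conversely, for these values every permuted simplex is again maximal, so its
cross ratio is `z` or `conj z`. -/
theorem isRegularIdealSimplex_iff {ξ : Fin 4 → ℙ ℂ (Fin 2 → ℂ)} :
    IsRegularIdealSimplex ξ ↔ |volH3 ξ| = v3 := by
  rw [volH3, abs_idealVolume_eq_v3_iff]
  set y : Fin 4 → Fin 2 → ℂ := fun i => (ξ i).rep with hy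
  constructor
  · rintro ⟨hinj, hσ⟩
    have hb : ∀ i j, i ≠ j → bracket (y i) (y j) ≠ 0 := fun i j hij =>
      bracket_rep_ne_zero (hinj.ne hij)
    refine ⟨hb, eq_omega_iff.2 ?_⟩
    obtain ⟨f, hf, hfξ⟩ := hσ (Equiv.swap 2 3)
    have h1 := crossRatio_of_isBoundaryIsometry hinj hf hfξ
    obtain ⟨f', hf', hfξ'⟩ := hσ (Equiv.swap 1 2)
    have h2 := crossRatio_of_isBoundaryIsometry hinj hf' hfξ'
    have e1 := crossRatio_swap_two_three y
    have e2 := crossRatio_swap_one_two (y := y) (hb 0 3 (by decide)) (hb 1 2 (by decide))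
    have e3 : crossRatio y ≠ 0 := div_ne_zero
      (mul_ne_zero (hb 0 2 (by decide)) (hb 1 3 (by decide)))
      (mul_ne_zero (hb 0 3 (by decide)) (hb 1 2 (by decide)))
    have e4 : 1 - crossRatio y ≠ 0 := by
      rw [← e2]
      exact div_ne_zero
        (mul_ne_zero (hb _ _ (by decide)) (hb _ _ (by decide)))
        (mul_ne_zero (hb _ _ (by decide)) (hb _ _ (by decide)))
    simp only [hy] at e1 e2 e3 e4 ⊢
    rw [e1] at h1
    rw [e2] at h2
    set z := crossRatio fun i => (ξ i).rep
    rcases h1 with h1 | h1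
    · exfalso
      have h3 : (z - 1) * (z + 1) = 0 := by
        have : z * z = 1 := by nth_rewrite 1 [← h1]; exact inv_mul_cancel₀ e3
        linear_combination this
      have h4 : z = -1 := by
        rcases mul_eq_zero.1 h3 with h | h
        · exact absurd (by linear_combination -h) e4
        · linear_combination h
      rw [h4] at h2
      norm_num at h2
    · have h3 : Complex.normSq z = 1 := by
        have : ((Complex.normSq z : ℝ) : ℂ) = 1 := by
          rw [← Complex.mul_conj, ← h1, mul_inv_cancel₀ e3]
        exact_mod_cast this
      refine ⟨h3, ?_⟩
      rcases h2 with h2 | h2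
      · exfalso
        have h4 : z = 1 / 2 := by linear_combination (-1 / 2 : ℂ) * h2
        rw [h4] at h3
        norm_num [Complex.normSq_apply] at h3
      · rw [h2, Complex.normSq_conj, h3]
  · rintro ⟨hb, hz⟩
    have habs : |idealVolume y| = v3 := abs_idealVolume_eq_v3_iff.2 ⟨hb, hz⟩
    refine ⟨fun i j hij => ?_, fun σ => ?_⟩
    · by_contra hne
      exact hb i j hne (by simp only [hij, bracket_self])
    · obtain ⟨hb', hz'⟩ := abs_idealVolume_eq_v3_iff.1 ((abs_idealVolume_perm σ y).trans habs)
      refine exists_isBoundaryIsometry (ξ' := fun i => ξ (σ i)) hb hb' ?_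
      rcases hz with hz | hz <;> rcases hz' with hz' | hz' <;>
        simp only [hy] at hz hz' <;> simp [hz', hz]

/-! ## The function `Vol` on configurations -/

/-- The case distinction in `Vol` is immaterial, because `idealVolume` already vanishes when some
vector is zero. -/
theorem Vol_mk_two (x : Spanning 3 2) : Vol (Config.mk x) = idealVolume x.1 := by
  classical
  have h : Vol (Config.mk x) = if ∀ i, x.1 i ≠ 0 then idealVolume x.1 else 0 := by
    simp only [Vol, Config.mk, Quotient.lift_mk]
  rw [h]
  split_ifs with h0
  · rfl
  · push Not at h0
    obtain ⟨i, hi⟩ := h0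
    obtain ⟨j, hj⟩ := exists_ne i
    refine (idealVolume_eq_zero hj.symm ?_).symm
    simp [bracket, hi]

theorem Vol_mk_of_ne {m : ℕ} (hm : m ≠ 2) (x : Spanning 3 m) : Vol (Config.mk x) = 0 := by
  match m, hm, x with
  | 0, _, _ => rfl
  | 1, _, _ => rfl
  | _ + 3, _, _ => rfl

section Vol

variable {V : Type*} [AddCommGroup V] [Module ℂ V]

theorem Vol_of_finrank_ne {x : Fin 4 → V}
    (h : Module.finrank ℂ (Submodule.span ℂ (range x)) ≠ 2) : Vol (Config.of x) = 0 :=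
  Vol_mk_of_ne h _

theorem eq_smul_add_smul_of_bracket {v w : Fin 2 → ℂ} (h : bracket v w ≠ 0) (u : Fin 2 → ℂ) :
    u = (bracket u w / bracket v w) • v + (bracket v u / bracket v w) • w := by
  ext i
  simp only [Pi.add_apply, Pi.smul_apply, smul_eq_mul]
  field_simp
  fin_cases i <;> simp [bracket] <;> ring

theorem span_eq_top_of_bracket {ι : Type*} {y : ι → Fin 2 → ℂ} {i j : ι}
    (h : bracket (y i) (y j) ≠ 0) : Submodule.span ℂ (range y) = ⊤ := by
  refine eq_top_iff.2 fun u _ => ?_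
  rw [eq_smul_add_smul_of_bracket h u]
  exact Submodule.add_mem _ (Submodule.smul_mem _ _ (Submodule.subset_span ⟨i, rfl⟩))
    (Submodule.smul_mem _ _ (Submodule.subset_span ⟨j, rfl⟩))

theorem exists_bracket_ne_zero {ι : Type*} {y : ι → Fin 2 → ℂ}
    (h : Submodule.span ℂ (range y) = ⊤) : ∃ i j, bracket (y i) (y j) ≠ 0 := by
  by_contra! h0
  have h1 : ∀ u v, bracket u v = 0 := by
    have key : ∀ u : Fin 2 → ℂ, (∀ i, bracket (y i) u = 0) → ∀ v, bracket v u = 0 := by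
      intro u hu v
      have hv : v ∈ Submodule.span ℂ (range y) := by rw [h]; trivial
      induction hv using Submodule.span_induction with
      | mem x hx => obtain ⟨i, rfl⟩ := hx; exact hu i
      | zero => simp [bracket]
      | add a b _ _ ha hb =>
        simp only [bracket, Pi.add_apply] at ha hb ⊢
        linear_combination ha + hb
      | smul c a _ ha =>
        simp only [bracket, Pi.smul_apply, smul_eq_mul] at ha ⊢
        linear_combination c * ha
    intro u v
    refine key v (fun i => ?_) u
    rw [bracket_swap, key (y i) (fun j => h0 j i) v, neg_zero]
  simpa [bracket] using h1 ![1, 0] ![0, 1]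

/-- No spanning hypothesis is needed: vectors that fail to span `ℂ²` give zero on both sides. -/
theorem Vol_of (y : Fin 4 → Fin 2 → ℂ) : Vol (Config.of y) = idealVolume y := by
  by_cases h : Submodule.span ℂ (range y) = ⊤
  · rw [← Config.mk_eq_of ⟨y, h⟩, Vol_mk_two]
  · rw [Vol_of_finrank_ne fun h2 => h (Submodule.eq_top_of_finrank_eq (by simpa using h2))]
    by_contra h0
    exact h (span_eq_top_of_bracket
      (bracket_ne_zero_of_idealVolume (Ne.symm h0) (i := 0) (j := 1) (by decide)))

theorem Vol_of_eq {x : Fin 4 → V} {y : Fin 4 → Fin 2 → ℂ}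
    (h : ∀ c : Fin 4 → ℂ, ∑ i, c i • x i = 0 ↔ ∑ i, c i • y i = 0) :
    Vol (Config.of x) = idealVolume y := by
  rw [Config.of_eq_of x y h, Vol_of]

theorem exists_coordinates {k : ℕ} {x : Fin (k + 1) → V}
    (h : Module.finrank ℂ (Submodule.span ℂ (range x)) = 2) :
    ∃ y : Fin (k + 1) → Fin 2 → ℂ, Submodule.span ℂ (range y) = ⊤ ∧
      ∀ c : Fin (k + 1) → ℂ, ∑ i, c i • x i = 0 ↔ ∑ i, c i • y i = 0 := by
  obtain ⟨m, y, hy⟩ : ∃ (m : ℕ) (y : Spanning k m), m = 2 ∧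
      ∀ c : Fin (k + 1) → ℂ, ∑ i, c i • y.1 i = 0 ↔ ∑ i, c i • x i = 0 :=
    ⟨_, spanCoord x, h, sum_spanCoord_eq_zero_iff x⟩
  obtain ⟨rfl, hy⟩ := hy
  exact ⟨y.1, y.2, fun c => (hy c).symm⟩

theorem exists_coordinates_of_Vol_ne_zero {x : Fin 4 → V} (h : Vol (Config.of x) ≠ 0) :
    ∃ y : Fin 4 → Fin 2 → ℂ, (∀ i j, i ≠ j → bracket (y i) (y j) ≠ 0) ∧
      (∀ c : Fin 4 → ℂ, ∑ i, c i • x i = 0 ↔ ∑ i, c i • y i = 0) ∧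
      Vol (Config.of x) = idealVolume y := by
  have h2 : Module.finrank ℂ (Submodule.span ℂ (range x)) = 2 := by
    by_contra h2
    exact h (Vol_of_finrank_ne h2)
  obtain ⟨y, -, hy⟩ := exists_coordinates h2
  have hV := Vol_of_eq hy
  exact ⟨y, fun i j hij => bracket_ne_zero_of_idealVolume (hV ▸ h) hij, hy, hV⟩

theorem sum_single_add_single_smul {ι : Type*} [Fintype ι] [DecidableEq ι] (x : ι → V) (a b : ι)
    (α β : ℂ) : ∑ i, (Pi.single a α + Pi.single b β : ι → ℂ) i • x i = α • x a + β • x b := by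
  simp [add_smul, Finset.sum_add_distrib, Pi.single_apply, ite_smul]

/-- If the volume does not vanish, any two of the vectors are linearly independent. -/
theorem eq_zero_of_Vol_ne_zero {x : Fin 4 → V} (h : Vol (Config.of x) ≠ 0) {a b : Fin 4}
    (hab : a ≠ b) {α β : ℂ} (h0 : α • x a + β • x b = 0) : α = 0 ∧ β = 0 := by
  obtain ⟨y, hb, hy, -⟩ := exists_coordinates_of_Vol_ne_zero h
  rw [← sum_single_add_single_smul, hy, sum_single_add_single_smul] at h0
  have h1 := hb a b hab
  have e0 := congrFun h0 0
  have e1 := congrFun h0 1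
  simp only [Pi.add_apply, Pi.smul_apply, smul_eq_mul, Pi.zero_apply] at e0 e1
  constructor
  · refine (mul_eq_zero.1 (?_ : α * bracket (y a) (y b) = 0)).resolve_right h1
    simp only [bracket]
    linear_combination (y b 1) * e0 - (y b 0) * e1
  · refine (mul_eq_zero.1 (?_ : β * bracket (y a) (y b) = 0)).resolve_right h1
    simp only [bracket]
    linear_combination -(y a 1) * e0 + (y a 0) * e1

/-- If the volume does not vanish, any two of the vectors span the others. -/
theorem exists_eq_of_Vol_ne_zero {x : Fin 4 → V} (h : Vol (Config.of x) ≠ 0) {a b : Fin 4}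
    (hab : a ≠ b) (c : Fin 4) : ∃ α β : ℂ, x c = α • x a + β • x b := by
  obtain ⟨y, hb, hy, -⟩ := exists_coordinates_of_Vol_ne_zero h
  set α := bracket (y c) (y b) / bracket (y a) (y b)
  set β := bracket (y a) (y c) / bracket (y a) (y b)
  have h1 : y c = α • y a + β • y b := eq_smul_add_smul_of_bracket (hb a b hab) (y c)
  refine ⟨α, β, ?_⟩
  have h2 := (hy (Pi.single c 1 - (Pi.single a α + Pi.single b β))).2 (by
    simp only [Pi.sub_apply, sub_smul, Finset.sum_sub_distrib, sum_single_add_single_smul, ← h1]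
    simp [Pi.single_apply, ite_smul])
  simp only [Pi.sub_apply, sub_smul, Finset.sum_sub_distrib, sum_single_add_single_smul] at h2
  simpa [Pi.single_apply, ite_smul, sub_eq_zero] using h2

theorem ne_zero_of_Vol_ne_zero {x : Fin 4 → V} (h : Vol (Config.of x) ≠ 0) (a : Fin 4) :
    x a ≠ 0 := by
  intro h0
  obtain ⟨b, hb⟩ := exists_ne a
  exact one_ne_zero (eq_zero_of_Vol_ne_zero h hb.symm (α := 1) (β := 0) (by simp [h0])).1

theorem abs_Vol_le (τ : Config 3) : |Vol τ| ≤ v3 := by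
  obtain ⟨m, x, -, rfl⟩ := τ.exists_of
  by_cases h : Vol (Config.of x) = 0
  · rw [h, abs_zero]
    exact v3_pos.le
  · obtain ⟨y, -, -, hV⟩ := exists_coordinates_of_Vol_ne_zero h
    rw [hV, v3_eq]
    exact abs_idealVolume_le y

theorem isAltConfig_Vol : IsAltConfig Vol := by
  intro σ τ
  obtain ⟨m, x, -, rfl⟩ := τ.exists_of
  rw [Config.perm_of]
  have key : ∀ {W : Type} [AddCommGroup W] [Module ℂ W] (z : Fin 4 → W) (c : Fin 4 → ℂ),
      ∑ i, c i • z (σ i) = ∑ i, c (σ.symm i) • z i := by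
    intro W _ _ z c
    rw [← Equiv.sum_comp σ (fun i => c (σ.symm i) • z i)]
    simp
  have hrange : range (fun i => x (σ i)) = range x := σ.surjective.range_comp x
  by_cases h2 : Module.finrank ℂ (Submodule.span ℂ (range x)) = 2
  · obtain ⟨y, -, hy⟩ := exists_coordinates h2
    rw [Vol_of_eq hy, Vol_of_eq (x := fun i => x (σ i)) (y := fun i => y (σ i)), idealVolume_perm]
    intro c
    rw [key, key, hy]
  · rw [Vol_of_finrank_ne h2, Vol_of_finrank_ne (x := fun i => x (σ i)) (by rwa [hrange]), mul_zero]

/-- The volume does not change if the vectors are rescaled. -/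
theorem Vol_of_smul (x : Fin 4 → V) {c : Fin 4 → ℂ} (hc : ∀ i, c i ≠ 0) :
    Vol (Config.of fun i => c i • x i) = Vol (Config.of x) := by
  have hspan : Submodule.span ℂ (range fun i => c i • x i) = Submodule.span ℂ (range x) := by
    apply le_antisymm <;> rw [Submodule.span_le] <;> rintro _ ⟨i, rfl⟩
    · exact Submodule.smul_mem _ _ (Submodule.subset_span ⟨i, rfl⟩)
    · exact (Submodule.smul_mem_iff _ (hc i)).1 (Submodule.subset_span ⟨i, rfl⟩)
  by_cases h2 : Module.finrank ℂ (Submodule.span ℂ (range x)) = 2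
  · obtain ⟨y, -, hy⟩ := exists_coordinates h2
    rw [Vol_of_eq hy, Vol_of_eq (x := fun i => c i • x i) (y := fun i => c i • y i),
      idealVolume_smul hc]
    intro d
    simp only [smul_smul]
    exact hy fun i => d i * c i
  · rw [Vol_of_finrank_ne h2, Vol_of_finrank_ne (x := fun i => c i • x i) (by rwa [hspan])]

end Vol

/-! ## Gale duality and the cocycle relation for `Vol` -/

/-- Pair `∑ m, w m ⊗ y m = 0` with `w i` in the first factor and `y j` in the second. The terms `m =
i` and `m = j` vanish, and two are left. -/
theorem bracket_gale {y w : Fin 4 → Fin 2 → ℂ} (h : ∀ a b, ∑ j, w j a * y j b = 0)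
    {i j k l : Fin 4} (hij : i ≠ j) (hik : i ≠ k) (hil : i ≠ l) (hjk : j ≠ k) (hjl : j ≠ l)
    (hkl : k ≠ l) :
    bracket (w i) (w k) * bracket (y k) (y j) + bracket (w i) (w l) * bracket (y l) (y j) = 0 := by
  have hsum : ∑ m, bracket (w i) (w m) * bracket (y m) (y j) = 0 := by
    have e : ∀ m, bracket (w i) (w m) * bracket (y m) (y j) =
        w i 0 * y j 1 * (w m 1 * y m 0) - w i 0 * y j 0 * (w m 1 * y m 1) -
        w i 1 * y j 1 * (w m 0 * y m 0) + w i 1 * y j 0 * (w m 0 * y m 1) := by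
      intro m
      simp only [bracket]
      ring
    simp only [e, Finset.sum_add_distrib, Finset.sum_sub_distrib, ← Finset.mul_sum, h]
    ring
  have huniv : (Finset.univ : Finset (Fin 4)) = {i, j, k, l} := by
    have : ∀ i j k l : Fin 4, i ≠ j → i ≠ k → i ≠ l → j ≠ k → j ≠ l → k ≠ l →
        (Finset.univ : Finset (Fin 4)) = {i, j, k, l} := by decide
    exact this i j k l hij hik hil hjk hjl hkl
  rw [huniv, Finset.sum_insert (by simp [hij, hik, hil]), Finset.sum_insert (by simp [hjk, hjl]),
    Finset.sum_insert (by simp [hkl]), Finset.sum_singleton, bracket_self, bracket_self] at hsum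
  linear_combination hsum

/-- Through `bracket_gale` one vanishing bracket of `y` at an index spreads to all brackets at that
index, and from there to all brackets. -/
theorem bracket_ne_zero_of_gale {y w : Fin 4 → Fin 2 → ℂ} (h : ∀ a b, ∑ j, w j a * y j b = 0)
    (hw : ∀ i j, i ≠ j → bracket (w i) (w j) ≠ 0) (hy : ∃ i j, bracket (y i) (y j) ≠ 0)
    (j k : Fin 4) (hjk : j ≠ k) : bracket (y j) (y k) ≠ 0 := by
  have step : ∀ j k l : Fin 4, j ≠ k → j ≠ l → bracket (y j) (y k) = 0 →
      bracket (y j) (y l) = 0 := by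
    intro j k l hjk hjl h0
    rcases eq_or_ne k l with rfl | hkl
    · exact h0
    obtain ⟨i, hij, hik, hil⟩ : ∃ i, i ≠ j ∧ i ≠ k ∧ i ≠ l := by
      have : ∀ j k l : Fin 4, ∃ i, i ≠ j ∧ i ≠ k ∧ i ≠ l := by decide
      exact this j k l
    have h1 := bracket_gale h hij hik hil hjk hjl hkl
    rw [bracket_swap (y j) (y k), h0, neg_zero, mul_zero, zero_add] at h1
    rw [bracket_swap, (mul_eq_zero.1 h1).resolve_left (hw i l hil), neg_zero]
  intro h0
  obtain ⟨a, b, hab⟩ := hy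
  have hne : a ≠ b := by rintro rfl; exact hab (bracket_self _)
  have hj : ∀ l, j ≠ l → bracket (y j) (y l) = 0 := fun l hl => step j k l hjk hl h0
  by_cases haj : a = j
  · exact hab (haj ▸ hj b (haj ▸ hne))
  · refine hab (step a j b haj hne ?_)
    rw [bracket_swap, hj a (Ne.symm haj), neg_zero]

/-- Gale dual configurations of four points have the same volume. -/
theorem idealVolume_eq_of_gale {y w : Fin 4 → Fin 2 → ℂ} (h : ∀ a b, ∑ j, w j a * y j b = 0)
    (hy : ∃ i j, bracket (y i) (y j) ≠ 0) (hw : ∃ i j, bracket (w i) (w j) ≠ 0) :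
    idealVolume y = idealVolume w := by
  have h' : ∀ a b, ∑ j, y j a * w j b = 0 := by
    intro a b
    rw [← h b a]
    exact Finset.sum_congr rfl fun _ _ => mul_comm _ _
  by_cases hwb : ∀ i j, i ≠ j → bracket (w i) (w j) ≠ 0
  · have hyb := bracket_ne_zero_of_gale h hwb hy
    rw [idealVolume_eq_normalForm hyb, idealVolume_eq_normalForm hwb]
    congr 2
    have h1 := bracket_gale h (i := 0) (j := 1) (k := 2) (l := 3) (by decide) (by decide)
      (by decide) (by decide) (by decide) (by decide)
    have h2 := bracket_gale h (i := 1) (j := 0) (k := 2) (l := 3) (by decide) (by decide)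
      (by decide) (by decide) (by decide) (by decide)
    rw [bracket_swap (y 1) (y 2), bracket_swap (y 1) (y 3)] at h1
    rw [bracket_swap (y 0) (y 2), bracket_swap (y 0) (y 3)] at h2
    have hw03 := hwb 0 3 (by decide)
    have hw12 := hwb 1 2 (by decide)
    have hy03 := hyb 0 3 (by decide)
    have hy12 := hyb 1 2 (by decide)
    rw [crossRatio, crossRatio, div_eq_div_iff (mul_ne_zero hy03 hy12) (mul_ne_zero hw03 hw12)]
    linear_combination (bracket (y 0) (y 3) * bracket (w 1) (w 3)) * h1 -
      (bracket (y 1) (y 3) * bracket (w 0) (w 3)) * h2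
  · by_cases hyb : ∀ i j, i ≠ j → bracket (y i) (y j) ≠ 0
    · exact absurd (bracket_ne_zero_of_gale h' hyb hw) hwb
    · push Not at hyb hwb
      obtain ⟨i, j, hij, h0⟩ := hyb
      obtain ⟨i', j', hij', h0'⟩ := hwb
      rw [idealVolume_eq_zero hij h0, idealVolume_eq_zero hij' h0']

section Cocycle

variable {m : ℕ}

/-- If the classes with and without the `j`-th vector agree and all other faces have zero volume,
the alternating sum vanishes. -/
theorem configD_eq_zero_of_face {f : Config 3 → ℝ} {τ : Config 4} (j : Fin 5)
    (hj : τ.eps j = τ.eta j) (he : ∀ i, i ≠ j → f (τ.eps i) = 0)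
    (hη : ∀ i, i ≠ j → f (τ.eta i) = 0) : configD f τ = 0 := by
  rw [configD, ← Finset.sum_sub_distrib]
  refine Finset.sum_eq_zero fun i _ => ?_
  by_cases hi : i = j
  · rw [hi, hj, sub_self]
  · rw [he i hi, hη i hi]
    simp

/-- Dropping a zero vector and dividing by it are the same operation, and every other face still
contains a zero vector. -/
theorem configD_Vol_of_eq_zero (x : Fin 5 → Fin m → ℂ) {j : Fin 5} (hj : x j = 0) :
    configD Vol (Config.of x) = 0 := by
  have hex : ∀ i, i ≠ j → ∃ l, (i.succAbove l) = j := fun i hi => Fin.exists_succAbove_eq hi.symm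
  refine configD_eq_zero_of_face j ?_ (fun i hi => ?_) fun i hi => ?_
  · rw [Config.eps_of, Config.eta_of]
    refine Config.of_eq_of _ _ fun c => ?_
    rw [sum_succAbove_smul, sum_smul_mkQ_eq_zero_iff]
    simp [Fin.sum_univ_succAbove _ j, hj]
  · by_contra h
    obtain ⟨l, hl⟩ := hex i hi
    rw [Config.eps_of] at h
    exact ne_zero_of_Vol_ne_zero h l (by rw [hl, hj])
  · by_contra h
    obtain ⟨l, hl⟩ := hex i hi
    rw [Config.eta_of] at h
    exact ne_zero_of_Vol_ne_zero h l (by rw [hl, hj, map_zero])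

/-- The span of the other vectors embeds into the quotient by `x j`, so the two `j`-th faces agree.
In any other face a nonzero volume would express `x j` through two of the remaining vectors, modulo
at most a third. -/
theorem configD_Vol_of_notMem (x : Fin 5 → Fin m → ℂ) {j : Fin 5}
    (hj : x j ∉ Submodule.span ℂ (range fun l => x (j.succAbove l))) :
    configD Vol (Config.of x) = 0 := by
  have hmem : ∀ a, a ≠ j → x a ∈ Submodule.span ℂ (range fun l => x (j.succAbove l)) := by
    intro a ha
    obtain ⟨l, rfl⟩ := Fin.exists_succAbove_eq ha
    exact Submodule.subset_span ⟨l, rfl⟩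
  have hex : ∀ i, i ≠ j → ∃ l a b, i.succAbove l = j ∧ a ≠ b ∧ i.succAbove a ≠ j ∧
      i.succAbove b ≠ j := by
    intro i hi
    obtain ⟨l, rfl⟩ := Fin.exists_succAbove_eq hi.symm
    have h : ∀ l : Fin 4, ∃ a b, a ≠ b ∧ a ≠ l ∧ b ≠ l := by decide
    obtain ⟨a, b, hab, ha, hb⟩ := h l
    exact ⟨l, a, b, rfl, hab, Fin.succAbove_right_injective.ne ha,
      Fin.succAbove_right_injective.ne hb⟩
  refine configD_eq_zero_of_face j ?_ (fun i hi => ?_) fun i hi => ?_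
  · rw [Config.eps_of, Config.eta_of]
    refine Config.of_eq_of _ _ fun c => ?_
    rw [sum_smul_mkQ_eq_zero_iff]
    simp only [Fin.sum_univ_succAbove _ j, Fin.insertNth_apply_same,
      Fin.insertNth_apply_succAbove]
    constructor
    · intro h
      exact ⟨0, by rw [zero_smul, zero_add, h]⟩
    · rintro ⟨a, ha⟩
      have hsum : ∑ l, c l • x (j.succAbove l) ∈
          Submodule.span ℂ (range fun l => x (j.succAbove l)) :=
        Submodule.sum_mem _ fun l _ => Submodule.smul_mem _ _ (Submodule.subset_span ⟨l, rfl⟩)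
      by_cases ha0 : a = 0
      · rwa [ha0, zero_smul, zero_add] at ha
      · refine absurd ((Submodule.smul_mem_iff _ ha0).1 ?_) hj
        rw [eq_neg_of_add_eq_zero_left ha]
        exact Submodule.neg_mem _ hsum
  · by_contra h
    obtain ⟨l, a, b, hl, hab, ha, hb⟩ := hex i hi
    rw [Config.eps_of] at h
    obtain ⟨α, β, he⟩ := exists_eq_of_Vol_ne_zero h hab l
    rw [hl] at he
    exact hj (he ▸ Submodule.add_mem _ (Submodule.smul_mem _ _ (hmem _ ha))
      (Submodule.smul_mem _ _ (hmem _ hb)))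
  · by_contra h
    obtain ⟨l, a, b, hl, hab, ha, hb⟩ := hex i hi
    rw [Config.eta_of] at h
    obtain ⟨α, β, he⟩ := exists_eq_of_Vol_ne_zero h hab l
    rw [hl, ← map_smul, ← map_smul, ← map_add, ← sub_eq_zero, ← map_sub, Submodule.mkQ_apply,
      Submodule.Quotient.mk_eq_zero, Submodule.mem_span_singleton] at he
    obtain ⟨γ, hγ⟩ := he
    have : x j = γ • x i + (α • x (i.succAbove a) + β • x (i.succAbove b)) := by rw [hγ]; abel
    exact hj (this ▸ Submodule.add_mem _ (Submodule.smul_mem _ _ (hmem _ hi))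
      (Submodule.add_mem _ (Submodule.smul_mem _ _ (hmem _ ha))
        (Submodule.smul_mem _ _ (hmem _ hb))))

theorem span_succAbove_eq_top {x : Fin 5 → Fin m → ℂ} (hx : Submodule.span ℂ (range x) = ⊤)
    {j : Fin 5} (hj : x j ∈ Submodule.span ℂ (range fun l => x (j.succAbove l))) :
    Submodule.span ℂ (range fun l => x (j.succAbove l)) = ⊤ := by
  rw [eq_top_iff, ← hx, Submodule.span_le]
  rintro _ ⟨a, rfl⟩
  rcases Fin.eq_self_or_eq_succAbove j a with rfl | ⟨l, rfl⟩
  · exact hj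
  · exact Submodule.subset_span ⟨l, rfl⟩

theorem span_mkQ_succAbove_eq_top {x : Fin 5 → Fin m → ℂ} {U : Submodule ℂ (Fin m → ℂ)} {j : Fin 5}
    (h : Submodule.span ℂ (range fun l => x (j.succAbove l)) = ⊤) :
    Submodule.span ℂ (range fun l => U.mkQ (x (j.succAbove l))) = ⊤ := by
  have h2 := congrArg (Submodule.map U.mkQ) h
  rwa [Submodule.map_span, ← range_comp, Submodule.map_top, Submodule.range_mkQ] at h2

theorem finrank_mkQ_span_singleton {v : Fin m → ℂ} (hv : v ≠ 0) :
    Module.finrank ℂ ((Fin m → ℂ) ⧸ Submodule.span ℂ {v}) + 1 = m := by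
  have h := Submodule.finrank_quotient_add_finrank (Submodule.span ℂ {v})
  rwa [finrank_span_singleton hv, Module.finrank_fin_fun] at h

/-- The Gale dual of five vectors spanning `ℂ³`. -/
theorem exists_gale_dual {x : Fin 5 → Fin 3 → ℂ} (hx : Submodule.span ℂ (range x) = ⊤)
    (h0 : ∀ i, x i ≠ 0)
    (hj : ∀ j : Fin 5, x j ∈ Submodule.span ℂ (range fun l => x (j.succAbove l))) :
    ∃ w : Fin 5 → Fin 2 → ℂ, (∀ i, w i ≠ 0) ∧ (∀ a, ∑ i, w i a • x i = 0) ∧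
      ∀ i : Fin 5, Submodule.span ℂ (range fun l => w (i.succAbove l)) = ⊤ := by
  set K := LinearMap.ker (Fintype.linearCombination ℂ x) with hK
  have hfin : Module.finrank ℂ K = 2 := by
    have h := LinearMap.finrank_range_add_finrank_ker (Fintype.linearCombination ℂ x)
    rw [Fintype.range_linearCombination, hx, finrank_top, Module.finrank_fin_fun,
      Module.finrank_fin_fun, ← hK] at h
    omega
  let b : Module.Basis (Fin 2) ℂ K := Module.finBasisOfFinrankEq ℂ K hfin
  have hmemK : ∀ c : Fin 5 → ℂ, c ∈ K ↔ ∑ i, c i • x i = 0 := fun c => by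
    rw [hK, LinearMap.mem_ker, Fintype.linearCombination_apply]
  have hrep : ∀ c ∈ K, ∃ α β : ℂ, ∀ i, c i = α * (b 0).1 i + β * (b 1).1 i := by
    intro c hc
    refine ⟨b.repr ⟨c, hc⟩ 0, b.repr ⟨c, hc⟩ 1, fun i => ?_⟩
    have := congrArg (fun k : K => k.1 i) (b.sum_repr ⟨c, hc⟩)
    rw [Fin.sum_univ_two] at this
    exact this.symm
  refine ⟨fun i => ![(b 0).1 i, (b 1).1 i], fun i hi => ?_, fun a => ?_, fun i => ?_⟩
  · obtain ⟨c, hc⟩ := (Submodule.mem_span_range_iff_exists_fun ℂ).1 (hj i)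
    -- A relation that really involves `x i` shows that the `i`-th coordinate functional is nonzero
    -- on the space of relations.
    have hcK : (i.insertNth (α := fun _ => ℂ) (-1) c) ∈ K := by
      rw [hmemK, Fin.sum_univ_succAbove _ i]
      simp [hc]
    obtain ⟨α, β, h⟩ := hrep _ hcK
    have h1 := h i
    have e0 : (b 0).1 i = 0 := congrFun hi 0
    have e1 : (b 1).1 i = 0 := congrFun hi 1
    rw [e0, e1] at h1
    simp at h1
  · fin_cases a
    · exact (hmemK _).1 (b 0).2
    · exact (hmemK _).1 (b 1).2
  · by_contra hne
    -- the coordinates `w l` for `l ≠ i` satisfy a common linear equation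
    obtain ⟨f, hf0, hf⟩ := Submodule.exists_le_ker_of_lt_top _ (lt_top_iff_ne_top.2 hne)
    set α := f ![1, 0]
    set β := f ![0, 1]
    have hfe : ∀ v : Fin 2 → ℂ, f v = α * v 0 + β * v 1 := by
      intro v
      have : v = v 0 • ![1, 0] + v 1 • ![0, 1] := by
        ext k
        fin_cases k <;> simp
      nth_rewrite 1 [this]
      rw [map_add, map_smul, map_smul, smul_eq_mul, smul_eq_mul]
      ring
    have hzero : ∀ l, α * (b 0).1 (i.succAbove l) + β * (b 1).1 (i.succAbove l) = 0 := by
      intro l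
      have : (fun l => (![(b 0).1 (i.succAbove l), (b 1).1 (i.succAbove l)] : Fin 2 → ℂ)) l ∈
          LinearMap.ker f := hf (Submodule.subset_span ⟨l, rfl⟩)
      rw [LinearMap.mem_ker, hfe] at this
      simpa using this
    -- This relation is supported at `i` alone, hence is trivial because `x i ≠ 0`; that contradicts
    -- the independence of the basis `b`.
    set k : K := α • b 0 + β • b 1 with hk
    have hkK := (hmemK _).1 k.2
    have hkl : ∀ l, k.1 (i.succAbove l) = 0 := fun l => by simpa [hk] using hzero l
    rw [Fin.sum_univ_succAbove _ i] at hkK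
    simp only [hkl, zero_smul, Finset.sum_const_zero, add_zero] at hkK
    have hki : k.1 i = 0 := (smul_eq_zero.1 hkK).resolve_right (h0 i)
    have hk0 : k = 0 := by
      ext a
      rcases Fin.eq_self_or_eq_succAbove i a with rfl | ⟨l, rfl⟩
      · exact hki
      · exact hkl l
    have hli := Fintype.linearIndependent_iff.1 b.linearIndependent ![α, β]
      (by simpa [Fin.sum_univ_two, hk] using hk0)
    have hα : α = 0 := hli 0
    have hβ : β = 0 := hli 1
    exact hf0 (LinearMap.ext fun v => by rw [hfe, hα, hβ]; simp)

/-- Once zero vectors and vectors independent of the rest are excluded, every face obtained by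
omission spans dimension `m` and every quotient face dimension `m - 1`. Only the first kind counts
for `m = 2` and only the second for `m = 3`. -/
theorem configD_Vol : configD Vol = 0 := by
  funext τ
  obtain ⟨m, x, hx, rfl⟩ := τ.exists_of
  rw [Pi.zero_apply]
  by_cases h0 : ∃ j, x j = 0
  · obtain ⟨j, hj⟩ := h0
    exact configD_Vol_of_eq_zero x hj
  by_cases h1 : ∃ j, x j ∉ Submodule.span ℂ (range fun l => x (j.succAbove l))
  · obtain ⟨j, hj⟩ := h1
    exact configD_Vol_of_notMem x hj
  push Not at h0 h1
  have htop : ∀ i : Fin 5, Submodule.span ℂ (range fun l => x (i.succAbove l)) = ⊤ :=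
    fun i => span_succAbove_eq_top hx (h1 i)
  have heps : m ≠ 2 → ∀ i, Vol ((Config.of x).eps i) = 0 := by
    intro hm i
    rw [Config.eps_of]
    refine Vol_of_finrank_ne ?_
    rw [htop i]
    simpa using hm
  have hqtop := fun i : Fin 5 => span_mkQ_succAbove_eq_top (U := Submodule.span ℂ {x i}) (htop i)
  have heta : m ≠ 3 → ∀ i, Vol ((Config.of x).eta i) = 0 := by
    intro hm i
    rw [Config.eta_of]
    refine Vol_of_finrank_ne ?_
    have := finrank_mkQ_span_singleton (h0 i)
    rw [hqtop i, finrank_top]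
    omega
  rw [configD]
  by_cases h2 : m = 2
  · subst h2
    simp only [heta (by norm_num), Config.eps_of, Vol_of]
    rw [sum_idealVolume_succAbove h0]
    simp
  simp only [heps h2, mul_zero, Finset.sum_const_zero, zero_sub, neg_eq_zero]
  by_cases h3 : m = 3
  · subst h3
    obtain ⟨w, hw0, hw, hwtop⟩ := exists_gale_dual hx h0 h1
    rw [← sum_idealVolume_succAbove hw0]
    refine Finset.sum_congr rfl fun i _ => ?_
    congr 1
    rw [Config.eta_of]
    have hfin := finrank_mkQ_span_singleton (h0 i)
    obtain ⟨y, hytop, hy⟩ := exists_coordinates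
      (x := fun l => (Submodule.span ℂ {x i}).mkQ (x (i.succAbove l))) (by
        rw [hqtop i, finrank_top]
        omega)
    rw [Vol_of_eq hy]
    refine idealVolume_eq_of_gale (fun a b => ?_) (exists_bracket_ne_zero hytop)
      (exists_bracket_ne_zero (hwtop i))
    -- The `i`-th coefficient is free in the quotient by `x i`, so `w` with its `i`-th vector
    -- dropped is Gale dual to the `i`-th quotient face.
    have h4 := (hy fun l => w (i.succAbove l) a).1 (by
      rw [sum_smul_mkQ_eq_zero_iff]
      refine ⟨w i a, ?_⟩
      rw [← hw a]
      refine Finset.sum_congr rfl fun l _ => ?_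
      rcases Fin.eq_self_or_eq_succAbove i l with rfl | ⟨k, rfl⟩ <;> simp)
    simpa using congrFun h4 b
  · simp [heta h3]

end Cocycle

/-! ## The cocycle on flags -/

section FlagVol

variable {n : ℕ}

theorem AffineFlag.v_mem (A : AffineFlag n) (j : Fin n) : A.v j ∈ A.space j.succ := by
  rw [A.space_succ]
  exact Submodule.mem_sup_left (Submodule.mem_span_singleton_self _)

theorem CFlag.castSucc_lt_succ (F : CFlag n) (j : Fin n) :
    F.space j.castSucc < F.space j.succ := by
  refine lt_of_le_of_ne (F.mono (Fin.castSucc_le_succ j)) fun h => ?_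
  have h1 := F.finrank_space j.castSucc
  rw [h, F.finrank_space] at h1
  simp at h1

theorem AffineFlag.v_notMem (A : AffineFlag n) (j : Fin n) : A.v j ∉ A.space j.castSucc := by
  intro h
  have h1 := A.castSucc_lt_succ j
  rw [A.space_succ, sup_eq_right.2 (by simpa using h)] at h1
  exact lt_irrefl _ h1

/-- Vectors that agree modulo `U` up to nonzero factors have the same volume. -/
theorem Vol_mkQ_congr {V : Type*} [AddCommGroup V] [Module ℂ V] {U : Submodule ℂ V}
    {x y : Fin 4 → V} {c : Fin 4 → ℂ} (hc : ∀ i, c i ≠ 0) (h : ∀ i, y i - c i • x i ∈ U) :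
    Vol (Config.of fun i => U.mkQ (y i)) = Vol (Config.of fun i => U.mkQ (x i)) := by
  rw [← Vol_of_smul (fun i => U.mkQ (x i)) hc]
  congr 2
  funext i
  rw [← map_smul, ← sub_eq_zero, ← map_sub, Submodule.mkQ_apply, Submodule.Quotient.mk_eq_zero]
  exact h i

/-- The sum of the spaces `F_l^{j_l}`. -/
def flagSum {k : ℕ} (F : Fin k → CFlag n) (J : Fin k → Fin (n + 1)) :
    Submodule ℂ (Fin n → ℂ) :=
  ⨆ l, (F l).space (J l)

/-- The summand of `borelCocycle n F` of index `J`. -/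
def flagVol (F : Fin 4 → CFlag n) (J : Fin 4 → Fin n) : ℝ :=
  Vol (tConfig J fun i => (exists_affineFlag (F i)).choose)

theorem borelCocycle_eq_sum (F : Fin 4 → CFlag n) :
    borelCocycle n F = ∑ J : Fin 4 → Fin n, flagVol F J := rfl

theorem AffineFlag.exists_smul_sub_mem (A : AffineFlag n) {j : Fin n} {x : Fin n → ℂ}
    (h : x ∈ A.space j.succ) (h' : x ∉ A.space j.castSucc) :
    ∃ c : ℂ, c ≠ 0 ∧ x - c • A.v j ∈ A.space j.castSucc := by
  rw [A.space_succ, Submodule.mem_sup] at h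
  obtain ⟨y, hy, z, hz, rfl⟩ := h
  obtain ⟨c, rfl⟩ := Submodule.mem_span_singleton.1 hy
  refine ⟨c, ?_, by simpa using hz⟩
  rintro rfl
  exact h' (by simpa using hz)

/-- A vector of the right layer is a nonzero multiple of the chosen one up to an element of the
smaller space, which lies in the denominator. In particular the value does not depend on the lift to
affine flags. -/
theorem flagVol_eq (F : Fin 4 → CFlag n) (J : Fin 4 → Fin n) {x : Fin 4 → Fin n → ℂ}
    (hx : ∀ i, x i ∈ (F i).space (J i).succ) (hx' : ∀ i, x i ∉ (F i).space (J i).castSucc) :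
    flagVol F J =
      Vol (Config.of fun i => (flagSum F fun l => (J l).castSucc).mkQ (x i)) := by
  have hA : ∀ i, (exists_affineFlag (F i)).choose.toCFlag = F i :=
    fun i => (exists_affineFlag (F i)).choose_spec
  set A := fun i => (exists_affineFlag (F i)).choose with hAdef
  have hU : (⨆ l, (A l).space (J l).castSucc) = flagSum F fun l => (J l).castSucc := by
    rw [flagSum]
    exact iSup_congr fun l => by rw [← hA l]
  have h : ∀ i, ∃ c : ℂ, c ≠ 0 ∧ x i - c • (A i).v (J i) ∈ (A i).space (J i).castSucc := by
    intro i
    refine (A i).exists_smul_sub_mem ?_ ?_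
    · rw [hA i]; exact hx i
    · rw [hA i]; exact hx' i
  choose c hc hxc using h
  rw [flagVol, tConfig, Config.of_mkQ_congr hU (y := fun i => (A i).v (J i)) rfl]
  refine (Vol_mkQ_congr hc fun i => ?_).symm
  rw [← hU]
  exact le_iSup (fun l => (A l).space (J l).castSucc) i (hxc i)

theorem Vol_tConfig (A : Fin 4 → AffineFlag n) (J : Fin 4 → Fin n) :
    Vol (tConfig J A) = flagVol (fun i => (A i).toCFlag) J :=
  (flagVol_eq _ J (fun i => (A i).v_mem _) fun i => (A i).v_notMem _).symm

theorem borelAffine_eq (A : Fin 4 → AffineFlag n) :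
    borelAffine n A = borelCocycle n fun i => (A i).toCFlag := by
  rw [borelCocycle_eq_sum, borelAffine, pullT]
  exact Finset.sum_congr rfl fun J _ => Vol_tConfig A J

theorem exists_lift {k : ℕ} (F : Fin k → CFlag n) :
    ∃ A : Fin k → AffineFlag n, (fun i => (A i).toCFlag) = F :=
  ⟨fun i => (exists_affineFlag (F i)).choose,
    funext fun i => (exists_affineFlag (F i)).choose_spec⟩

/-! ### Invariance, alternation and the cocycle identity on flags -/

theorem CFlag.smul_space (g : GL (Fin n) ℂ) (F : CFlag n) (j : Fin (n + 1)) :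
    (g • F).space j = (F.space j).map (glEquiv g).toLinearMap := rfl

theorem flagSum_smul {k : ℕ} (g : GL (Fin n) ℂ) (F : Fin k → CFlag n) (J : Fin k → Fin (n + 1)) :
    flagSum (fun i => g • F i) J = (flagSum F J).map (glEquiv g).toLinearMap := by
  simp only [flagSum, CFlag.smul_space, Submodule.map_iSup]

theorem mem_map_glEquiv (g : GL (Fin n) ℂ) (U : Submodule ℂ (Fin n → ℂ)) (x : Fin n → ℂ) :
    glEquiv g x ∈ U.map (glEquiv g).toLinearMap ↔ x ∈ U := by
  constructor
  · rintro ⟨y, hy, h⟩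
    rwa [← (glEquiv g).injective h]
  · exact Submodule.mem_map_of_mem

theorem flagVol_smul (g : GL (Fin n) ℂ) (F : Fin 4 → CFlag n) (J : Fin 4 → Fin n) :
    flagVol (fun i => g • F i) J = flagVol F J := by
  obtain ⟨A, rfl⟩ := exists_lift F
  rw [flagVol_eq _ J (fun i => (A i).v_mem _) fun i => (A i).v_notMem _,
    flagVol_eq (x := fun i => glEquiv g ((A i).v (J i)))]
  · rw [flagSum_smul]
    congr 1
    refine Config.of_mkQ_eq_of_mkQ _ _ _ _ fun c => ?_
    rw [← mem_map_glEquiv g]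
    simp [map_sum]
  · intro i
    rw [CFlag.smul_space, mem_map_glEquiv]
    exact (A i).v_mem _
  · intro i
    rw [CFlag.smul_space, mem_map_glEquiv]
    exact (A i).v_notMem _

theorem borelCocycle_smul (g : GL (Fin n) ℂ) (F : Fin 4 → CFlag n) :
    borelCocycle n (fun i => g • F i) = borelCocycle n F := by
  simp only [borelCocycle_eq_sum, flagVol_smul]

theorem flagSum_perm {k : ℕ} (σ : Equiv.Perm (Fin k)) (F : Fin k → CFlag n)
    (J : Fin k → Fin (n + 1)) : flagSum (fun i => F (σ i)) (fun i => J (σ i)) = flagSum F J :=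
  σ.iSup_comp (g := fun l => (F l).space (J l))

theorem flagVol_perm (σ : Equiv.Perm (Fin 4)) (F : Fin 4 → CFlag n) (J : Fin 4 → Fin n) :
    flagVol (fun i => F (σ i)) (fun i => J (σ i)) =
      ((Equiv.Perm.sign σ : ℤ) : ℝ) * flagVol F J := by
  obtain ⟨A, rfl⟩ := exists_lift F
  rw [flagVol_eq _ J (fun i => (A i).v_mem _) fun i => (A i).v_notMem _, ← isAltConfig_Vol,
    flagVol_eq (x := fun i => (A (σ i)).v (J (σ i))) _ _ (fun i => (A (σ i)).v_mem _)
      fun i => (A (σ i)).v_notMem _, Config.perm_of]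
  congr 1
  refine Config.of_mkQ_congr ?_ rfl
  exact flagSum_perm σ (fun i => (A i).toCFlag) fun l => (J l).castSucc

theorem borelCocycle_perm (σ : Equiv.Perm (Fin 4)) (F : Fin 4 → CFlag n) :
    borelCocycle n (fun i => F (σ i)) = ((Equiv.Perm.sign σ : ℤ) : ℝ) * borelCocycle n F := by
  rw [borelCocycle_eq_sum, borelCocycle_eq_sum, Finset.mul_sum,
    ← Equiv.sum_comp (Equiv.arrowCongr σ.symm (Equiv.refl (Fin n)))]
  refine Finset.sum_congr rfl fun J _ => ?_
  rw [← flagVol_perm]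
  rfl

theorem coboundary_borelCocycle (F : Fin 5 → CFlag n) : coboundary (borelCocycle n) F = 0 := by
  obtain ⟨A, rfl⟩ := exists_lift F
  have h := congrFun (coboundary_pullT n Vol isAltConfig_Vol) A
  rw [configD_Vol] at h
  calc coboundary (borelCocycle n) (fun i => (A i).toCFlag)
      = coboundary (pullT n Vol) A := by
        refine Finset.sum_congr rfl fun i _ => ?_
        congr 1
        exact (borelAffine_eq fun j => A (i.succAbove j)).symm
    _ = 0 := by rw [h]; simp [pullT]

end FlagVol

/-! ## Contributing indices -/

section Contributing

variable {n : ℕ}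

/-- The spaces of a flag indexed by natural numbers; all spaces beyond the `n`-th are `ℂⁿ`. -/
def CFlag.sp (F : CFlag n) (j : ℕ) : Submodule ℂ (Fin n → ℂ) := F.space ⟨min j n, by omega⟩

theorem CFlag.space_eq_sp (F : CFlag n) (j : Fin (n + 1)) : F.space j = F.sp j := by
  rw [CFlag.sp]
  congr 1
  ext
  simp only
  omega

theorem CFlag.sp_mono (F : CFlag n) : Monotone F.sp := fun i j h =>
  F.mono (by rw [Fin.mk_le_mk]; omega)

theorem CFlag.finrank_sp (F : CFlag n) {j : ℕ} (hj : j ≤ n) :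
    Module.finrank ℂ (F.sp j) = j := by
  rw [CFlag.sp, F.finrank_space]
  exact min_eq_left hj

theorem CFlag.sp_zero (F : CFlag n) : F.sp 0 = ⊥ := by
  rw [← F.space_zero, F.space_eq_sp]
  rfl

theorem CFlag.sp_of_le (F : CFlag n) {j : ℕ} (hj : n ≤ j) : F.sp j = ⊤ := by
  rw [← F.space_last, CFlag.sp]
  congr 1
  ext
  simp [hj]

theorem CFlag.ext_sp {F G : CFlag n} (h : ∀ j, F.sp j = G.sp j) : F = G := by
  ext1
  funext j
  rw [F.space_eq_sp, G.space_eq_sp, h]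

/-- The vectors of an affine flag indexed by natural numbers. -/
def AffineFlag.vec (A : AffineFlag n) (j : ℕ) : Fin n → ℂ := if h : j < n then A.v ⟨j, h⟩ else 0

theorem AffineFlag.vec_coe (A : AffineFlag n) (j : Fin n) : A.vec j = A.v j := by
  simp [AffineFlag.vec]

theorem AffineFlag.sp_succ (A : AffineFlag n) (j : ℕ) :
    A.sp (j + 1) = Submodule.span ℂ {A.vec j} ⊔ A.sp j := by
  by_cases h : j < n
  · have := A.space_succ ⟨j, h⟩
    rw [A.space_eq_sp, A.space_eq_sp] at this
    rw [AffineFlag.vec, dif_pos h]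
    exact this
  · rw [A.sp_of_le (by omega), A.sp_of_le (by omega), sup_top_eq]

theorem AffineFlag.vec_mem (A : AffineFlag n) {i j : ℕ} (h : i < j) : A.vec i ∈ A.sp j := by
  refine A.sp_mono h ?_
  rw [A.sp_succ]
  exact Submodule.mem_sup_left (Submodule.mem_span_singleton_self _)

/-- The sum of the spaces `F_l^{j_l}`. -/
def spSum (A : Fin 4 → AffineFlag n) (J : Fin 4 → ℕ) : Submodule ℂ (Fin n → ℂ) :=
  ⨆ l, (A l).sp (J l)

theorem sp_le_spSum (A : Fin 4 → AffineFlag n) (J : Fin 4 → ℕ) (l : Fin 4) :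
    (A l).sp (J l) ≤ spSum A J := le_iSup (fun l => (A l).sp (J l)) l

theorem spSum_mono (A : Fin 4 → AffineFlag n) {J J' : Fin 4 → ℕ} (h : J ≤ J') :
    spSum A J ≤ spSum A J' := iSup_mono fun l => (A l).sp_mono (h l)

/-- The summand of `borelAffine n A` of index `J`. -/
def spVol (A : Fin 4 → AffineFlag n) (J : Fin 4 → ℕ) : ℝ :=
  Vol (Config.of fun i => (spSum A J).mkQ ((A i).vec (J i)))

theorem Vol_tConfig_eq_spVol (A : Fin 4 → AffineFlag n) (J : Fin 4 → Fin n) :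
    Vol (tConfig J A) = spVol A fun i => J i := by
  rw [tConfig, spVol]
  congr 1
  refine Config.of_mkQ_congr ?_ (funext fun i => ((A i).vec_coe _).symm)
  exact iSup_congr fun l => (A l).space_eq_sp _

variable {A : Fin 4 → AffineFlag n} {J J' : Fin 4 → ℕ}

theorem eq_zero_of_spVol_ne_zero (h : spVol A J ≠ 0) {a b : Fin 4} (hab : a ≠ b) {α β : ℂ}
    (h0 : α • (A a).vec (J a) + β • (A b).vec (J b) ∈ spSum A J) : α = 0 ∧ β = 0 := by
  refine eq_zero_of_Vol_ne_zero h hab ?_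
  rwa [← map_smul, ← map_smul, ← map_add, Submodule.mkQ_apply, Submodule.Quotient.mk_eq_zero]

theorem exists_sub_mem_of_spVol_ne_zero (h : spVol A J ≠ 0) {a b : Fin 4} (hab : a ≠ b)
    (c : Fin 4) :
    ∃ α β : ℂ, (A c).vec (J c) - (α • (A a).vec (J a) + β • (A b).vec (J b)) ∈ spSum A J := by
  obtain ⟨α, β, h1⟩ := exists_eq_of_Vol_ne_zero h hab c
  refine ⟨α, β, ?_⟩
  rwa [← map_smul, ← map_smul, ← map_add, ← sub_eq_zero, ← map_sub, Submodule.mkQ_apply,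
    Submodule.Quotient.mk_eq_zero] at h1

theorem vec_notMem_of_spVol_ne_zero (h : spVol A J ≠ 0) (a : Fin 4) :
    (A a).vec (J a) ∉ spSum A J := by
  intro h0
  refine ne_zero_of_Vol_ne_zero h a ?_
  rwa [Submodule.mkQ_apply, Submodule.Quotient.mk_eq_zero]

theorem lt_of_spVol_ne_zero (h : spVol A J ≠ 0) (a : Fin 4) : J a < n := by
  by_contra h0
  refine vec_notMem_of_spVol_ne_zero h a ?_
  rw [AffineFlag.vec, dif_neg h0]
  exact Submodule.zero_mem _

theorem finrank_spSum_add_two_le (h : spVol A J ≠ 0) :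
    Module.finrank ℂ (spSum A J) + 2 ≤ n := by
  have h2 : Module.finrank ℂ (Submodule.span ℂ
      (range fun i => (spSum A J).mkQ ((A i).vec (J i)))) = 2 := by
    by_contra h2
    exact h (Vol_of_finrank_ne h2)
  have h3 := Submodule.finrank_le (Submodule.span ℂ
      (range fun i => (spSum A J).mkQ ((A i).vec (J i))))
  have h4 := Submodule.finrank_quotient_add_finrank (spSum A J)
  rw [Module.finrank_fin_fun] at h4
  omega

/-- Modulo the sum for `J` the vector of flag `c` is a combination of those of flags `a` and `b`. If
`J c < J' c`, it dies in the sum for `J'`, where the other two are unchanged and independent; so it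
was already zero modulo the sum for `J`. -/
theorem not_lt_of_spVol_ne_zero (h : spVol A J ≠ 0) (h' : spVol A J' ≠ 0) (hle : J ≤ J')
    {a b : Fin 4} (hab : a ≠ b) (ha : J a = J' a) (hb : J b = J' b) (c : Fin 4) :
    ¬ J c < J' c := by
  intro hc
  obtain ⟨α, β, h1⟩ := exists_sub_mem_of_spVol_ne_zero h hab c
  have h2 : (A c).vec (J c) ∈ spSum A J' := sp_le_spSum A J' c ((A c).vec_mem hc)
  have h3 := (Submodule.sub_mem_iff_right _ h2).1 (spSum_mono A hle h1)
  rw [ha, hb] at h3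
  obtain ⟨rfl, rfl⟩ := eq_zero_of_spVol_ne_zero h' hab h3
  refine vec_notMem_of_spVol_ne_zero h c ?_
  simpa using h1

/-- The vector of flag `b` at a contributing index is not in the whole sum. The dimension therefore
jumps right after `J b`, which is how that index can be read off from dimensions. -/
theorem finrank_lt_of_spVol_ne_zero (h : spVol A J ≠ 0) (b : Fin 4) {q : ℕ} (hq : J b < q)
    {W : Submodule ℂ (Fin n → ℂ)} (hW : W ≤ spSum A J) :
    Module.finrank ℂ ↥(W ⊔ (A b).sp (J b)) < Module.finrank ℂ ↥(W ⊔ (A b).sp q) := by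
  refine Submodule.finrank_lt_finrank_of_lt (lt_of_le_of_ne
    (sup_le_sup_left ((A b).sp_mono hq.le) _) fun he => ?_)
  refine vec_notMem_of_spVol_ne_zero h b (sup_le hW (sp_le_spSum A J b) ?_)
  rw [he]
  exact Submodule.mem_sup_right ((A b).vec_mem hq)

theorem eq_of_finrank_eq (h : spVol A J ≠ 0) (h' : spVol A J' ≠ 0) (b : Fin 4)
    {W : Submodule ℂ (Fin n → ℂ)} (hW : W ≤ spSum A J) (hW' : W ≤ spSum A J')
    (he : Module.finrank ℂ ↥(W ⊔ (A b).sp (J b)) = Module.finrank ℂ ↥(W ⊔ (A b).sp (J' b))) :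
    J b = J' b := by
  rcases lt_trichotomy (J b) (J' b) with hlt | heq | hlt
  · exact absurd he (finrank_lt_of_spVol_ne_zero h b hlt hW).ne
  · exact heq
  · exact absurd he.symm (finrank_lt_of_spVol_ne_zero h' b hlt hW').ne

/-- The sum of the spaces of index `J` of the first two flags. -/
def spSum₂ (A : Fin 4 → AffineFlag n) (J : Fin 4 → ℕ) : Submodule ℂ (Fin n → ℂ) :=
  (A 0).sp (J 0) ⊔ (A 1).sp (J 1)

/-- The sum of the spaces of index `J` of the first three flags. -/
def spSum₃ (A : Fin 4 → AffineFlag n) (J : Fin 4 → ℕ) : Submodule ℂ (Fin n → ℂ) :=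
  spSum₂ A J ⊔ (A 2).sp (J 2)

theorem spSum₂_le (A : Fin 4 → AffineFlag n) (J : Fin 4 → ℕ) : spSum₂ A J ≤ spSum A J :=
  sup_le (sp_le_spSum A J 0) (sp_le_spSum A J 1)

theorem spSum₃_le (A : Fin 4 → AffineFlag n) (J : Fin 4 → ℕ) : spSum₃ A J ≤ spSum A J :=
  sup_le (spSum₂_le A J) (sp_le_spSum A J 2)

/-- The increments of the dimensions of the partial sums of the spaces of index `J`. -/
def dimCode (A : Fin 4 → AffineFlag n) (J : Fin 4 → ℕ) : Fin 4 → ℕ :=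
  ![J 0, Module.finrank ℂ (spSum₂ A J) - J 0,
    Module.finrank ℂ (spSum₃ A J) - Module.finrank ℂ (spSum₂ A J),
    n - 2 - Module.finrank ℂ (spSum₃ A J)]

theorem dim_le_of_spVol_ne_zero (h : spVol A J ≠ 0) :
    J 0 ≤ Module.finrank ℂ (spSum₂ A J) ∧
      Module.finrank ℂ (spSum₂ A J) ≤ Module.finrank ℂ (spSum₃ A J) ∧
      Module.finrank ℂ (spSum₃ A J) ≤ n - 2 := by
  refine ⟨?_, Submodule.finrank_mono le_sup_left, ?_⟩
  · rw [← (A 0).finrank_sp (lt_of_spVol_ne_zero h 0).le]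
    exact Submodule.finrank_mono le_sup_left
  · have h1 := Submodule.finrank_mono (spSum₃_le A J)
    have h2 := finrank_spSum_add_two_le h
    omega

theorem sum_dimCode (h : spVol A J ≠ 0) : ∑ i, dimCode A J i = n - 2 := by
  obtain ⟨h1, h2, h3⟩ := dim_le_of_spVol_ne_zero h
  simp only [dimCode, Fin.sum_univ_four, Matrix.cons_val]
  omega

/-- The first entry is `J 0`, and the next two dimensions locate `J 1` and `J 2` by the jump
property. The last index then follows by comparing two contributing indices that agree in three
places. -/
theorem dimCode_injOn (A : Fin 4 → AffineFlag n) : Set.InjOn (dimCode A) {J | spVol A J ≠ 0} := by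
  intro J h J' h' he
  obtain ⟨h1, h2, h3⟩ := dim_le_of_spVol_ne_zero h
  obtain ⟨h1', h2', h3'⟩ := dim_le_of_spVol_ne_zero h'
  have e0 : J 0 = J' 0 := congrFun he 0
  have e1 := congrFun he 1
  have e2 := congrFun he 2
  simp only [dimCode, Matrix.cons_val] at e1 e2
  have hk : Module.finrank ℂ (spSum₂ A J) = Module.finrank ℂ (spSum₂ A J') := by omega
  have hk' : Module.finrank ℂ (spSum₃ A J) = Module.finrank ℂ (spSum₃ A J') := by omega
  have f1 : J 1 = J' 1 := by
    refine eq_of_finrank_eq h h' 1 (sp_le_spSum A J 0) ?_ ?_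
    · rw [e0]; exact sp_le_spSum A J' 0
    · rw [spSum₂, spSum₂, ← e0] at hk
      exact hk
  have hs : spSum₂ A J = spSum₂ A J' := by rw [spSum₂, spSum₂, e0, f1]
  have f2 : J 2 = J' 2 := by
    refine eq_of_finrank_eq h h' 2 (spSum₂_le A J) ?_ ?_
    · rw [hs]; exact spSum₂_le A J'
    · rw [spSum₃, spSum₃, ← hs] at hk'
      exact hk'
  have key : ∀ {J J' : Fin 4 → ℕ}, spVol A J ≠ 0 → spVol A J' ≠ 0 → J 0 = J' 0 → J 1 = J' 1 →
      J 2 = J' 2 → ¬ J 3 < J' 3 := by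
    intro J J' h h' e0 f1 f2 hlt
    refine not_lt_of_spVol_ne_zero h h' ?_ (a := 0) (b := 1) (by decide) e0 f1 3 hlt
    intro i
    fin_cases i
    · exact e0.le
    · exact f1.le
    · exact f2.le
    · exact hlt.le
  have f3 : J 3 = J' 3 := by
    have := key h h' e0 f1 f2
    have := key h' h e0.symm f1.symm f2.symm
    omega
  funext i
  fin_cases i
  · exact e0
  · exact f1
  · exact f2
  · exact f3

/-- The set of indices with nonzero volume. -/
def contributing (A : Fin 4 → AffineFlag n) : Finset (Fin 4 → ℕ) :=
  (Fintype.piFinset fun _ => Finset.range n).filter fun J => spVol A J ≠ 0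

theorem mem_contributing : J ∈ contributing A ↔ spVol A J ≠ 0 := by
  rw [contributing, Finset.mem_filter, and_iff_right_iff_imp]
  intro h
  rw [Fintype.mem_piFinset]
  exact fun i => Finset.mem_range.2 (lt_of_spVol_ne_zero h i)

theorem borelAffine_eq_sum_contributing (A : Fin 4 → AffineFlag n) :
    borelAffine n A = ∑ J ∈ contributing A, spVol A J := by
  rw [contributing, Finset.sum_filter_ne_zero, borelAffine, pullT]
  simp only [Vol_tConfig_eq_spVol]
  refine Finset.sum_bij (fun J _ i => (J i : ℕ)) (fun J _ => ?_) (fun J _ J' _ h => ?_)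
    (fun J hJ => ?_) fun J _ => rfl
  · exact Fintype.mem_piFinset.2 fun i => Finset.mem_range.2 (J i).2
  · funext i
    exact Fin.ext (congrFun h i)
  · rw [Fintype.mem_piFinset] at hJ
    exact ⟨fun i => ⟨J i, Finset.mem_range.1 (hJ i)⟩, Finset.mem_univ _, rfl⟩

theorem dimCode_mem (hJ : J ∈ contributing A) :
    dimCode A J ∈ Finset.piAntidiag (Finset.univ : Finset (Fin 4)) (n - 2) := by
  rw [Finset.mem_piAntidiag]
  exact ⟨sum_dimCode (mem_contributing.1 hJ), fun i _ => Finset.mem_univ i⟩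

theorem card_contributing_le (A : Fin 4 → AffineFlag n) :
    (contributing A).card ≤ (Finset.piAntidiag (Finset.univ : Finset (Fin 4)) (n - 2)).card := by
  refine Finset.card_le_card_of_injOn (dimCode A) (fun J hJ => dimCode_mem hJ) ?_
  exact (dimCode_injOn A).mono fun J hJ => mem_contributing.1 hJ

/-- Stars and bars: with `n = m + 2` the number is the binomial coefficient of `m + 3` over `3`. -/
theorem card_piAntidiag_four (hn : 2 ≤ n) :
    ((Finset.piAntidiag (Finset.univ : Finset (Fin 4)) (n - 2)).card : ℝ) =
      n * ((n : ℝ) ^ 2 - 1) / 6 := by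
  obtain ⟨m, rfl⟩ := Nat.exists_eq_add_of_le' hn
  have e : (Finset.piAntidiag (Finset.univ : Finset (Fin 4)) (m + 2 - 2)) ≃ Sym (Fin 4) m :=
    (Equiv.subtypeEquivRight fun P => by simp [Finset.mem_piAntidiag]).trans
      (Sym.equivNatSumOfFintype (Fin 4) m).symm
  rw [Finset.card_eq_of_equiv_fintype e, Sym.card_sym_eq_choose, Fintype.card_fin,
    show 4 + m - 1 = m + 3 by omega, Nat.cast_add_choose]
  have h0 : ((m.factorial : ℕ) : ℝ) ≠ 0 := by exact_mod_cast m.factorial_ne_zero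
  simp only [Nat.factorial_succ]
  push_cast
  field_simp
  ring

theorem abs_borelAffine_le (hn : 2 ≤ n) (A : Fin 4 → AffineFlag n) :
    |borelAffine n A| ≤ n * ((n : ℝ) ^ 2 - 1) / 6 * v3 := by
  rw [borelAffine_eq_sum_contributing, ← card_piAntidiag_four hn]
  calc |∑ J ∈ contributing A, spVol A J| ≤ ∑ J ∈ contributing A, |spVol A J| :=
        Finset.abs_sum_le_sum_abs _ _
    _ ≤ ∑ _J ∈ contributing A, v3 := Finset.sum_le_sum fun J _ => abs_Vol_le _
    _ = (contributing A).card * v3 := by simp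
    _ ≤ _ := by
      refine mul_le_mul_of_nonneg_right ?_ v3_pos.le
      exact_mod_cast card_contributing_le A

/-- In the case of equality, all simplices are regular with the same orientation and the number of
contributing indices is maximal. -/
theorem spVol_eq_of_abs_borelAffine_eq (hn : 2 ≤ n)
    (h : |borelAffine n A| = n * ((n : ℝ) ^ 2 - 1) / 6 * v3) :
    (contributing A).card = (Finset.piAntidiag (Finset.univ : Finset (Fin 4)) (n - 2)).card ∧
      ∃ s : ℝ, |s| = v3 ∧ ∀ J, spVol A J ≠ 0 → spVol A J = s := by
  -- Multiplying by the sign of the sum makes every summand at most `v3`, so that equality of the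
  -- sums forces equality term by term.
  obtain ⟨ε, hε, hB⟩ : ∃ ε : ℝ, |ε| = 1 ∧ ε * borelAffine n A = |borelAffine n A| := by
    rcases le_total 0 (borelAffine n A) with h0 | h0
    · exact ⟨1, by simp, by rw [abs_of_nonneg h0, one_mul]⟩
    · exact ⟨-1, by simp, by rw [abs_of_nonpos h0]; ring⟩
  have hv := v3_pos
  have hterm : ∀ J ∈ contributing A, ε * spVol A J ≤ v3 := fun J _ => by
    refine (le_abs_self _).trans ?_
    rw [abs_mul, hε, one_mul]
    exact abs_Vol_le _
  have hsum : ∑ J ∈ contributing A, ε * spVol A J =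
      (Finset.piAntidiag (Finset.univ : Finset (Fin 4)) (n - 2)).card * v3 := by
    rw [← Finset.mul_sum, ← borelAffine_eq_sum_contributing, hB, h, card_piAntidiag_four hn]
  have hle := Finset.sum_le_sum hterm
  have hcard : (contributing A).card =
      (Finset.piAntidiag (Finset.univ : Finset (Fin 4)) (n - 2)).card := by
    refine le_antisymm (card_contributing_le A) ?_
    rw [hsum, Finset.sum_const, nsmul_eq_mul] at hle
    exact_mod_cast le_of_mul_le_mul_right hle hv
  refine ⟨hcard, ε * v3, by rw [abs_mul, hε, abs_of_pos hv, one_mul], fun J hJ => ?_⟩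
  have heq := (Finset.sum_eq_sum_iff_of_le hterm).1 (by
    rw [hsum, Finset.sum_const, nsmul_eq_mul, hcard]) J (mem_contributing.2 hJ)
  have hε2 : ε * ε = 1 := by rw [← abs_mul_abs_self, hε, one_mul]
  calc spVol A J = ε * ε * spVol A J := by rw [hε2, one_mul]
    _ = ε * v3 := by rw [mul_assoc, heq]

end Contributing

/-! ## Tuples of flags with the maximal number of contributing indices -/

section Maximal

variable {n : ℕ}

theorem spSum_perm (σ : Equiv.Perm (Fin 4)) (A : Fin 4 → AffineFlag n) (J : Fin 4 → ℕ) :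
    spSum (fun i => A (σ i)) (fun i => J (σ i)) = spSum A J :=
  σ.iSup_comp (g := fun l => (A l).sp (J l))

theorem spVol_perm (σ : Equiv.Perm (Fin 4)) (A : Fin 4 → AffineFlag n) (J : Fin 4 → ℕ) :
    spVol (fun i => A (σ i)) (fun i => J (σ i)) =
      ((Equiv.Perm.sign σ : ℤ) : ℝ) * spVol A J := by
  rw [spVol, spVol, ← isAltConfig_Vol, Config.perm_of]
  congr 1
  exact Config.of_mkQ_congr (spSum_perm σ A J) rfl

theorem spVol_perm_ne_zero_iff (σ : Equiv.Perm (Fin 4)) (A : Fin 4 → AffineFlag n)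
    (J : Fin 4 → ℕ) : spVol (fun i => A (σ i)) (fun i => J (σ i)) ≠ 0 ↔ spVol A J ≠ 0 := by
  rw [spVol_perm]
  simp

/-- Four affine flags with the largest possible number of contributing indices. -/
def IsMaximal (A : Fin 4 → AffineFlag n) : Prop :=
  (contributing A).card = (Finset.piAntidiag (Finset.univ : Finset (Fin 4)) (n - 2)).card

variable {A : Fin 4 → AffineFlag n}

theorem IsMaximal.perm (h : IsMaximal A) (σ : Equiv.Perm (Fin 4)) :
    IsMaximal fun i => A (σ i) := by
  rw [IsMaximal, ← h]
  refine Finset.card_bij (fun J _ i => J (σ.symm i)) (fun J hJ => ?_) (fun J _ J' _ he => ?_)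
    fun J hJ => ?_
  · rw [mem_contributing, ← spVol_perm_ne_zero_iff σ]
    simpa using mem_contributing.1 hJ
  · funext i
    simpa using congrFun he (σ i)
  · refine ⟨fun i => J (σ i), ?_, ?_⟩
    · rw [mem_contributing, spVol_perm_ne_zero_iff]
      exact mem_contributing.1 hJ
    · simp

/-- An injection between finite sets of the same size is onto, so every admissible triple of
dimensions is realised by a contributing index. -/
theorem IsMaximal.exists_index (h : IsMaximal A) {p k l : ℕ} (hpk : p ≤ k) (hkl : k ≤ l)
    (hl : l + 2 ≤ n) : ∃ J, spVol A J ≠ 0 ∧ J 0 = p ∧ Module.finrank ℂ (spSum₂ A J) = k ∧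
      Module.finrank ℂ (spSum₃ A J) = l := by
  have hsurj := Finset.surjOn_of_injOn_of_card_le (dimCode A)
    (s := contributing A) (t := Finset.piAntidiag (Finset.univ : Finset (Fin 4)) (n - 2))
    (fun J hJ => dimCode_mem hJ) ((dimCode_injOn A).mono fun J hJ => mem_contributing.1 hJ) h.ge
  obtain ⟨J, hJ, he⟩ := hsurj (show ![p, k - p, l - k, n - 2 - l] ∈
      (Finset.piAntidiag (Finset.univ : Finset (Fin 4)) (n - 2) : Set (Fin 4 → ℕ)) by
    rw [Finset.mem_coe, Finset.mem_piAntidiag]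
    refine ⟨?_, fun i _ => Finset.mem_univ i⟩
    simp only [Fin.sum_univ_four, Matrix.cons_val]
    omega)
  have hJ' := mem_contributing.1 hJ
  obtain ⟨h1, h2, h3⟩ := dim_le_of_spVol_ne_zero hJ'
  have e0 := congrFun he 0
  have e1 := congrFun he 1
  have e2 := congrFun he 2
  simp only [dimCode, Matrix.cons_val] at e0 e1 e2
  exact ⟨J, hJ', e0, by omega, by omega⟩

/-- Choose a contributing index with first entry `p` whose first two spaces sum to the given
dimension. The jump property gives `q ≤ J 1`, so the sum in question lies inside a denominator that
avoids the vector. -/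
theorem IsMaximal.vec_notMem_zero_one (h : IsMaximal A) {p q : ℕ}
    (hpq : Module.finrank ℂ ↥((A 0).sp p ⊔ (A 1).sp q) + 2 ≤ n) :
    (A 0).vec p ∉ (A 0).sp p ⊔ (A 1).sp q := by
  have hp : p ≤ Module.finrank ℂ ↥((A 0).sp p ⊔ (A 1).sp q) := by
    have h1 := Submodule.finrank_mono (le_sup_left : (A 0).sp p ≤ (A 0).sp p ⊔ (A 1).sp q)
    rcases le_total p n with hp | hp
    · rwa [(A 0).finrank_sp hp] at h1
    · rw [(A 0).sp_of_le hp, finrank_top, Module.finrank_fin_fun] at h1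
      rw [(A 0).sp_of_le hp] at hpq
      omega
  obtain ⟨J, hJ, h0, h1, -⟩ := h.exists_index hp le_rfl hpq
  rw [spSum₂, h0] at h1
  have hq : q ≤ J 1 := by
    by_contra hlt
    have := finrank_lt_of_spVol_ne_zero hJ 1 (not_le.1 hlt) (sp_le_spSum A J 0)
    rw [h0] at this
    omega
  intro hmem
  refine vec_notMem_of_spVol_ne_zero hJ 0 ?_
  rw [h0]
  refine (sup_le ?_ ?_ : (A 0).sp p ⊔ (A 1).sp q ≤ spSum A J) hmem
  · rw [← h0]; exact sp_le_spSum A J 0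
  · exact ((A 1).sp_mono hq).trans (sp_le_spSum A J 1)

theorem IsMaximal.vec_notMem (h : IsMaximal A) {a b : Fin 4} (hab : a ≠ b) {p q : ℕ}
    (hpq : Module.finrank ℂ ↥((A a).sp p ⊔ (A b).sp q) + 2 ≤ n) :
    (A a).vec p ∉ (A a).sp p ⊔ (A b).sp q := by
  have key : ∀ a b : Fin 4, a ≠ b → ∃ σ : Equiv.Perm (Fin 4), σ 0 = a ∧ σ 1 = b := by decide
  obtain ⟨σ, rfl, rfl⟩ := key a b hab
  exact (h.perm σ).vec_notMem_zero_one hpq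

/-- The spaces of any two of the flags are in general position. -/
theorem IsMaximal.finrank_sup (h : IsMaximal A) {a b : Fin 4} (hab : a ≠ b) {p q : ℕ}
    (hpq : p + q < n) : Module.finrank ℂ ↥((A a).sp p ⊔ (A b).sp q) = p + q := by
  refine le_antisymm ?_ ?_
  · have := Submodule.finrank_add_le_finrank_add_finrank ((A a).sp p) ((A b).sp q)
    rwa [(A a).finrank_sp (by omega), (A b).finrank_sp (by omega)] at this
  · induction p with
    | zero =>
      rw [(A a).sp_zero, bot_sup_eq, (A b).finrank_sp (by omega)]
      omega
    | succ p ih =>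
      have h1 := ih (by omega)
      have h2 := Submodule.finrank_add_le_finrank_add_finrank ((A a).sp p) ((A b).sp q)
      rw [(A a).finrank_sp (by omega), (A b).finrank_sp (by omega)] at h2
      have h3 := h.vec_notMem hab (p := p) (q := q) (by omega)
      have h4 : (A a).sp p ⊔ (A b).sp q < (A a).sp (p + 1) ⊔ (A b).sp q := by
        refine lt_of_le_of_ne (sup_le_sup_right ((A a).sp_mono (Nat.le_succ p)) _) fun he => h3 ?_
        rw [he]
        exact Submodule.mem_sup_left ((A a).vec_mem (Nat.lt_succ_self p))
      have := Submodule.finrank_lt_finrank_of_lt h4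
      omega

/-- Otherwise general position gives two of the spaces a sum of dimension at least `n - 1`, but the
denominator of a contributing index has dimension at most `n - 2`. -/
theorem IsMaximal.add_le (h : IsMaximal A) {J : Fin 4 → ℕ} (hJ : spVol A J ≠ 0) {a b : Fin 4}
    (hab : a ≠ b) : J a + J b + 2 ≤ n := by
  have h1 := Submodule.finrank_mono (sup_le (sp_le_spSum A J a) (sp_le_spSum A J b))
  have h2 := finrank_spSum_add_two_le hJ
  have ha := lt_of_spVol_ne_zero hJ a
  by_contra hlt
  have h3 := h.finrank_sup hab (p := J a) (q := n - 1 - J a) (by omega)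
  have h4 := Submodule.finrank_mono (sup_le_sup_left ((A b).sp_mono
    (show n - 1 - J a ≤ J b by omega)) ((A a).sp (J a)))
  omega

/-- Permute the fourth flag to the front and prescribe the dimensions `0, p, p + q`. Because two
flags are in general position, these dimensions give the indices of the first two flags exactly. -/
theorem IsMaximal.exists_third_index (h : IsMaximal A) {p q : ℕ} (hpq : p + q + 2 ≤ n) :
    ∃ r, spVol A ![p, q, r, 0] ≠ 0 := by
  obtain ⟨σ, h0, h1, h2, h3⟩ : ∃ σ : Equiv.Perm (Fin 4), σ 0 = 3 ∧ σ 1 = 0 ∧ σ 2 = 1 ∧ σ 3 = 2 := by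
    decide
  obtain ⟨J, hJ, e0, e1, e2⟩ := (h.perm σ).exists_index (Nat.zero_le p) (Nat.le_add_right p q) hpq
  have hlt : J 1 < n := lt_of_spVol_ne_zero hJ 1
  have hs₂ : spSum₂ (fun i => A (σ i)) J = (A 0).sp (J 1) := by
    simp only [spSum₂]
    rw [e0, CFlag.sp_zero, bot_sup_eq, h1]
  have hs₃ : spSum₃ (fun i => A (σ i)) J = (A 0).sp (J 1) ⊔ (A 1).sp (J 2) := by
    simp only [spSum₃]
    rw [hs₂, h2]
  rw [hs₂, (A 0).finrank_sp hlt.le] at e1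
  rw [hs₃, e1] at e2
  have hJ1 := (h.perm σ).add_le hJ (show (1 : Fin 4) ≠ 2 by decide)
  rw [h.finrank_sup (by decide) (by omega)] at e2
  refine ⟨J 3, ?_⟩
  rw [← spVol_perm_ne_zero_iff σ]
  convert hJ using 2
  funext i
  fin_cases i
  · simp [h0, e0]
  · simp [h1, e1]
  · simp [h2]; omega
  · simp [h3]

/-- A strictly decreasing map of `{0, …, M}` to itself can only be `q ↦ M - q`. -/
theorem add_eq_of_strictAnti {M : ℕ} {R : ℕ → ℕ} (hR : ∀ q ≤ M, R q ≤ M)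
    (hanti : ∀ q q', q < q' → q' ≤ M → R q' < R q) {q : ℕ} (hq : q ≤ M) : q + R q = M := by
  have h1 : ∀ q ≤ M, q + R q ≤ M := by
    intro q
    induction q with
    | zero => intro h; simpa using hR 0 h
    | succ q ih =>
      intro h
      have := ih (by omega)
      have := hanti q (q + 1) (Nat.lt_succ_self q) h
      omega
  have h2 : ∀ d ≤ M, d ≤ R (M - d) := by
    intro d
    induction d with
    | zero => intro _; exact Nat.zero_le _
    | succ d ih =>
      intro h
      have := ih (by omega)
      have := hanti (M - (d + 1)) (M - d) (by omega) (by omega)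
      omega
  have h3 := h1 q hq
  have h4 := h2 (M - q) (by omega)
  rw [show M - (M - q) = q by omega] at h4
  omega

/-- For fixed `p` let `R q` be the third index supplied by `IsMaximal.exists_third_index`. Two
contributing indices that agree in the first and last place cannot be comparable in the others, so
`R` is strictly decreasing. -/
theorem IsMaximal.spVol_ne_zero (h : IsMaximal A) {p q m : ℕ} (hpq : p + q + m + 2 = n) :
    spVol A ![p, q, m, 0] ≠ 0 := by
  have hex : ∀ q, ∃ r, q ≤ n - 2 - p → spVol A ![p, q, r, 0] ≠ 0 := by
    intro q
    by_cases hq : q ≤ n - 2 - p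
    · obtain ⟨r, hr⟩ := h.exists_third_index (show p + q + 2 ≤ n by omega)
      exact ⟨r, fun _ => hr⟩
    · exact ⟨0, fun h => absurd h hq⟩
  choose R hR using hex
  have hle : ∀ q ≤ n - 2 - p, R q ≤ n - 2 - p := by
    intro q hq
    have := h.add_le (hR q hq) (show (0 : Fin 4) ≠ 2 by decide)
    simp only [Matrix.cons_val] at this
    omega
  have hanti : ∀ q q', q < q' → q' ≤ n - 2 - p → R q' < R q := by
    intro q q' hqq hq'
    by_contra hlt
    refine not_lt_of_spVol_ne_zero (hR q (by omega)) (hR q' hq') ?_ (a := 0) (b := 3) (by decide)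
      rfl rfl 1 hqq
    intro i
    fin_cases i
    · exact le_rfl
    · exact hqq.le
    · exact not_lt.1 hlt
    · exact le_rfl
  have := add_eq_of_strictAnti hle hanti (q := q) (by omega)
  have hm : R q = m := by omega
  have h1 := hR q (by omega)
  rwa [hm] at h1

theorem spVol_swap (A : Fin 4 → AffineFlag n) (p q m l : ℕ) :
    spVol (fun i => A (Equiv.swap 2 3 i)) ![p, q, m, l] = -spVol A ![p, q, l, m] := by
  have h := spVol_perm (Equiv.swap 2 3) A ![p, q, l, m]
  rw [Equiv.Perm.sign_swap (by decide)] at h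
  have hJ : (fun i => ![p, q, l, m] (Equiv.swap (2 : Fin 4) 3 i)) = ![p, q, m, l] := by
    funext i
    fin_cases i <;> rfl
  rw [hJ] at h
  rw [h]
  simp

theorem exists_spVol_eq (hn : 2 ≤ n)
    (h : |borelAffine n A| = n * ((n : ℝ) ^ 2 - 1) / 6 * v3) :
    ∃ s : ℝ, |s| = v3 ∧ ∀ p q m, p + q + m + 2 = n →
      spVol A ![p, q, m, 0] = s ∧ spVol A ![p, q, 0, m] = s := by
  obtain ⟨hmax, s, hs, hA⟩ := spVol_eq_of_abs_borelAffine_eq hn h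
  refine ⟨s, hs, fun p q m hpq => ⟨hA _ (IsMaximal.spVol_ne_zero hmax hpq), hA _ ?_⟩⟩
  have := (IsMaximal.perm hmax (Equiv.swap 2 3)).spVol_ne_zero hpq
  rwa [spVol_swap, neg_ne_zero] at this

end Maximal

/-! ## Rigidity -/

section Rigidity

variable {n : ℕ}

/-- Three vectors of a configuration of maximal volume determine the line of the fourth one. -/
theorem exists_smul_eq_of_Vol_eq {V : Type*} [AddCommGroup V] [Module ℂ V] {x x' : Fin 4 → V}
    (h : |Vol (Config.of x)| = v3) (h' : Vol (Config.of x') = Vol (Config.of x))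
    (h0 : x' 0 = x 0) (h1 : x' 1 = x 1) (h3 : x' 3 = x 3) : ∃ c : ℂ, x' 2 = c • x 2 := by
  have hne : Vol (Config.of x) ≠ 0 := by
    intro h0
    rw [h0, abs_zero] at h
    exact v3_pos.ne h
  have hne' : Vol (Config.of x') ≠ 0 := by rwa [h']
  obtain ⟨α, β, hαβ⟩ := exists_eq_of_Vol_ne_zero hne (show (0 : Fin 4) ≠ 1 by decide) 3
  obtain ⟨γ, δ, hγδ⟩ := exists_eq_of_Vol_ne_zero hne (show (0 : Fin 4) ≠ 1 by decide) 2
  obtain ⟨γ', δ', hγδ'⟩ := exists_eq_of_Vol_ne_zero hne' (show (0 : Fin 4) ≠ 1 by decide) 2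
  have hαβ' : x' 3 = α • x' 0 + β • x' 1 := by rw [h0, h1, h3, hαβ]
  obtain ⟨y, hb, hy, hV⟩ := exists_coordinates_of_Vol_ne_zero hne
  obtain ⟨y', hb', hy', hV'⟩ := exists_coordinates_of_Vol_ne_zero hne'
  -- The cross ratio is `(δ / γ) * (α / β)`. As `α` and `β` are common to both configurations, equal
  -- cross ratios fix `δ / γ`, that is, the line of the third vector.
  have key : ∀ {x : Fin 4 → V} {y : Fin 4 → Fin 2 → ℂ} {α β γ δ : ℂ},
      (∀ c : Fin 4 → ℂ, ∑ i, c i • x i = 0 ↔ ∑ i, c i • y i = 0) →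
      (∀ i j, i ≠ j → bracket (y i) (y j) ≠ 0) → x 3 = α • x 0 + β • x 1 →
      x 2 = γ • x 0 + δ • x 1 →
      α ≠ 0 ∧ β ≠ 0 ∧ γ ≠ 0 ∧ crossRatio y = δ * α / (β * γ) := by
    intro x y α β γ δ hy hb h3 h2
    have e3 : y 3 = α • y 0 + β • y 1 := by
      have := (hy ![α, β, 0, -1]).1 (by simp [Fin.sum_univ_four, h3]; abel)
      simp only [Fin.sum_univ_four, Matrix.cons_val, zero_smul, add_zero, neg_smul, one_smul] at this
      exact (add_neg_eq_zero.1 this).symm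
    have e2 : y 2 = γ • y 0 + δ • y 1 := by
      have := (hy ![γ, δ, -1, 0]).1 (by simp [Fin.sum_univ_four, h2]; abel)
      simp only [Fin.sum_univ_four, Matrix.cons_val, zero_smul, add_zero, neg_smul, one_smul] at this
      exact (add_neg_eq_zero.1 this).symm
    have b01 := hb 0 1 (by decide)
    have b02 : bracket (y 0) (y 2) = δ * bracket (y 0) (y 1) := by
      rw [e2]; simp [bracket]; ring
    have b13 : bracket (y 1) (y 3) = -α * bracket (y 0) (y 1) := by
      rw [e3]; simp [bracket]; ring
    have b03 : bracket (y 0) (y 3) = β * bracket (y 0) (y 1) := by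
      rw [e3]; simp [bracket]; ring
    have b12 : bracket (y 1) (y 2) = -γ * bracket (y 0) (y 1) := by
      rw [e2]; simp [bracket]; ring
    have hα : α ≠ 0 := by
      rintro rfl
      exact hb 1 3 (by decide) (by rw [b13]; simp)
    have hβ : β ≠ 0 := by
      rintro rfl
      exact hb 0 3 (by decide) (by rw [b03]; simp)
    have hγ : γ ≠ 0 := by
      rintro rfl
      exact hb 1 2 (by decide) (by rw [b12]; simp)
    refine ⟨hα, hβ, hγ, ?_⟩
    rw [crossRatio, b02, b13, b03, b12]
    field_simp
  obtain ⟨hα, hβ, hγ, hcr⟩ := key hy hb hαβ hγδ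
  obtain ⟨-, -, hγ', hcr'⟩ := key hy' hb' hαβ' hγδ'
  have hcc := crossRatio_eq_of_idealVolume_eq (y' := y') (hV ▸ h) (by rw [← hV, ← hV', h'])
  rw [hcr, hcr'] at hcc
  have hδ : δ' = γ' / γ * δ := by
    field_simp at hcc ⊢
    linear_combination -hcc
  refine ⟨γ' / γ, ?_⟩
  rw [hγδ', hγδ, h0, h1, hδ, smul_add, smul_smul, smul_smul, div_mul_cancel₀ _ hγ]

theorem AffineFlag.vec_notMem (A : AffineFlag n) {j : ℕ} (hj : j < n) : A.vec j ∉ A.sp j := by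
  have := A.v_notMem ⟨j, hj⟩
  rw [A.space_eq_sp] at this
  rw [AffineFlag.vec, dif_pos hj]
  exact this

theorem CFlag.sp_succ_eq (F : CFlag n) {j : ℕ} {x : Fin n → ℂ} (h : x ∈ F.sp (j + 1))
    (h' : x ∉ F.sp j) : F.sp (j + 1) = Submodule.span ℂ {x} ⊔ F.sp j := by
  by_cases hj : j + 1 ≤ n
  · refine (Submodule.eq_of_le_of_finrank_le (sup_le (by simpa using h)
      (F.sp_mono (Nat.le_succ j))) ?_).symm
    have : F.sp j < Submodule.span ℂ {x} ⊔ F.sp j := by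
      refine lt_of_le_of_ne le_sup_right fun he => h' ?_
      rw [he]
      exact Submodule.mem_sup_left (Submodule.mem_span_singleton_self x)
    have := Submodule.finrank_lt_finrank_of_lt this
    rw [F.finrank_sp (by omega)] at this
    rw [F.finrank_sp hj]
    exact this
  · exact absurd (by rw [F.sp_of_le (by omega)]; trivial) h'

theorem spVol_eq_Vol {A : Fin 4 → AffineFlag n} {J : Fin 4 → ℕ} {x : Fin 4 → Fin n → ℂ}
    (hx : ∀ i, x i ∈ (A i).sp (J i + 1)) (hx' : ∀ i, x i ∉ (A i).sp (J i)) :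
    spVol A J = Vol (Config.of fun i => (spSum A J).mkQ (x i)) := by
  have h : ∀ i, ∃ c : ℂ, c ≠ 0 ∧ x i - c • (A i).vec (J i) ∈ (A i).sp (J i) := by
    intro i
    have h1 := hx i
    rw [(A i).sp_succ, Submodule.mem_sup] at h1
    obtain ⟨y, hy, z, hz, he⟩ := h1
    obtain ⟨c, rfl⟩ := Submodule.mem_span_singleton.1 hy
    refine ⟨c, ?_, by rw [← he]; simpa using hz⟩
    rintro rfl
    exact hx' i (by rw [← he]; simpa using hz)
  choose c hc hxc using h
  exact (Vol_mkQ_congr hc fun i => sp_le_spSum A J i (hxc i)).symm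

theorem spSum_four (A : Fin 4 → AffineFlag n) (p q r : ℕ) :
    spSum A ![p, q, r, 0] = (A 0).sp p ⊔ (A 1).sp q ⊔ (A 2).sp r := by
  refine le_antisymm (iSup_le fun i => ?_) (sup_le (sup_le ?_ ?_) ?_)
  · fin_cases i
    · exact le_sup_of_le_left le_sup_left
    · exact le_sup_of_le_left le_sup_right
    · exact le_sup_right
    · simp [CFlag.sp_zero]
  · exact sp_le_spSum A ![p, q, r, 0] 0
  · exact sp_le_spSum A ![p, q, r, 0] 1
  · exact sp_le_spSum A ![p, q, r, 0] 2

theorem vec_notMem_span_sup {A : Fin 4 → AffineFlag n} {J : Fin 4 → ℕ} (h : spVol A J ≠ 0)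
    {a b : Fin 4} (hab : a ≠ b) {c : ℂ}
    (hc : c • (A a).vec (J a) ∈ Submodule.span ℂ {(A b).vec (J b)} ⊔ spSum A J) : c = 0 := by
  obtain ⟨y, hy, z, hz, he⟩ := Submodule.mem_sup.1 hc
  obtain ⟨d, rfl⟩ := Submodule.mem_span_singleton.1 hy
  refine (eq_zero_of_spVol_ne_zero h hab (α := c) (β := -d) ?_).1
  rw [← he]
  simpa using hz

/-- If all spaces but those of the third flag agree, so do the latter. -/
theorem sp_two_succ_eq {A A' : Fin 4 → AffineFlag n} {s : ℝ} (hs : |s| = v3)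
    (h : ∀ p q m, p + q + m + 2 = n → spVol A ![p, q, m, 0] = s)
    (h' : ∀ p q m, p + q + m + 2 = n → spVol A' ![p, q, m, 0] = s)
    (e0 : ∀ j, (A' 0).sp j = (A 0).sp j) (e1 : ∀ j, (A' 1).sp j = (A 1).sp j)
    (e3 : (A' 3).sp 1 = (A 3).sp 1) {j : ℕ} (hj : j + 2 ≤ n) (e2 : (A' 2).sp j = (A 2).sp j) :
    (A' 2).sp (j + 1) = (A 2).sp (j + 1) := by
  have hs0 : s ≠ 0 := by
    rintro rfl
    rw [abs_zero] at hs
    exact v3_pos.ne hs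
  obtain ⟨M, rfl⟩ := Nat.exists_eq_add_of_le hj
  have hne : ∀ p q, p + q = M → spVol A ![p, q, j, 0] ≠ 0 := fun p q hpq => by
    rwa [h p q j (by omega)]
  set w := (A' 2).vec j with hw
  set x := (A 2).vec j with hx
  set U : ℕ → ℕ → Submodule ℂ (Fin (j + 2 + M) → ℂ) :=
    fun p q => (A 0).sp p ⊔ (A 1).sp q ⊔ (A 2).sp j with hU
  have hUmono : ∀ {p p' q q'}, p ≤ p' → q ≤ q' → U p q ≤ U p' q' := fun hp hq =>
    sup_le_sup_right (sup_le_sup ((A 0).sp_mono hp) ((A 1).sp_mono hq)) _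
  -- In each quotient by `U p q` the volume `s` and the other three vectors are the same for both
  -- quadruples, so the cross ratio pins down the line of the new vector.
  have hc : ∀ p q, p + q = M → ∃ c : ℂ, w - c • x ∈ U p q := by
    intro p q hpq
    have hUs : spSum A ![p, q, j, 0] = U p q := spSum_four A p q j
    have hUs' : spSum A' ![p, q, j, 0] = U p q := by
      rw [spSum_four, e0, e1, e2]
    have hV : s = Vol (Config.of fun i => (U p q).mkQ ((A i).vec (![p, q, j, 0] i))) := by
      rw [← h p q j (by omega), spVol, hUs]
    have hV' : s = Vol (Config.of fun i => (U p q).mkQ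
        ((![(A 0).vec p, (A 1).vec q, w, (A 3).vec 0] : Fin 4 → _) i)) := by
      rw [← h' p q j (by omega), spVol_eq_Vol, hUs']
      · intro i
        fin_cases i
        · simpa [e0] using (A 0).vec_mem (Nat.lt_succ_self p)
        · simpa [e1] using (A 1).vec_mem (Nat.lt_succ_self q)
        · simpa using (A' 2).vec_mem (Nat.lt_succ_self j)
        · simpa [e3] using (A 3).vec_mem Nat.zero_lt_one
      · intro i
        fin_cases i
        · simpa [e0] using (A 0).vec_notMem (show p < j + 2 + M by omega)
        · simpa [e1] using (A 1).vec_notMem (show q < j + 2 + M by omega)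
        · simpa using (A' 2).vec_notMem (show j < j + 2 + M by omega)
        · simpa [CFlag.sp_zero] using (A 3).vec_notMem (show 0 < j + 2 + M by omega)
    obtain ⟨c, hc⟩ := exists_smul_eq_of_Vol_eq (hV ▸ hs) (hV'.symm.trans hV) rfl rfl rfl
    refine ⟨c, ?_⟩
    rw [← Submodule.Quotient.mk_eq_zero, ← Submodule.mkQ_apply, map_sub, map_smul, sub_eq_zero]
    exact hc
  -- The factor does not depend on `p`: neighbouring values can be compared modulo the sum for `p`
  -- enlarged by the vector of the first flag, where `x` is still nonzero.
  have hconst : ∃ c : ℂ, ∀ p ≤ M, w - c • x ∈ U p (M - p) := by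
    obtain ⟨c, hc0⟩ := hc 0 M (by omega)
    refine ⟨c, fun p => ?_⟩
    induction p with
    | zero => intro _; exact hc0
    | succ p ih =>
      intro hp
      have h1 := ih (by omega)
      obtain ⟨d, hd⟩ := hc (p + 1) (M - (p + 1)) (by omega)
      have hle : U (p + 1) (M - (p + 1)) ≤
          Submodule.span ℂ {(A 0).vec p} ⊔ spSum A ![p, M - p, j, 0] := by
        rw [spSum_four]
        refine sup_le (sup_le ?_ ?_) (le_sup_of_le_right le_sup_right)
        · rw [(A 0).sp_succ]
          exact sup_le_sup_left (le_sup_of_le_left le_sup_left) _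
        · exact le_sup_of_le_right (le_sup_of_le_left
            (le_sup_of_le_right ((A 1).sp_mono (by omega))))
      have hle' : U p (M - p) ≤
          Submodule.span ℂ {(A 0).vec p} ⊔ spSum A ![p, M - p, j, 0] := by
        rw [spSum_four]
        exact le_sup_right
      have hdc : d - c = 0 := by
        refine vec_notMem_span_sup (hne p (M - p) (by omega)) (a := 2) (b := 0) (by decide) ?_
        have := Submodule.sub_mem _ (hle' h1) (hle hd)
        simpa [sub_smul] using this
      rw [sub_eq_zero] at hdc
      rwa [← hdc]
  obtain ⟨c, hcx⟩ := hconst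
  -- The intersection of the spaces `U p (M - p)` is the `j`-th space of the third flag. It is
  -- reached by removing one vector of the second flag at a time: its coefficient must vanish
  -- because it is independent of `U (k + 1) (M - (k + 1))`.
  have hdesc : ∀ k ≤ M, w - c • x ∈ U 0 (M - k) := by
    intro k
    induction k with
    | zero => intro _; exact hcx 0 (Nat.zero_le _)
    | succ k ih =>
      intro hk
      have h1 := ih (by omega)
      have h2 := hcx (k + 1) hk
      have hq : M - k = M - (k + 1) + 1 := by omega
      have hle : U 0 (M - k) ≤ Submodule.span ℂ {(A 1).vec (M - (k + 1))} ⊔ U 0 (M - (k + 1)) := by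
        rw [hq]
        refine sup_le (sup_le ?_ ?_) (le_sup_of_le_right le_sup_right)
        · exact le_sup_of_le_right (le_sup_of_le_left le_sup_left)
        · rw [(A 1).sp_succ]
          exact sup_le_sup_left (le_sup_of_le_left le_sup_right) _
      obtain ⟨y, hy, z, hz, he⟩ := Submodule.mem_sup.1 (hle h1)
      obtain ⟨d, rfl⟩ := Submodule.mem_span_singleton.1 hy
      have hd : d = 0 := by
        by_contra hd
        refine vec_notMem_of_spVol_ne_zero (hne (k + 1) (M - (k + 1)) (by omega)) 1 ?_
        rw [spSum_four]
        refine (Submodule.smul_mem_iff _ hd).1 ?_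
        have h3 := Submodule.sub_mem _ h2 (hUmono (Nat.zero_le (k + 1)) le_rfl hz)
        rw [← he, add_sub_cancel_right] at h3
        exact h3
      rw [← he, hd, zero_smul, zero_add]
      exact hz
  have hfin := hdesc M le_rfl
  rw [hU] at hfin
  simp only [Nat.sub_self, CFlag.sp_zero, bot_sup_eq] at hfin
  refine Submodule.eq_of_le_of_finrank_eq ?_ ?_
  · rw [(A' 2).sp_succ, e2]
    refine sup_le ?_ ((A 2).sp_mono (Nat.le_succ j))
    rw [Submodule.span_singleton_le_iff_mem, ← hw, ← sub_add_cancel w (c • x)]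
    exact Submodule.add_mem _ ((A 2).sp_mono (Nat.le_succ j) hfin)
      (Submodule.smul_mem _ _ ((A 2).vec_mem (Nat.lt_succ_self j)))
  · rw [(A' 2).finrank_sp (by omega), (A 2).finrank_sp (by omega)]

theorem toCFlag_two_eq {A A' : Fin 4 → AffineFlag n} {s : ℝ} (hs : |s| = v3)
    (h : ∀ p q m, p + q + m + 2 = n → spVol A ![p, q, m, 0] = s)
    (h' : ∀ p q m, p + q + m + 2 = n → spVol A' ![p, q, m, 0] = s)
    (e0 : ∀ j, (A' 0).sp j = (A 0).sp j) (e1 : ∀ j, (A' 1).sp j = (A 1).sp j)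
    (e3 : (A' 3).sp 1 = (A 3).sp 1) (j : ℕ) : (A' 2).sp j = (A 2).sp j := by
  induction j with
  | zero => rw [CFlag.sp_zero, CFlag.sp_zero]
  | succ j ih =>
    by_cases hj : j + 2 ≤ n
    · exact sp_two_succ_eq hs h h' e0 e1 e3 hj ih
    · rw [CFlag.sp_of_le _ (by omega), CFlag.sp_of_le _ (by omega)]

end Rigidity

/-! ### Normalising two flags and a line -/

section AdaptedBasis

variable {n : ℕ} {A : Fin 4 → AffineFlag n}

/-- For `p + q ≤ n - 2` the sum lies in a denominator. The remaining case `p + q = n - 1` uses that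
the vectors of the first two flags are independent modulo the denominator with `p` lowered by one.
-/
theorem vec_one_notMem (h : ∀ p q m, p + q + m + 2 = n → spVol A ![p, q, m, 0] ≠ 0) {p q : ℕ}
    (hpq : p + q < n) : (A 1).vec q ∉ (A 0).sp p ⊔ (A 1).sp q := by
  intro hmem
  by_cases h1 : p + q + 2 ≤ n
  · obtain ⟨m, hm⟩ := Nat.exists_eq_add_of_le h1
    have := h p q m (by omega)
    refine vec_notMem_of_spVol_ne_zero this 1 ?_
    rw [spSum_four]
    exact Submodule.mem_sup_left hmem
  · rcases p with _ | p
    · rw [CFlag.sp_zero, bot_sup_eq] at hmem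
      exact (A 1).vec_notMem (by omega) hmem
    · refine one_ne_zero (vec_notMem_span_sup (h p q 0 (by omega)) (a := 1) (b := 0) (by decide)
        (c := 1) ?_)
      rw [one_smul, spSum_four, CFlag.sp_zero, sup_bot_eq, ← sup_assoc]
      simpa [(A 0).sp_succ] using hmem

theorem sup_eq_top (h : ∀ p q m, p + q + m + 2 = n → spVol A ![p, q, m, 0] ≠ 0) {p : ℕ}
    (hp : p ≤ n) : (A 0).sp p ⊔ (A 1).sp (n - p) = ⊤ := by
  have key : ∀ q, p + q ≤ n → p + q ≤ Module.finrank ℂ ↥((A 0).sp p ⊔ (A 1).sp q) := by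
    intro q
    induction q with
    | zero =>
      intro _
      rw [CFlag.sp_zero, sup_bot_eq, (A 0).finrank_sp hp]
      rfl
    | succ q ih =>
      intro hq
      have h1 := ih (by omega)
      have h2 : (A 0).sp p ⊔ (A 1).sp q < (A 0).sp p ⊔ (A 1).sp (q + 1) := by
        refine lt_of_le_of_ne (sup_le_sup_left ((A 1).sp_mono (Nat.le_succ q)) _) fun he =>
          vec_one_notMem h (show p + q < n by omega) ?_
        rw [he]
        exact Submodule.mem_sup_right ((A 1).vec_mem (Nat.lt_succ_self q))
      have := Submodule.finrank_lt_finrank_of_lt h2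
      omega
  refine Submodule.eq_top_of_finrank_eq (le_antisymm (Submodule.finrank_le _) ?_)
  rw [Module.finrank_fin_fun]
  have := key (n - p) (by omega)
  omega

/-- The sum is a denominator plus one further vector of the first or second flag, and that vector is
independent of the one of the fourth flag. -/
theorem vec_three_notMem (hn : 2 ≤ n)
    (h : ∀ p q m, p + q + m + 2 = n → spVol A ![p, q, m, 0] ≠ 0) {p q : ℕ}
    (hpq : p + q + 1 = n) : (A 3).vec 0 ∉ (A 0).sp p ⊔ (A 1).sp q := by
  intro hmem
  rcases p with _ | p
  · obtain ⟨q, rfl⟩ : ∃ r, q = r + 1 := ⟨q - 1, by omega⟩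
    refine one_ne_zero (vec_notMem_span_sup (h 0 q 0 (by omega)) (a := 3) (b := 1) (by decide)
      (c := 1) ?_)
    rw [one_smul, spSum_four, CFlag.sp_zero, CFlag.sp_zero, sup_bot_eq, bot_sup_eq]
    rw [CFlag.sp_zero, bot_sup_eq] at hmem
    simpa [(A 1).sp_succ] using hmem
  · refine one_ne_zero (vec_notMem_span_sup (h p q 0 (by omega)) (a := 3) (b := 0) (by decide)
      (c := 1) ?_)
    rw [one_smul, spSum_four, CFlag.sp_zero, sup_bot_eq, ← sup_assoc]
    simpa [(A 0).sp_succ] using hmem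

/-- A basis adapted to the first two flags, whose sum spans the line of the fourth flag. -/
theorem exists_adapted_basis (hn : 2 ≤ n)
    (h : ∀ p q m, p + q + m + 2 = n → spVol A ![p, q, m, 0] ≠ 0) :
    ∃ b : Module.Basis (Fin n) ℂ (Fin n → ℂ),
      (∀ j ≤ n, (A 0).sp j = Submodule.span ℂ (b '' {i | (i : ℕ) < j})) ∧
      (∀ j ≤ n, (A 1).sp j = Submodule.span ℂ (b '' {i | n ≤ i + j})) ∧
      (A 3).sp 1 = Submodule.span ℂ {∑ i, b i} := by
  set x := (A 3).vec 0 with hx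
  -- Here `a` is a component of `x` in the `p`-th space of the first flag along the complementary
  -- space of the second.
  have hdec : ∀ p, ∃ a, p ≤ n → a ∈ (A 0).sp p ∧ x - a ∈ (A 1).sp (n - p) := by
    intro p
    by_cases hp : p ≤ n
    · have hmem : x ∈ (A 0).sp p ⊔ (A 1).sp (n - p) := by rw [sup_eq_top h hp]; trivial
      obtain ⟨a, ha, b, hb, he⟩ := Submodule.mem_sup.1 hmem
      exact ⟨a, fun _ => ⟨ha, by rw [← he]; simpa using hb⟩⟩
    · exact ⟨0, fun h => absurd h hp⟩
  choose a ha using hdec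
  -- Differences of consecutive components lie in the `p + 1`-st space of the first flag and the `n
  -- - p`-th of the second, and they sum to `x`.
  set e : ℕ → Fin n → ℂ := fun p => a (p + 1) - a p with he
  have he0 : ∀ p < n, e p ∈ (A 0).sp (p + 1) := fun p hp =>
    Submodule.sub_mem _ (ha (p + 1) hp).1 ((A 0).sp_mono (Nat.le_succ p) (ha p hp.le).1)
  have he1 : ∀ p < n, e p ∈ (A 1).sp (n - p) := by
    intro p hp
    have : e p = (x - a p) - (x - a (p + 1)) := by simp [he]
    rw [this]
    exact Submodule.sub_mem _ (ha p hp.le).2 ((A 1).sp_mono (by omega) (ha (p + 1) hp).2)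
  -- Otherwise `x` would lie in the sum of spaces of dimensions `p` and `n - p - 1`, against the
  -- general position of the line.
  have he0' : ∀ p < n, e p ∉ (A 0).sp p := by
    intro p hp hmem
    refine vec_three_notMem hn h (show p + (n - (p + 1)) + 1 = n by omega) ?_
    have h1 : a (p + 1) ∈ (A 0).sp p := by
      have := Submodule.add_mem _ hmem (ha p hp.le).1
      simpa [he] using this
    have h2 := (ha (p + 1) hp).2
    rw [← hx, ← add_sub_cancel (a (p + 1)) x]
    exact Submodule.add_mem _ (Submodule.mem_sup_left h1) (Submodule.mem_sup_right h2)
  have he1' : ∀ p < n, e p ∉ (A 1).sp (n - (p + 1)) := by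
    intro p hp hmem
    refine vec_three_notMem hn h (show p + (n - (p + 1)) + 1 = n by omega) ?_
    have h1 : x - a p ∈ (A 1).sp (n - (p + 1)) := by
      have := Submodule.add_mem _ hmem (ha (p + 1) hp).2
      simpa [he] using this
    rw [← hx, ← add_sub_cancel (a p) x]
    exact Submodule.add_mem _ (Submodule.mem_sup_left (ha p hp.le).1) (Submodule.mem_sup_right h1)
  have hsum : ∑ i : Fin n, e i = x := by
    have h0 : a 0 = 0 := by
      have := (ha 0 (Nat.zero_le n)).1
      rwa [CFlag.sp_zero, Submodule.mem_bot] at this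
    have hn' : x = a n := by
      have := (ha n le_rfl).2
      rwa [Nat.sub_self, CFlag.sp_zero, Submodule.mem_bot, sub_eq_zero] at this
    rw [Fin.sum_univ_eq_sum_range, Finset.sum_range_sub, h0, sub_zero, hn']
  have hspan0 : ∀ j ≤ n, (A 0).sp j =
      Submodule.span ℂ ((fun i : Fin n => e i) '' {i | (i : ℕ) < j}) := by
    intro j
    induction j with
    | zero => intro _; simp [CFlag.sp_zero]
    | succ j ih =>
      intro hj
      rw [CFlag.sp_succ_eq _ (he0 j hj) (he0' j hj), ih (by omega), ← Submodule.span_union]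
      congr 1
      ext y
      constructor
      · rintro (rfl | ⟨i, hi, rfl⟩)
        · exact ⟨⟨j, hj⟩, Nat.lt_succ_self j, rfl⟩
        · exact ⟨i, Nat.lt_succ_of_lt hi, rfl⟩
      · rintro ⟨i, hi, rfl⟩
        rcases Nat.lt_succ_iff_lt_or_eq.1 hi with hi | hi
        · exact Or.inr ⟨i, hi, rfl⟩
        · exact Or.inl (by simp [hi])
  have hspan1 : ∀ j ≤ n, (A 1).sp j =
      Submodule.span ℂ ((fun i : Fin n => e i) '' {i | n ≤ i + j}) := by
    intro j
    induction j with
    | zero =>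
      intro _
      have : {i : Fin n | n ≤ i + 0} = ∅ := by
        ext i
        have := i.2
        simp
      rw [this]
      simp [CFlag.sp_zero]
    | succ j ih =>
      intro hj
      have h1 := he1 (n - (j + 1)) (by omega)
      have h2 := he1' (n - (j + 1)) (by omega)
      rw [show n - (n - (j + 1)) = j + 1 by omega] at h1
      rw [show n - (n - (j + 1) + 1) = j by omega] at h2
      rw [CFlag.sp_succ_eq _ h1 h2, ih (by omega), ← Submodule.span_union]
      congr 1
      ext y
      constructor
      · rintro (rfl | ⟨i, hi, rfl⟩)
        · exact ⟨⟨n - (j + 1), by omega⟩, by show n ≤ n - (j + 1) + (j + 1); omega, rfl⟩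
        · have hi : n ≤ i + j := hi
          exact ⟨i, by show n ≤ i + (j + 1); omega, rfl⟩
      · rintro ⟨i, hi, rfl⟩
        have hi : n ≤ i + (j + 1) := hi
        rcases Nat.lt_or_ge (i + j) n with hi' | hi'
        · exact Or.inl (by simp [show (i : ℕ) = n - (j + 1) by omega])
        · exact Or.inr ⟨i, hi', rfl⟩
  have htop : ⊤ ≤ Submodule.span ℂ (range fun i : Fin n => e i) := by
    rw [← (A 0).sp_of_le le_rfl, hspan0 n le_rfl]
    exact Submodule.span_mono (image_subset_range _ _)
  let b := basisOfTopLeSpanOfCardEqFinrank (fun i : Fin n => e i) htop (by simp)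
  have hb : ⇑b = fun i : Fin n => e i := coe_basisOfTopLeSpanOfCardEqFinrank _ _ _
  refine ⟨b, ?_, ?_, ?_⟩
  · rwa [hb]
  · rwa [hb]
  · rw [hb, hsum, (A 3).sp_succ, CFlag.sp_zero, sup_bot_eq]

theorem exists_glEquiv_eq (e : (Fin n → ℂ) ≃ₗ[ℂ] (Fin n → ℂ)) :
    ∃ g : GL (Fin n) ℂ, glEquiv g = e :=
  ⟨Matrix.GeneralLinearGroup.toLin.symm
    ((LinearMap.GeneralLinearGroup.generalLinearEquiv ℂ _).symm e), by simp [glEquiv]⟩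

theorem CFlag.smul_sp (g : GL (Fin n) ℂ) (F : CFlag n) (j : ℕ) :
    (g • F).sp j = (F.sp j).map (glEquiv g).toLinearMap := rfl

/-- Match the two adapted bases: they determine the first two flags, and the sum of the basis
vectors determines the line. -/
theorem exists_gl_map_eq {A A' : Fin 4 → AffineFlag n} (hn : 2 ≤ n)
    (h : ∀ p q m, p + q + m + 2 = n → spVol A ![p, q, m, 0] ≠ 0)
    (h' : ∀ p q m, p + q + m + 2 = n → spVol A' ![p, q, m, 0] ≠ 0) :
    ∃ g : GL (Fin n) ℂ, (∀ j, (g • (A 0).toCFlag).sp j = (A' 0).sp j) ∧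
      (∀ j, (g • (A 1).toCFlag).sp j = (A' 1).sp j) ∧ (g • (A 3).toCFlag).sp 1 = (A' 3).sp 1 := by
  obtain ⟨b, h0, h1, h3⟩ := exists_adapted_basis hn h
  obtain ⟨b', h0', h1', h3'⟩ := exists_adapted_basis hn h'
  obtain ⟨g, hg⟩ := exists_glEquiv_eq (b.equiv b' (Equiv.refl _))
  have hgb : ∀ i, glEquiv g (b i) = b' i := fun i => by rw [hg]; simp
  have himg : ∀ s : Set (Fin n), (Submodule.span ℂ (b '' s)).map (glEquiv g).toLinearMap =
      Submodule.span ℂ (b' '' s) := by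
    intro s
    rw [Submodule.map_span, image_image]
    congr 1
    exact image_congr fun i _ => hgb i
  refine ⟨g, fun j => ?_, fun j => ?_, ?_⟩
  · rcases le_total j n with hj | hj
    · rw [CFlag.smul_sp, h0 j hj, h0' j hj, himg]
    · rw [CFlag.sp_of_le _ hj, CFlag.sp_of_le _ hj]
  · rcases le_total j n with hj | hj
    · rw [CFlag.smul_sp, h1 j hj, h1' j hj, himg]
    · rw [CFlag.sp_of_le _ hj, CFlag.sp_of_le _ hj]
  · rw [CFlag.smul_sp, h3, h3', Submodule.map_span, image_singleton]
    congr 2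
    simp [map_sum, hgb]

theorem spVol_eq_flagVol (A : Fin 4 → AffineFlag n) (J : Fin 4 → Fin n) :
    spVol A (fun i => J i) = flagVol (fun i => (A i).toCFlag) J := by
  rw [← Vol_tConfig_eq_spVol, Vol_tConfig]

theorem spVol_smul {A B : Fin 4 → AffineFlag n} {g : GL (Fin n) ℂ}
    (h : ∀ i, (B i).toCFlag = g • (A i).toCFlag) {J : Fin 4 → ℕ} (hJ : ∀ i, J i < n) :
    spVol B J = spVol A J := by
  have hB := spVol_eq_flagVol B fun i => ⟨J i, hJ i⟩
  have hA := spVol_eq_flagVol A fun i => ⟨J i, hJ i⟩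
  simp only [h, flagVol_smul] at hB
  exact hB.trans hA.symm

/-- Two quadruples of flags with the same maximal volumes differ by a linear automorphism. -/
theorem exists_smul_eq_of_spVol_eq {A A' : Fin 4 → AffineFlag n} (hn : 2 ≤ n) {s : ℝ}
    (hs : |s| = v3)
    (h : ∀ p q m, p + q + m + 2 = n → spVol A ![p, q, m, 0] = s ∧ spVol A ![p, q, 0, m] = s)
    (h' : ∀ p q m, p + q + m + 2 = n → spVol A' ![p, q, m, 0] = s ∧ spVol A' ![p, q, 0, m] = s) :
    ∃ g : GL (Fin n) ℂ, ∀ i, (A i).toCFlag = g • (A' i).toCFlag := by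
  have hs0 : s ≠ 0 := by
    rintro rfl
    rw [abs_zero] at hs
    exact v3_pos.ne hs
  obtain ⟨g, g0, g1, g3⟩ := exists_gl_map_eq hn (A := A') (A' := A)
    (fun p q m hpq => by rwa [(h' p q m hpq).1]) (fun p q m hpq => by rwa [(h p q m hpq).1])
  obtain ⟨B, hB⟩ := exists_lift fun i => g • (A' i).toCFlag
  have hB' : ∀ i, (B i).toCFlag = g • (A' i).toCFlag := fun i => congrFun hB i
  have hBs : ∀ p q m, p + q + m + 2 = n →
      spVol B ![p, q, m, 0] = s ∧ spVol B ![p, q, 0, m] = s := by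
    intro p q m hpq
    rw [spVol_smul hB', spVol_smul hB']
    · exact h' p q m hpq
    all_goals
      intro i
      fin_cases i <;> simp <;> omega
  rw [← hB' 0] at g0
  rw [← hB' 1] at g1
  rw [← hB' 3] at g3
  have g2 := toCFlag_two_eq hs (fun p q m hpq => (h p q m hpq).1)
    (fun p q m hpq => (hBs p q m hpq).1) g0 g1 g3
  -- The third flags now agree, in particular their lines. After exchanging the last two flags the
  -- same rigidity applies to the fourth; the swap changes the sign of all volumes.
  have g3' := toCFlag_two_eq (A := fun i => A (Equiv.swap 2 3 i))
    (A' := fun i => B (Equiv.swap 2 3 i)) (s := -s) (by rwa [abs_neg])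
    (fun p q m hpq => by rw [spVol_swap, (h p q m hpq).2])
    (fun p q m hpq => by rw [spVol_swap, (hBs p q m hpq).2]) g0 g1 (g2 1)
  refine ⟨g, fun i => ?_⟩
  rw [← hB' i]
  refine CFlag.ext_sp fun j => ?_
  fin_cases i
  · exact (g0 j).symm
  · exact (g1 j).symm
  · exact (g2 j).symm
  · exact (g3' j).symm

end AdaptedBasis

/-! ## Volumes of Veronese flags -/

section Veronese

open Polynomial in
/-- The linear form `p₀ + p₁ X`. -/
def linForm (p : Fin 2 → ℂ) : ℂ[X] := C (p 0) + C (p 1) * X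

open Polynomial in
/-- The first `n` coefficients of a polynomial. -/
def coeffVec (n : ℕ) : ℂ[X] →ₗ[ℂ] (Fin n → ℂ) := LinearMap.pi fun m => lcoeff ℂ m

-- This reads the Veronese space of dimension `j` as the multiples of `linForm p ^ (n - j)` among
-- polynomials of degree below `n`; the recursion in `i` is multiplication by the linear form.
open Polynomial in
theorem veroneseVector_eq (n i : ℕ) (p : Fin 2 → ℂ) (k : ℕ) :
    veroneseVector n i p k = coeffVec n (linForm p ^ i * X ^ k) := by
  induction i generalizing k with
  | zero =>
    ext m
    simp only [veroneseVector, coeffVec, pow_zero, one_mul, LinearMap.pi_apply, lcoeff_apply,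
      coeff_X_pow]
    rcases lt_trichotomy k (m : ℕ) with h | h | h
    · rw [if_pos h.le, if_neg h.ne', Nat.choose_eq_zero_of_lt (by omega)]
      simp
    · simp [h]
    · rw [if_neg (by omega), if_neg h.ne]
  | succ i ih =>
    rw [veroneseVector_succ, ih, ih, ← map_smul, ← map_smul, ← map_add]
    congr 1
    rw [smul_eq_C_mul, smul_eq_C_mul, linForm]
    ring

-- Products of two independent linear forms of total degree `j - 1` generate all polynomials of
-- degree below `j`, since `1` and `X` are combinations of the two forms.
open Polynomial in
theorem X_pow_mem_span {p q : Fin 2 → ℂ} (h : bracket p q ≠ 0) {j k : ℕ} (hk : k < j) :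
    (X ^ k : ℂ[X]) ∈ Submodule.span ℂ
      (range fun a : Fin j => linForm q ^ (j - 1 - a) * linForm p ^ (a : ℕ)) := by
  induction j generalizing k with
  | zero => omega
  | succ j ih =>
    rcases j with _ | j
    · obtain rfl : k = 0 := by omega
      exact Submodule.subset_span ⟨0, by simp⟩
    set W := Submodule.span ℂ
      (range fun a : Fin (j + 1) => linForm q ^ (j + 1 - 1 - a) * linForm p ^ (a : ℕ)) with hW
    set W' := Submodule.span ℂ
      (range fun a : Fin (j + 1 + 1) =>
        linForm q ^ (j + 1 + 1 - 1 - a) * linForm p ^ (a : ℕ)) with hW'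
    have hq : ∀ f ∈ W, linForm q * f ∈ W' := by
      intro f hf
      refine Submodule.span_induction (p := fun f _ => linForm q * f ∈ W') ?_ (by simp)
        (fun f g _ _ hf hg => by rw [mul_add]; exact Submodule.add_mem _ hf hg)
        (fun c f _ hf => by rw [mul_smul_comm]; exact Submodule.smul_mem _ _ hf) hf
      rintro _ ⟨a, rfl⟩
      refine Submodule.subset_span ⟨a.castSucc, ?_⟩
      have : j + 1 + 1 - 1 - (a : ℕ) = j + 1 - 1 - a + 1 := by omega
      simp only [Fin.val_castSucc, this]
      ring
    have hp : ∀ f ∈ W, linForm p * f ∈ W' := by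
      intro f hf
      refine Submodule.span_induction (p := fun f _ => linForm p * f ∈ W') ?_ (by simp)
        (fun f g _ _ hf hg => by rw [mul_add]; exact Submodule.add_mem _ hf hg)
        (fun c f _ hf => by rw [mul_smul_comm]; exact Submodule.smul_mem _ _ hf) hf
      rintro _ ⟨a, rfl⟩
      refine Submodule.subset_span ⟨a.succ, ?_⟩
      have : j + 1 + 1 - 1 - ((a : ℕ) + 1) = j + 1 - 1 - a := by omega
      simp only [Fin.val_succ, this]
      ring
    rcases k with _ | k
    -- Here `q 1 * linForm p - p 1 * linForm q` is the constant `bracket p q`; in the next case the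
    -- analogous combination with `p 0` and `q 0` is `bracket p q` times `X`.
    · have h1 := Submodule.sub_mem _ (Submodule.smul_mem _ (q 1) (hp _ (ih (Nat.zero_lt_succ j))))
        (Submodule.smul_mem _ (p 1) (hq _ (ih (Nat.zero_lt_succ j))))
      refine (Submodule.smul_mem_iff _ h).1 ?_
      convert h1 using 1
      simp only [smul_eq_C_mul, linForm, bracket, C_sub, C_mul]
      ring
    · have h1 := Submodule.sub_mem _
        (Submodule.smul_mem _ (p 0) (hq _ (ih (show k < j + 1 by omega))))
        (Submodule.smul_mem _ (q 0) (hp _ (ih (show k < j + 1 by omega))))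
      refine (Submodule.smul_mem_iff _ h).1 ?_
      convert h1 using 1
      simp only [smul_eq_C_mul, linForm, bracket, C_sub, C_mul]
      ring

theorem ne_zero_of_bracket {p q : Fin 2 → ℂ} (h : bracket p q ≠ 0) : p ≠ 0 ∧ q ≠ 0 := by
  constructor <;> rintro rfl <;> simp [bracket] at h

/-- The multiples of a power of `linForm q` are spanned by monomials in both forms, and the number
of monomials is the dimension. In this basis polar derivations act diagonally up to a shift. -/
theorem veroneseSpace_eq_span {n j : ℕ} (hj : j ≤ n) {p q : Fin 2 → ℂ} (h : bracket p q ≠ 0) :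
    veroneseSpace n q j = Submodule.span ℂ (range fun a : Fin j =>
      coeffVec n (linForm q ^ (n - 1 - a) * linForm p ^ (a : ℕ))) := by
  refine Submodule.eq_of_le_of_finrank_le ?_ ?_
  · rw [veroneseSpace, Submodule.span_le]
    rintro _ ⟨k, hk, rfl⟩
    rw [veroneseVector_eq]
    have h1 := Submodule.mem_map_of_mem
      (f := (coeffVec n).comp (LinearMap.mulLeft ℂ (linForm q ^ (n - j)))) (X_pow_mem_span h hk)
    rw [Submodule.map_span, ← range_comp] at h1
    have h2 : (((coeffVec n).comp (LinearMap.mulLeft ℂ (linForm q ^ (n - j)))) ∘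
        fun a : Fin j => linForm q ^ (j - 1 - a) * linForm p ^ (a : ℕ)) =
        fun a : Fin j => coeffVec n (linForm q ^ (n - 1 - a) * linForm p ^ (a : ℕ)) := by
      funext a
      simp only [Function.comp_apply, LinearMap.comp_apply, LinearMap.mulLeft_apply, ← mul_assoc,
        ← pow_add]
      rw [show n - j + (j - 1 - (a : ℕ)) = n - 1 - a by omega]
    rw [h2] at h1
    exact h1
  · rw [finrank_veroneseSpace (ne_zero_of_bracket h).2 hj]
    exact (finrank_range_le_card (R := ℂ) fun a : Fin j =>
      coeffVec n (linForm q ^ (n - 1 - a) * linForm p ^ (a : ℕ))).trans_eq (Fintype.card_fin j)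

/-- The derivation of binary forms of degree `N` that kills the linear form of `p`. -/
def polar (N : ℕ) (p : Fin 2 → ℂ) : (Fin (N + 1) → ℂ) →ₗ[ℂ] (Fin N → ℂ) where
  toFun f m := p 1 * (N - m) * f m.castSucc - p 0 * (m + 1) * f m.succ
  map_add' f g := by ext m; simp only [Pi.add_apply]; ring
  map_smul' c f := by
    ext m
    simp only [Pi.smul_apply, smul_eq_mul, RingHom.id_apply]
    ring

open Polynomial in
theorem polar_coeffVec (N : ℕ) (p : Fin 2 → ℂ) (f : ℂ[X]) :
    polar N p (coeffVec (N + 1) f) =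
      coeffVec N (C (N * p 1) * f - linForm p * derivative f) := by
  ext m
  have h : (linForm p * derivative f).coeff m = p 0 * ((m + 1) * f.coeff (m + 1)) +
      p 1 * (m * f.coeff m) := by
    rw [linForm, add_mul, coeff_add, coeff_C_mul, mul_assoc, coeff_C_mul, coeff_derivative]
    congr 2
    · ring
    · rcases hm : (m : ℕ) with _ | l
      · simp
      · rw [coeff_X_mul, coeff_derivative]
        push_cast
        ring
  simp only [polar, coeffVec, LinearMap.coe_mk, AddHom.coe_mk, LinearMap.pi_apply, lcoeff_apply,
    coeff_sub, coeff_C_mul, h, Fin.val_castSucc, Fin.val_succ]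
  ring

-- The derivation kills `linForm p` and sends `linForm q` to `bracket q p`, so it only lowers the
-- exponent of `linForm q`.
open Polynomial in
theorem polar_coeffVec_mul {N a b : ℕ} (hab : a + b + 1 = N) (p q : Fin 2 → ℂ) :
    polar N p (coeffVec (N + 1) (linForm q ^ (b + 1) * linForm p ^ a)) =
      ((b + 1) * bracket q p) • coeffVec N (linForm q ^ b * linForm p ^ a) := by
  rw [polar_coeffVec, ← map_smul]
  congr 1
  have hd : ∀ r : Fin 2 → ℂ, derivative (linForm r) = C (r 1) := fun r => by simp [linForm]
  have hN : (C ((N : ℂ) * p 1) : ℂ[X]) = ((a : ℂ[X]) + b + 1) * C (p 1) := by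
    rw [← hab]; simp
  have hp : C (p 1) * linForm q - C (q 1) * linForm p = C (bracket q p) := by
    simp only [linForm, bracket, C_sub, C_mul]
    ring
  rw [hN, derivative_mul, derivative_pow, derivative_pow, hd, hd, smul_eq_C_mul, C_mul, ← hp]
  rcases a with _ | a
  · simp only [Nat.cast_zero, map_zero, map_add, map_natCast, map_one, Nat.cast_add,
      Nat.cast_one, Nat.add_sub_cancel]
    ring
  · simp only [map_add, map_natCast, map_one, Nat.cast_add,
      Nat.cast_one, Nat.add_sub_cancel]
    ring

open Polynomial in
theorem polar_coeffVec_pow (N : ℕ) (p : Fin 2 → ℂ) :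
    polar N p (coeffVec (N + 1) (linForm p ^ N)) = 0 := by
  rw [polar_coeffVec]
  have hd : derivative (linForm p) = C (p 1) := by simp [linForm]
  rw [derivative_pow, hd]
  rcases N with _ | N
  · ext m; exact m.elim0
  · simp only [Nat.add_sub_cancel, C_mul, map_natCast]
    rw [show (((N + 1 : ℕ) : ℂ[X]) * C (p 1) * linForm p ^ (N + 1) -
      linForm p * (((N + 1 : ℕ) : ℂ[X]) * linForm p ^ N * C (p 1))) = 0 by ring, map_zero]

theorem span_range_smul_eq {ι V : Type*} [AddCommGroup V] [Module ℂ V] {x : ι → V} {c : ι → ℂ}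
    (hc : ∀ i, c i ≠ 0) :
    Submodule.span ℂ (range fun i => c i • x i) = Submodule.span ℂ (range x) := by
  apply le_antisymm <;> rw [Submodule.span_le] <;> rintro _ ⟨i, rfl⟩
  · exact Submodule.smul_mem _ _ (Submodule.subset_span ⟨i, rfl⟩)
  · exact (Submodule.smul_mem_iff _ (hc i)).1 (Submodule.subset_span ⟨i, rfl⟩)

theorem map_polar_veroneseSpace {N j : ℕ} (hj : j ≤ N) {p q : Fin 2 → ℂ} (h : bracket q p ≠ 0) :
    (veroneseSpace (N + 1) q j).map (polar N p) = veroneseSpace N q j := by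
  have h' : bracket p q ≠ 0 := by rwa [bracket_swap, neg_ne_zero]
  rw [veroneseSpace_eq_span (by omega) h', veroneseSpace_eq_span hj h', Submodule.map_span,
    ← range_comp]
  refine Eq.trans ?_ (span_range_smul_eq
    (c := fun a : Fin j => (((N - 1 - a : ℕ) : ℂ) + 1) * bracket q p)
    fun a => mul_ne_zero (Nat.cast_add_one_ne_zero _) h)
  congr 2
  funext a
  have : N + 1 - 1 - (a : ℕ) = N - 1 - a + 1 := by omega
  rw [Function.comp_apply, this, polar_coeffVec_mul (by omega)]

/-- In the flag of `p` itself one monomial, the pure power of `linForm p`, is killed and the others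
shift by one; so exactly one dimension is lost. -/
theorem map_polar_veroneseSpace_self {N j : ℕ} (hj : j ≤ N) {p q : Fin 2 → ℂ}
    (h : bracket q p ≠ 0) :
    (veroneseSpace (N + 1) p (j + 1)).map (polar N p) = veroneseSpace N p j := by
  rw [veroneseSpace_eq_span (by omega) h, veroneseSpace_eq_span hj h, Submodule.map_span,
    ← range_comp]
  rw [← span_range_smul_eq (c := fun a : Fin j => ((a : ℂ) + 1) * bracket q p)
    fun a => mul_ne_zero (Nat.cast_add_one_ne_zero _) h]
  have key : ∀ a : Fin j, polar N p (coeffVec (N + 1)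
      (linForm p ^ (N + 1 - 1 - ((a : ℕ) + 1)) * linForm q ^ ((a : ℕ) + 1))) =
      (((a : ℂ) + 1) * bracket q p) • coeffVec N (linForm p ^ (N - 1 - a) * linForm q ^ (a : ℕ)) := by
    intro a
    rw [mul_comm (linForm p ^ _), mul_comm (linForm p ^ _),
      show N + 1 - 1 - ((a : ℕ) + 1) = N - 1 - a by omega, polar_coeffVec_mul (by omega)]
  apply le_antisymm <;> rw [Submodule.span_le]
  · rintro _ ⟨a, rfl⟩
    rcases Fin.eq_zero_or_eq_succ a with rfl | ⟨b, rfl⟩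
    · simp [polar_coeffVec_pow]
    · rw [Function.comp_apply, Fin.val_succ, key b]
      exact Submodule.subset_span ⟨b, rfl⟩
  · rintro _ ⟨a, rfl⟩
    refine Submodule.subset_span ⟨a.succ, ?_⟩
    rw [Function.comp_apply, Fin.val_succ, key a]

theorem range_polar {N : ℕ} {p q : Fin 2 → ℂ} (h : bracket q p ≠ 0) :
    LinearMap.range (polar N p) = ⊤ := by
  rw [eq_top_iff, ← veroneseSpace_top N q, ← map_polar_veroneseSpace le_rfl h]
  exact LinearMap.map_le_range

theorem ker_polar {N : ℕ} {p q : Fin 2 → ℂ} (h : bracket q p ≠ 0) :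
    LinearMap.ker (polar N p) = veroneseSpace (N + 1) p 1 := by
  have hz : ∀ r : Fin 2 → ℂ, veroneseSpace N r 0 = ⊥ := fun r => by simp [veroneseSpace]
  refine (Submodule.eq_of_le_of_finrank_eq ?_ ?_).symm
  · rw [LinearMap.le_ker_iff_map, map_polar_veroneseSpace_self (Nat.zero_le N) h, hz]
  · have h1 := LinearMap.finrank_range_add_finrank_ker (polar N p)
    rw [range_polar h, finrank_top, Module.finrank_fin_fun, Module.finrank_fin_fun] at h1
    rw [finrank_veroneseSpace (ne_zero_of_bracket h).2 (by omega)]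
    omega

/-- For `q ≠ p` the space has the same dimension as its image, so the restriction of the derivation
is injective. -/
theorem disjoint_ker_polar {N j : ℕ} (hj : j ≤ N) {p q : Fin 2 → ℂ} (h : bracket q p ≠ 0)
    {x : Fin (N + 1) → ℂ} (hx : x ∈ veroneseSpace (N + 1) q j) (hx0 : polar N p x = 0) :
    x = 0 := by
  have h1 := LinearMap.finrank_range_add_finrank_ker
    ((polar N p).domRestrict (veroneseSpace (N + 1) q j))
  rw [LinearMap.range_domRestrict, map_polar_veroneseSpace hj h,
    finrank_veroneseSpace (ne_zero_of_bracket h).1 hj,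
    finrank_veroneseSpace (ne_zero_of_bracket h).1 (by omega)] at h1
  have h2 : LinearMap.ker ((polar N p).domRestrict (veroneseSpace (N + 1) q j)) = ⊥ :=
    Submodule.finrank_eq_zero.1 (by omega)
  have h3 : (⟨x, hx⟩ : veroneseSpace (N + 1) q j) ∈
      LinearMap.ker ((polar N p).domRestrict (veroneseSpace (N + 1) q j)) := hx0
  rw [h2, Submodule.mem_bot] at h3
  exact congrArg Subtype.val h3

/-- Four points in general position are recovered from their Veronese flags by a projection. -/
theorem exists_veronese_projection {y : Fin 4 → Fin 2 → ℂ}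
    (hy : ∀ i j, i ≠ j → bracket (y i) (y j) ≠ 0) (n : ℕ) (J : Fin 4 → ℕ)
    (hJ : ∑ i, J i = n) :
    ∃ Φ : (Fin (n + 2) → ℂ) →ₗ[ℂ] (Fin 2 → ℂ),
      LinearMap.ker Φ = ⨆ i, veroneseSpace (n + 2) (y i) (J i) ∧
      ∀ i, ∀ x ∈ veroneseSpace (n + 2) (y i) (J i + 1), (∃ c : ℂ, Φ x = c • y i) ∧
        (Φ x = 0 → x ∈ veroneseSpace (n + 2) (y i) (J i)) := by
  induction n generalizing J with
  | zero =>
    have hJ0 : ∀ i, J i = 0 := by simpa using hJ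
    have hbot : ∀ i, veroneseSpace (0 + 2) (y i) (J i) = ⊥ := fun i => by
      rw [hJ0]; simp [veroneseSpace]
    refine ⟨LinearMap.id, by simp [hbot], fun i x hx => ⟨?_, ?_⟩⟩
    · have h1 : {k : ℕ | k < 0 + 1} = {0} := by ext; simp
      rw [hJ0, veroneseSpace, h1, image_singleton, Submodule.mem_span_singleton] at hx
      obtain ⟨c, rfl⟩ := hx
      refine ⟨c, ?_⟩
      rw [LinearMap.id_apply]
      congr 1
      ext m
      fin_cases m <;> simp [veroneseVector]
    · intro h0
      rw [LinearMap.id_apply] at h0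
      rw [h0]
      exact Submodule.zero_mem _
  | succ n ih =>
    -- Differentiate along a point with positive multiplicity. This lowers the degree and that
    -- multiplicity by one and leaves the others alone.
    obtain ⟨i, hi⟩ : ∃ i, J i ≠ 0 := by
      by_contra! h0
      simp [h0] at hJ
    obtain ⟨k, hk⟩ := Nat.exists_eq_succ_of_ne_zero hi
    have hle : ∀ l, l ≠ i → J l + J i ≤ n + 1 := by
      intro l hl
      rw [← hJ, ← Finset.sum_pair hl]
      exact Finset.sum_le_sum_of_subset (Finset.subset_univ _)
    set J' : Fin 4 → ℕ := Function.update J i k with hJ'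
    have hJi : J' i = k := by simp [hJ']
    have hJl : ∀ l, l ≠ i → J' l = J l := fun l hl => by simp [hJ', hl]
    have hsum : ∑ l, J' l = n := by
      have h1 := Finset.add_sum_erase Finset.univ J (Finset.mem_univ i)
      have h2 := Finset.add_sum_erase Finset.univ J' (Finset.mem_univ i)
      have h3 : ∑ l ∈ Finset.univ.erase i, J' l = ∑ l ∈ Finset.univ.erase i, J l :=
        Finset.sum_congr rfl fun l hl => hJl l (Finset.ne_of_mem_erase hl)
      omega
    obtain ⟨Φ, hker, hΦ⟩ := ih J' hsum
    obtain ⟨r, hr⟩ := exists_ne i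
    have hri := hy r i hr
    set D := polar (n + 2) (y i) with hD
    have hik : k ≤ n := by
      have := hle r hr
      omega
    have hmap : ∀ l, (veroneseSpace (n + 2 + 1) (y l) (J l)).map D =
        veroneseSpace (n + 2) (y l) (J' l) := by
      intro l
      by_cases hl : l = i
      · subst hl
        rw [hk, hJi]
        exact map_polar_veroneseSpace_self (by omega) hri
      · rw [hJl l hl]
        have := hle l hl
        exact map_polar_veroneseSpace (by omega) (hy l i hl)
    have hmap' : ∀ l, (veroneseSpace (n + 2 + 1) (y l) (J l + 1)).map D =
        veroneseSpace (n + 2) (y l) (J' l + 1) := by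
      intro l
      by_cases hl : l = i
      · subst hl
        rw [hk, hJi]
        exact map_polar_veroneseSpace_self (by omega) hri
      · rw [hJl l hl]
        have := hle l hl
        exact map_polar_veroneseSpace (by omega) (hy l i hl)
    -- The kernel is the line of the `i`-th flag and lies in its `J i`-th space because `J i` is
    -- positive; so the kernel of the composite is again exactly the sum.
    have hkerD : LinearMap.ker D ≤ veroneseSpace (n + 2 + 1) (y i) (J i) := by
      rw [hD, ker_polar hri, hk]
      have hmono : ∀ a, a < n + 2 → veroneseSpace (n + 2 + 1) (y i) 1 ≤
          veroneseSpace (n + 2 + 1) (y i) (a + 1) := by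
        intro a
        induction a with
        | zero => intro _; exact le_rfl
        | succ a ih =>
          intro ha
          exact (ih (by omega)).trans (veroneseSpace_le_succ _ (by omega))
      exact hmono k (by omega)
    refine ⟨Φ.comp D, ?_, fun l x hx => ⟨?_, fun h0 => ?_⟩⟩
    · rw [LinearMap.ker_comp, hker]
      have hU : (⨆ l, veroneseSpace (n + 2) (y l) (J' l)) =
          (⨆ l, veroneseSpace (n + 2 + 1) (y l) (J l)).map D := by
        rw [Submodule.map_iSup]
        exact iSup_congr fun l => (hmap l).symm
      rw [hU, Submodule.comap_map_eq, sup_eq_left]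
      exact hkerD.trans (le_iSup (fun l => veroneseSpace (n + 2 + 1) (y l) (J l)) i)
    · have hDx : D x ∈ veroneseSpace (n + 2) (y l) (J' l + 1) := by
        rw [← hmap' l]
        exact Submodule.mem_map_of_mem hx
      exact (hΦ l _ hDx).1
    · have hDx : D x ∈ veroneseSpace (n + 2) (y l) (J' l + 1) := by
        rw [← hmap' l]
        exact Submodule.mem_map_of_mem hx
      have h1 := (hΦ l _ hDx).2 h0
      rw [← hmap l] at h1
      obtain ⟨u, hu, hux⟩ := h1
      have hxu : D (x - u) = 0 := by rw [map_sub, hux, sub_self]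
      by_cases hl : l = i
      · subst hl
        have h2 := hkerD (LinearMap.mem_ker.2 hxu)
        have := Submodule.add_mem _ h2 hu
        simpa using this
      · have hJl' := hle l hl
        have h2 : x - u ∈ veroneseSpace (n + 2 + 1) (y l) (J l + 1) :=
          Submodule.sub_mem _ hx (veroneseSpace_le_succ _ (by omega) hu)
        have h3 := disjoint_ker_polar (by omega) (hy l i hl) h2 hxu
        rw [sub_eq_zero] at h3
        rwa [h3]

theorem veronese_sp (n : ℕ) (ξ : ℙ ℂ (Fin 2 → ℂ)) {j : ℕ} (hj : j ≤ n) :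
    (veronese n ξ).sp j = veroneseSpace n ξ.rep j := by
  have := (veronese n ξ).space_eq_sp ⟨j, by omega⟩
  rw [← this]
  rfl

/-- The projection identifies the quotient with `ℂ²` and sends each vector to a nonzero multiple of
the corresponding vertex, and volumes do not see such factors. -/
theorem spVol_veronese {n : ℕ} {ξ : Fin 4 → ℙ ℂ (Fin 2 → ℂ)} (hξ : volH3 ξ ≠ 0)
    {A : Fin 4 → AffineFlag n} (hA : ∀ i, (A i).toCFlag = veronese n (ξ i)) {J : Fin 4 → ℕ}
    (hJ : ∑ i, J i + 2 = n) : spVol A J = volH3 ξ := by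
  obtain ⟨m, rfl⟩ : ∃ m, n = m + 2 := ⟨_, hJ.symm⟩
  have hy : ∀ i j, i ≠ j → bracket (ξ i).rep (ξ j).rep ≠ 0 := fun i j hij =>
    bracket_ne_zero_of_idealVolume hξ hij
  obtain ⟨Φ, hker, hΦ⟩ := exists_veronese_projection hy m J (by omega)
  have hlt : ∀ i, J i ≤ m := by
    intro i
    have : J i ≤ ∑ i, J i := Finset.single_le_sum (fun _ _ => Nat.zero_le _) (Finset.mem_univ i)
    omega
  have hsp : ∀ i j, j ≤ m + 2 → (A i).sp j = veroneseSpace (m + 2) (ξ i).rep j := by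
    intro i j hj
    rw [hA i, veronese_sp _ _ hj]
  have hU : spSum A J = LinearMap.ker Φ := by
    rw [hker, spSum]
    exact iSup_congr fun i => hsp i (J i) (by have := hlt i; omega)
  have hmem : ∀ i, (A i).vec (J i) ∈ veroneseSpace (m + 2) (ξ i).rep (J i + 1) := by
    intro i
    rw [← hsp i _ (by have := hlt i; omega)]
    exact (A i).vec_mem (Nat.lt_succ_self _)
  choose c hc using fun i => (hΦ i _ (hmem i)).1
  have hc0 : ∀ i, c i ≠ 0 := by
    intro i h0
    have h1 := hc i
    rw [h0, zero_smul] at h1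
    have h2 := (hΦ i _ (hmem i)).2 h1
    rw [← hsp i _ (by have := hlt i; omega)] at h2
    exact (A i).vec_notMem (by have := hlt i; omega) h2
  rw [volH3, ← idealVolume_smul hc0]
  refine Vol_of_eq fun d => ?_
  have h1 : ∑ i, d i • (spSum A J).mkQ ((A i).vec (J i)) =
      (spSum A J).mkQ (∑ i, d i • (A i).vec (J i)) := by simp [map_sum]
  rw [h1, Submodule.mkQ_apply, Submodule.Quotient.mk_eq_zero, hU, LinearMap.mem_ker, map_sum]
  simp only [map_smul, hc]

/-- All compositions of `n - 2` contribute as indices, and their number already exhausts the bound;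
hence nothing else contributes and there is no cancellation. -/
theorem abs_borelAffine_veronese {n : ℕ} (hn : 2 ≤ n) {ξ : Fin 4 → ℙ ℂ (Fin 2 → ℂ)}
    (hξ : |volH3 ξ| = v3) {A : Fin 4 → AffineFlag n}
    (hA : ∀ i, (A i).toCFlag = veronese n (ξ i)) :
    |borelAffine n A| = n * ((n : ℝ) ^ 2 - 1) / 6 * v3 := by
  have hne : volH3 ξ ≠ 0 := by
    intro h0
    rw [h0, abs_zero] at hξ
    exact v3_pos.ne hξ
  have hval : ∀ J ∈ Finset.piAntidiag (Finset.univ : Finset (Fin 4)) (n - 2),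
      spVol A J = volH3 ξ := by
    intro J hJ
    have := (Finset.mem_piAntidiag.1 hJ).1
    exact spVol_veronese hne hA (by rw [this]; omega)
  have hsub : Finset.piAntidiag (Finset.univ : Finset (Fin 4)) (n - 2) ⊆ contributing A := by
    intro J hJ
    rw [mem_contributing, hval J hJ]
    exact hne
  rw [borelAffine_eq_sum_contributing, ← Finset.eq_of_subset_of_card_le hsub
    (card_contributing_le A), Finset.sum_congr rfl hval, Finset.sum_const, nsmul_eq_mul, abs_mul,
    hξ, Nat.abs_cast, card_piAntidiag_four hn]

end Veronese

/-! ## The case of equality -/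

theorem exists_volH3_eq {s : ℝ} (hs : |s| = v3) : ∃ ξ : Fin 4 → ℙ ℂ (Fin 2 → ℂ), volH3 ξ = s := by
  rcases (abs_eq v3_pos.le).1 hs with rfl | rfl
  · exact ⟨_, (volH3_mk (normalForm_ne_zero omega)).trans v3_eq.symm⟩
  · refine ⟨_, (volH3_mk fun i => normalForm_ne_zero omega (Equiv.swap 2 3 i)).trans ?_⟩
    rw [idealVolume_perm, Equiv.Perm.sign_swap (by decide), ← v3_eq]
    simp

theorem abs_borelCocycle_le {n : ℕ} (hn : 2 ≤ n) (F : Fin 4 → CFlag n) :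
    |borelCocycle n F| ≤ n * ((n : ℝ) ^ 2 - 1) / 6 * v3 := by
  obtain ⟨A, rfl⟩ := exists_lift F
  rw [← borelAffine_eq]
  exact abs_borelAffine_le hn A

theorem abs_borelCocycle_eq_iff {n : ℕ} (hn : 2 ≤ n) (F : Fin 4 → CFlag n) :
    |borelCocycle n F| = n * ((n : ℝ) ^ 2 - 1) / 6 * v3 ↔
      ∃ (g : GL (Fin n) ℂ) (ξ : Fin 4 → ℙ ℂ (Fin 2 → ℂ)),
        IsRegularIdealSimplex ξ ∧ ∀ i, F i = g • veronese n (ξ i) := by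
  constructor
  · intro h
    obtain ⟨A, rfl⟩ := exists_lift F
    rw [← borelAffine_eq] at h
    obtain ⟨s, hs, hA⟩ := exists_spVol_eq hn h
    -- The sign of `s` selects the orientation of the regular simplex, so that its Veronese
    -- quadruple has the same values at all the indices used by rigidity.
    obtain ⟨ξ, hξ⟩ := exists_volH3_eq hs
    obtain ⟨A', hA'⟩ := exists_lift fun i => veronese n (ξ i)
    have hne : volH3 ξ ≠ 0 := by
      intro h0
      rw [← hξ, h0, abs_zero] at hs
      exact v3_pos.ne hs
    obtain ⟨g, hg⟩ := exists_smul_eq_of_spVol_eq hn hs hA fun p q m hpq => by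
      constructor <;> rw [← hξ] <;> refine spVol_veronese hne (fun i => congrFun hA' i) ?_ <;>
        simp [Fin.sum_univ_four] <;> omega
    refine ⟨g, ξ, isRegularIdealSimplex_iff.2 (by rw [hξ, hs]), fun i => ?_⟩
    exact (hg i).trans (congrArg (g • ·) (congrFun hA' i))
  · rintro ⟨g, ξ, hξ, hF⟩
    obtain rfl : F = fun i => g • veronese n (ξ i) := funext hF
    obtain ⟨A, hA⟩ := exists_lift fun i => veronese n (ξ i)
    rw [borelCocycle_smul g fun i => veronese n (ξ i), ← hA, ← borelAffine_eq]
    exact abs_borelAffine_veronese hn (isRegularIdealSimplex_iff.1 hξ) fun i => congrFun hA i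

/-! ## Measurability -/

section MeasurableVol

/-- By `idealVolume_eq` the volume is a continuous determinant times the measure of a section of a
jointly measurable set. -/
theorem measurable_idealVolume : Measurable idealVolume := by
  have hset : MeasurableSet {p : (Fin 4 → Fin 2 → ℂ) × (Fin 4 → ℝ) | p.2 ∈ coneRegion p.1} := by
    have hc : Continuous fun p : (Fin 4 → Fin 2 → ℂ) × (Fin 4 → ℝ) => nullForm p.1 p.2 := by
      unfold nullForm bracket
      simp only [Complex.normSq_apply]
      fun_prop
    refine MeasurableSet.inter ?_ (MeasurableSet.inter ?_ ?_)
    · exact (isClosed_le continuous_const continuous_snd).measurableSet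
    · exact (isOpen_lt continuous_const hc).measurableSet
    · exact (isOpen_lt hc continuous_const).measurableSet
  have h1 : Measurable fun y : Fin 4 → Fin 2 → ℂ => volume (coneRegion y) :=
    measurable_measure_prodMk_left hset
  have h2 : Continuous fun y : Fin 4 → Fin 2 → ℂ =>
      (Matrix.of fun i => nullVector (y i)).det := by
    refine Continuous.matrix_det (continuous_pi fun i => continuous_pi fun j => ?_)
    simp only [Matrix.of_apply]
    fin_cases j <;> simp [nullVector, Complex.normSq_apply] <;> fun_prop
  have h3 : idealVolume = fun y => (Matrix.of fun i => nullVector (y i)).det *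
      (4 * (volume (coneRegion y)).toReal) := funext idealVolume_eq
  rw [h3]
  exact h2.measurable.mul (h1.ennreal_toReal.const_mul 4)

/-! ### Coordinates by Gram determinants -/

variable {n : ℕ}

/-- The Gram determinant of two vectors. -/
def gramDet (u v : Fin n → ℂ) : ℂ :=
  star u ⬝ᵥ u * star v ⬝ᵥ v - star u ⬝ᵥ v * star v ⬝ᵥ u

/-- The numerator of the first coordinate of `w` with respect to `u` and `v`. -/
def gramFst (u v w : Fin n → ℂ) : ℂ :=
  star u ⬝ᵥ w * star v ⬝ᵥ v - star u ⬝ᵥ v * star v ⬝ᵥ w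

/-- The numerator of the second coordinate of `w` with respect to `u` and `v`. -/
def gramSnd (u v w : Fin n → ℂ) : ℂ :=
  star u ⬝ᵥ u * star v ⬝ᵥ w - star v ⬝ᵥ u * star u ⬝ᵥ w

theorem gramFst_eq (u v : Fin n → ℂ) (α β : ℂ) :
    gramFst u v (α • u + β • v) = α * gramDet u v := by
  simp only [gramFst, gramDet, dotProduct_add, dotProduct_smul, smul_eq_mul]
  ring

theorem gramSnd_eq (u v : Fin n → ℂ) (α β : ℂ) :
    gramSnd u v (α • u + β • v) = β * gramDet u v := by
  simp only [gramSnd, gramDet, dotProduct_add, dotProduct_smul, smul_eq_mul]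
  ring

open scoped ComplexOrder in
theorem star_dotProduct_self_eq_zero {u : Fin n → ℂ} : star u ⬝ᵥ u = 0 ↔ u = 0 :=
  dotProduct_star_self_eq_zero

/-- If the determinant vanishes, the combination `t` is orthogonal to `u` and `v`, hence to itself,
hence zero. -/
theorem gramDet_ne_zero {u v : Fin n → ℂ}
    (h : ∀ α β : ℂ, α • u + β • v = 0 → α = 0 ∧ β = 0) : gramDet u v ≠ 0 := by
  intro h0
  set t := (star u ⬝ᵥ v) • u + (-(star u ⬝ᵥ u)) • v with ht
  have h1 : star u ⬝ᵥ t = 0 := by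
    rw [ht]
    simp only [dotProduct_add, dotProduct_smul, smul_eq_mul]
    ring
  have h2 : star v ⬝ᵥ t = 0 := by
    rw [ht]
    simp only [dotProduct_add, dotProduct_smul, smul_eq_mul]
    rw [gramDet] at h0
    linear_combination -h0
  have h3 : star t ⬝ᵥ t = 0 := by
    nth_rewrite 1 [ht]
    rw [star_add, star_smul, star_smul, add_dotProduct, smul_dotProduct, smul_dotProduct, h1, h2]
    simp
  have h4 := (h _ _ (star_dotProduct_self_eq_zero.1 h3)).2
  rw [neg_eq_zero, star_dotProduct_self_eq_zero] at h4
  exact one_ne_zero (h 1 0 (by rw [h4]; simp)).1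

-- Nonzero volume forces the first two vectors to be independent and to span the others. The
-- quotients of Gram expressions are then coordinates in that basis, and all conditions are
-- equalities or inequalities of continuous functions.
open Classical in
theorem Vol_of_eq_ite (z : Fin 4 → Fin n → ℂ) :
    Vol (Config.of z) = if gramDet (z 0) (z 1) ≠ 0 ∧ ∀ i, gramDet (z 0) (z 1) • z i =
        gramFst (z 0) (z 1) (z i) • z 0 + gramSnd (z 0) (z 1) (z i) • z 1 then
      idealVolume fun i => ![gramFst (z 0) (z 1) (z i) / gramDet (z 0) (z 1),
        gramSnd (z 0) (z 1) (z i) / gramDet (z 0) (z 1)] else 0 := by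
  split_ifs with h
  · obtain ⟨hG, hz⟩ := h
    refine Vol_of_eq fun c => ?_
    set y : Fin 4 → Fin 2 → ℂ := fun i => ![gramFst (z 0) (z 1) (z i) / gramDet (z 0) (z 1),
        gramSnd (z 0) (z 1) (z i) / gramDet (z 0) (z 1)] with hy
    have hzy : ∀ i, z i = y i 0 • z 0 + y i 1 • z 1 := by
      intro i
      rw [← smul_right_inj hG, hz i, smul_add, smul_smul, smul_smul]
      simp only [hy, Matrix.cons_val_zero, Matrix.cons_val_one]
      rw [mul_div_cancel₀ _ hG, mul_div_cancel₀ _ hG]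
    have hsum : ∑ i, c i • z i = (∑ i, c i • y i) 0 • z 0 + (∑ i, c i • y i) 1 • z 1 := by
      simp only [Finset.sum_apply, Pi.smul_apply, smul_eq_mul, Finset.sum_smul,
        ← Finset.sum_add_distrib]
      refine Finset.sum_congr rfl fun i _ => ?_
      nth_rewrite 1 [hzy i]
      rw [smul_add, smul_smul, smul_smul]
    rw [hsum]
    constructor
    · intro h0
      have h1 := gramFst_eq (z 0) (z 1) ((∑ i, c i • y i) 0) ((∑ i, c i • y i) 1)
      have h2 := gramSnd_eq (z 0) (z 1) ((∑ i, c i • y i) 0) ((∑ i, c i • y i) 1)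
      rw [h0] at h1 h2
      ext k
      fin_cases k
      · exact (mul_eq_zero.1 (h1.symm.trans (by simp [gramFst]))).resolve_right hG
      · exact (mul_eq_zero.1 (h2.symm.trans (by simp [gramSnd]))).resolve_right hG
    · intro h0
      rw [h0]
      simp
  · by_contra h0
    refine h ⟨gramDet_ne_zero fun α β => eq_zero_of_Vol_ne_zero h0 (by decide), fun i => ?_⟩
    obtain ⟨α, β, hi⟩ := exists_eq_of_Vol_ne_zero h0 (show (0 : Fin 4) ≠ 1 by decide) i
    rw [hi, gramFst_eq, gramSnd_eq, smul_add, smul_smul, smul_smul, mul_comm α, mul_comm β]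

theorem measurable_Vol_of : Measurable fun z : Fin 4 → Fin n → ℂ => Vol (Config.of z) := by
  classical
  have hc : ∀ i j, Continuous fun z : Fin 4 → Fin n → ℂ => star (z i) ⬝ᵥ z j := fun i j =>
    (continuous_apply i).star.dotProduct (continuous_apply j)
  have hG : Continuous fun z : Fin 4 → Fin n → ℂ => gramDet (z 0) (z 1) :=
    ((hc 0 0).mul (hc 1 1)).sub ((hc 0 1).mul (hc 1 0))
  have h1 : ∀ i, Continuous fun z : Fin 4 → Fin n → ℂ => gramFst (z 0) (z 1) (z i) := fun i =>
    ((hc 0 i).mul (hc 1 1)).sub ((hc 0 1).mul (hc 1 i))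
  have h2 : ∀ i, Continuous fun z : Fin 4 → Fin n → ℂ => gramSnd (z 0) (z 1) (z i) := fun i =>
    ((hc 0 0).mul (hc 1 i)).sub ((hc 1 0).mul (hc 0 i))
  simp only [Vol_of_eq_ite]
  refine Measurable.ite ?_ (measurable_idealVolume.comp ?_) measurable_const
  · have hset : {z : Fin 4 → Fin n → ℂ | gramDet (z 0) (z 1) ≠ 0 ∧ ∀ i,
        gramDet (z 0) (z 1) • z i = gramFst (z 0) (z 1) (z i) • z 0 +
          gramSnd (z 0) (z 1) (z i) • z 1} =
        {z | gramDet (z 0) (z 1) ≠ 0} ∩ ⋂ i, {z | gramDet (z 0) (z 1) • z i =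
          gramFst (z 0) (z 1) (z i) • z 0 + gramSnd (z 0) (z 1) (z i) • z 1} := by
      ext z
      simp
    rw [hset]
    refine MeasurableSet.inter (isOpen_ne_fun hG continuous_const).measurableSet ?_
    exact MeasurableSet.iInter fun i => (isClosed_eq (hG.smul (continuous_apply i))
      (((h1 i).smul (continuous_apply 0)).add ((h2 i).smul (continuous_apply 1)))).measurableSet
  · refine measurable_pi_iff.2 fun i => measurable_pi_iff.2 fun k => ?_
    fin_cases k
    · exact (h1 i).measurable.div hG.measurable
    · exact (h2 i).measurable.div hG.measurable

/-! ### Measurable quotients by orthogonal projection -/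

/-- The orthogonal projection along `u`. -/
def orthProj (u : Fin n → ℂ) : (Fin n → ℂ) →ₗ[ℂ] (Fin n → ℂ) where
  toFun x := x - (star u ⬝ᵥ x / star u ⬝ᵥ u) • u
  map_add' x y := by
    rw [dotProduct_add, add_div, add_smul]
    abel
  map_smul' c x := by
    rw [dotProduct_smul, smul_eq_mul, mul_div_assoc, RingHom.id_apply, smul_sub, smul_smul]

theorem orthProj_apply (u x : Fin n → ℂ) :
    orthProj u x = x - (star u ⬝ᵥ x / star u ⬝ᵥ u) • u := rfl

theorem orthProj_self (u : Fin n → ℂ) : orthProj u u = 0 := by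
  rw [orthProj_apply]
  by_cases h : star u ⬝ᵥ u = 0
  · rw [star_dotProduct_self_eq_zero] at h
    simp [h]
  · rw [div_self h, one_smul, sub_self]

theorem measurable_orthProj {Ω : Type*} [MeasurableSpace Ω] {f g : Ω → Fin n → ℂ}
    (hf : Measurable f) (hg : Measurable g) : Measurable fun ω => orthProj (f ω) (g ω) := by
  have hdot : Measurable fun p : (Fin n → ℂ) × (Fin n → ℂ) => star p.1 ⬝ᵥ p.2 :=
    (continuous_fst.star.dotProduct continuous_snd).measurable
  have h1 : Measurable fun ω => star (f ω) ⬝ᵥ g ω := hdot.comp (hf.prodMk hg)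
  have h2 : Measurable fun ω => star (f ω) ⬝ᵥ f ω := hdot.comp (hf.prodMk hf)
  exact hg.sub ((h1.div h2).smul hf)

theorem mem_span_range_iff_orthProj {K : ℕ} (u : Fin (K + 1) → Fin n → ℂ) (y : Fin n → ℂ) :
    y ∈ Submodule.span ℂ (range u) ↔
      orthProj (u 0) y ∈ Submodule.span ℂ (range fun k : Fin K => orthProj (u 0) (u k.succ)) := by
  have hsub : ∀ x, orthProj (u 0) x ∈ Submodule.span ℂ (range u) ↔
      x ∈ Submodule.span ℂ (range u) := fun x => by
    rw [orthProj_apply]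
    exact Submodule.sub_mem_iff_left _
      (Submodule.smul_mem _ _ (Submodule.subset_span (mem_range_self 0)))
  constructor
  · intro h
    have h1 := Submodule.mem_map_of_mem (f := orthProj (u 0)) h
    rw [Submodule.map_span, ← range_comp] at h1
    refine (Submodule.span_le.2 ?_ : _ ≤ _) h1
    rintro _ ⟨k, rfl⟩
    rcases Fin.eq_zero_or_eq_succ k with rfl | ⟨l, rfl⟩
    · rw [Function.comp_apply, orthProj_self]
      exact Submodule.zero_mem _
    · exact Submodule.subset_span ⟨l, rfl⟩
  · intro h
    rw [← hsub]
    refine (Submodule.span_le.2 ?_ : _ ≤ _) h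
    rintro _ ⟨k, rfl⟩
    exact (hsub _).2 (Submodule.subset_span (mem_range_self _))

/-- A quotient by a varying span is removed one generator at a time: projecting everything
orthogonally to the first generator keeps the relations and stays measurable. A vanishing generator
is harmless, as division by zero makes the projection the identity. -/
theorem measurable_Vol_mkQ {Ω : Type*} [MeasurableSpace Ω] {K : ℕ} {u : Fin K → Ω → Fin n → ℂ}
    {x : Fin 4 → Ω → Fin n → ℂ} (hu : ∀ k, Measurable (u k)) (hx : ∀ i, Measurable (x i)) :
    Measurable fun ω =>
      Vol (Config.of fun i => (Submodule.span ℂ (range fun k => u k ω)).mkQ (x i ω)) := by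
  induction K generalizing x with
  | zero =>
    have h : ∀ ω, Vol (Config.of fun i =>
        (Submodule.span ℂ (range fun k : Fin 0 => u k ω)).mkQ (x i ω)) =
        Vol (Config.of fun i => x i ω) := by
      intro ω
      congr 1
      refine Config.of_eq_of _ _ fun c => ?_
      have h1 : ∑ i, c i • (Submodule.span ℂ (range fun k : Fin 0 => u k ω)).mkQ (x i ω) =
        (Submodule.span ℂ (range fun k : Fin 0 => u k ω)).mkQ (∑ i, c i • x i ω) := by
          simp [map_sum]
      rw [h1, Submodule.mkQ_apply, Submodule.Quotient.mk_eq_zero]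
      simp
    rw [funext h]
    exact measurable_Vol_of.comp (measurable_pi_iff.2 hx)
  | succ K ih =>
    have h : ∀ ω, Vol (Config.of fun i =>
        (Submodule.span ℂ (range fun k => u k ω)).mkQ (x i ω)) =
        Vol (Config.of fun i => (Submodule.span ℂ
          (range fun k : Fin K => orthProj (u 0 ω) (u k.succ ω))).mkQ
            (orthProj (u 0 ω) (x i ω))) := by
      intro ω
      congr 1
      refine Config.of_mkQ_eq_of_mkQ _ _ _ _ fun c => ?_
      rw [mem_span_range_iff_orthProj]
      simp [map_sum]
    rw [funext h]
    exact ih (u := fun k ω => orthProj (u 0 ω) (u k.succ ω))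
      (x := fun i ω => orthProj (u 0 ω) (x i ω))
      (fun k => measurable_orthProj (hu 0) (hu k.succ)) fun i => measurable_orthProj (hu 0) (hx i)

end MeasurableVol

/-! ### Topology of the flag manifold and descent of measurability -/

section FlagManifold

variable {n : ℕ}

theorem CFlag.ofGL_space (g : GL (Fin n) ℂ) (j : Fin (n + 1)) :
    (CFlag.ofGL g).space j = Submodule.span ℂ ((fun k => g.1.col k) '' {i | i.castSucc < j}) := by
  have h : ∀ k, (Pi.basisFun ℂ (Fin n)).map (glEquiv g) k = g.1.col k := fun k => by
    rw [Module.Basis.map_apply, Pi.basisFun_apply, glEquiv_apply, Matrix.mulVec_single_one]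
  show Submodule.span ℂ (_ '' _) = _
  congr 1
  exact image_congr fun k _ => h k

theorem AffineFlag.space_eq_span (A : AffineFlag n) (j : Fin (n + 1)) :
    A.space j = Submodule.span ℂ (A.v '' {i | i.castSucc < j}) := by
  induction j using Fin.induction with
  | zero => simp [CFlag.space_zero]
  | succ j ih =>
    rw [A.space_succ, ih, ← Submodule.span_union]
    congr 1
    ext y
    constructor
    · rintro (rfl | ⟨i, hi, rfl⟩)
      · exact ⟨j, Fin.castSucc_lt_succ, rfl⟩
      · exact ⟨i, lt_trans hi Fin.castSucc_lt_succ, rfl⟩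
    · rintro ⟨i, hi, rfl⟩
      have hi : i.castSucc < j.succ := hi
      rcases eq_or_lt_of_le (Fin.castSucc_lt_succ_iff.1 hi) with rfl | hi'
      · exact Or.inl rfl
      · exact Or.inr ⟨i, hi', rfl⟩

theorem CFlag.ofGL_surjective : Function.Surjective (CFlag.ofGL (n := n)) := by
  intro F
  obtain ⟨A, rfl⟩ := exists_affineFlag F
  have htop : ⊤ ≤ Submodule.span ℂ (range A.v) := by
    rw [← A.space_last, A.space_eq_span]
    exact Submodule.span_mono (image_subset_range _ _)
  let b := basisOfTopLeSpanOfCardEqFinrank A.v htop (by simp)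
  have hb : ⇑b = A.v := coe_basisOfTopLeSpanOfCardEqFinrank _ _ _
  obtain ⟨g, hg⟩ := exists_glEquiv_eq ((Pi.basisFun ℂ (Fin n)).equiv b (Equiv.refl _))
  refine ⟨g, CFlag.ext (funext fun j => ?_)⟩
  rw [CFlag.ofGL_space, A.space_eq_span]
  congr 1
  refine image_congr fun k _ => ?_
  have h1 := congrArg (fun e => e (Pi.basisFun ℂ (Fin n) k)) hg
  simp only [Module.Basis.equiv_apply, Equiv.refl_apply, hb] at h1
  rw [← h1, Pi.basisFun_apply, glEquiv_apply, Matrix.mulVec_single_one]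

theorem CFlag.ofGL_mul (g h : GL (Fin n) ℂ) : CFlag.ofGL (g * h) = g • CFlag.ofGL h := by
  refine CFlag.ext (funext fun j => ?_)
  rw [CFlag.smul_space, CFlag.ofGL_space, CFlag.ofGL_space, Submodule.map_span, image_image]
  rfl

/-- The saturation of an open set is the union of its right translates by the stabiliser of the
standard flag. -/
theorem CFlag.isOpenMap_ofGL : IsOpenMap (CFlag.ofGL (n := n)) := by
  intro O hO
  rw [isOpen_coinduced]
  have hset : CFlag.ofGL ⁻¹' (CFlag.ofGL '' O) =
      ⋃ b ∈ {b : GL (Fin n) ℂ | CFlag.ofGL b = CFlag.ofGL 1}, (fun x => x * b) ⁻¹' O := by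
    ext x
    simp only [mem_preimage, mem_image, mem_iUnion, exists_prop]
    constructor
    · rintro ⟨g, hg, he⟩
      refine ⟨x⁻¹ * g, ?_, by simpa using hg⟩
      show CFlag.ofGL (x⁻¹ * g) = CFlag.ofGL 1
      rw [CFlag.ofGL_mul, he, ← CFlag.ofGL_mul, inv_mul_cancel]
    · rintro ⟨b, hb, hx⟩
      have hb : CFlag.ofGL b = CFlag.ofGL 1 := hb
      exact ⟨x * b, hx, by rw [CFlag.ofGL_mul, hb, ← CFlag.ofGL_mul, mul_one]⟩
  rw [hset]
  exact isOpen_biUnion fun b _ => hO.preimage (continuous_mul_const b)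

theorem CFlag.continuous_ofGL : Continuous (CFlag.ofGL (n := n)) := continuous_coinduced_rng

theorem continuous_col (k : Fin n) : Continuous fun g : GL (Fin n) ℂ => g.1.col k :=
  continuous_pi fun i => (continuous_apply k).comp
    ((continuous_apply i).comp (Units.continuous_val (M := Matrix (Fin n) (Fin n) ℂ)))

instance : T1Space (CFlag n) where
  t1 F := by
    rw [isClosed_coinduced]
    -- A matrix lies over `F` as soon as each column lies in the corresponding space, by equality of
    -- dimensions; these conditions are closed.
    have hset : CFlag.ofGL ⁻¹' {F} = ⋂ k : Fin n, {g | g.1.col k ∈ F.space k.succ} := by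
      ext g
      simp only [mem_preimage, mem_singleton_iff, mem_iInter]
      constructor
      · rintro rfl k
        show g.1.col k ∈ (CFlag.ofGL g).space k.succ
        rw [CFlag.ofGL_space]
        exact Submodule.subset_span ⟨k, Fin.castSucc_lt_succ, rfl⟩
      · intro h
        refine CFlag.ext (funext fun j => Submodule.eq_of_le_of_finrank_eq ?_ ?_)
        · rw [CFlag.ofGL_space, Submodule.span_le]
          rintro _ ⟨k, hk, rfl⟩
          exact F.mono (show k.succ ≤ j from hk) (h k)
        · rw [CFlag.finrank_space, CFlag.finrank_space]
    rw [hset]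
    exact isClosed_iInter fun k =>
      (Submodule.closed_of_finiteDimensional (F.space k.succ)).preimage (continuous_col k)

instance : PolishSpace (GL (Fin n) ℂ) := by
  have : PolishSpace (Matrix (Fin n) (Fin n) ℂ) :=
    inferInstanceAs (PolishSpace (Fin n → Fin n → ℂ))
  have : PolishSpace (Matrix (Fin n) (Fin n) ℂ)ᵐᵒᵖ :=
    MulOpposite.opHomeomorph.symm.isClosedEmbedding.polishSpace
  exact (Units.isClosedEmbedding_embedProduct
    (α := Matrix (Fin n) (Fin n) ℂ)).polishSpace

instance : SecondCountableTopology (CFlag n) :=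
  Topology.IsQuotientMap.secondCountableTopology (X := GL (Fin n) ℂ) (π := CFlag.ofGL)
    ⟨⟨rfl⟩, CFlag.ofGL_surjective⟩ CFlag.isOpenMap_ofGL

theorem measurable_flagVol_ofGL [MeasurableSpace (GL (Fin n) ℂ)] [BorelSpace (GL (Fin n) ℂ)]
    (J : Fin 4 → Fin n) :
    Measurable fun g : Fin 4 → GL (Fin n) ℂ => flagVol (fun i => CFlag.ofGL (g i)) J := by
  -- The denominator is generated by a family of fixed length in which the columns not needed are
  -- replaced by zero.
  set u : Fin (4 * n) → (Fin 4 → GL (Fin n) ℂ) → Fin n → ℂ := fun k g =>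
    if (finProdFinEquiv.symm k).2 < J (finProdFinEquiv.symm k).1 then
      (g (finProdFinEquiv.symm k).1).1.col (finProdFinEquiv.symm k).2 else 0 with hu
  have hcol : ∀ i k, Measurable fun g : Fin 4 → GL (Fin n) ℂ => (g i).1.col k := fun i k =>
    (continuous_col k).measurable.comp (measurable_pi_apply i)
  have hmem : ∀ g : GL (Fin n) ℂ, ∀ j, g.1.col j ∈ (CFlag.ofGL g).space j.succ := fun g j => by
    rw [CFlag.ofGL_space]
    exact Submodule.subset_span ⟨j, Fin.castSucc_lt_succ, rfl⟩
  have hnot : ∀ g : GL (Fin n) ℂ, ∀ j, g.1.col j ∉ (CFlag.ofGL g).space j.castSucc := by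
    intro g j h
    refine ((CFlag.ofGL g).castSucc_lt_succ j).not_ge ?_
    rw [CFlag.ofGL_space g j.succ, Submodule.span_le]
    rintro _ ⟨k, hk, rfl⟩
    have hk : k.castSucc < j.succ := hk
    rcases eq_or_lt_of_le (Fin.castSucc_lt_succ_iff.1 hk) with rfl | hk'
    · exact h
    · exact (CFlag.ofGL g).mono (Fin.succ_le_castSucc_iff.2 hk') (hmem g k)
  have h : ∀ g : Fin 4 → GL (Fin n) ℂ, flagVol (fun i => CFlag.ofGL (g i)) J =
      Vol (Config.of fun i =>
        (Submodule.span ℂ (range fun k => u k g)).mkQ ((g i).1.col (J i))) := by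
    intro g
    rw [flagVol_eq _ J (fun i => hmem (g i) (J i)) fun i => hnot (g i) (J i)]
    congr 1
    refine Config.of_mkQ_congr ?_ rfl
    apply le_antisymm
    · refine iSup_le fun l => ?_
      rw [CFlag.ofGL_space, Submodule.span_le]
      rintro _ ⟨k, hk, rfl⟩
      refine Submodule.subset_span ⟨finProdFinEquiv (l, k), ?_⟩
      have hk : k < J l := hk
      simp only [hu, Equiv.symm_apply_apply, if_pos hk]
    · rw [Submodule.span_le]
      rintro _ ⟨k, rfl⟩
      simp only [hu]
      split_ifs with hk
      · refine le_iSup (fun l => (CFlag.ofGL (g l)).space (J l).castSucc)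
          (finProdFinEquiv.symm k).1 ?_
        exact (CFlag.ofGL _).mono (Fin.succ_le_castSucc_iff.2 hk) (hmem _ _)
      · exact Submodule.zero_mem _
  rw [funext h]
  refine measurable_Vol_mkQ (fun k => ?_) fun i => hcol i (J i)
  simp only [hu]
  split_ifs
  · exact hcol _ _
  · exact measurable_const

/-- Invertible matrices form a Polish space and flags a second countable T1 space. For a surjective
measurable map between such spaces, measurability of the composite implies measurability of the
function on the target. -/
theorem measurable_borelCocycle (n : ℕ) : Measurable (borelCocycle n) := by
  let _ : MeasurableSpace (GL (Fin n) ℂ) := borel _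
  have _ : BorelSpace (GL (Fin n) ℂ) := ⟨rfl⟩
  have hf : Measurable fun (g : Fin 4 → GL (Fin n) ℂ) i => CFlag.ofGL (g i) :=
    measurable_pi_iff.2 fun i => CFlag.continuous_ofGL.measurable.comp (measurable_pi_apply i)
  have hsurj : Function.Surjective fun (g : Fin 4 → GL (Fin n) ℂ) i => CFlag.ofGL (g i) :=
    CFlag.ofGL_surjective.comp_left
  rw [← hf.measurable_comp_iff_of_surjective hsurj]
  have h : borelCocycle n ∘ (fun (g : Fin 4 → GL (Fin n) ℂ) i => CFlag.ofGL (g i)) =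
      fun g => ∑ J : Fin 4 → Fin n, flagVol (fun i => CFlag.ofGL (g i)) J := by
    funext g
    rfl
  rw [h]
  exact Finset.measurable_sum _ fun J _ => measurable_flagVol_ofGL J

end FlagManifold

end BorelCocycle

end

theorem theorem3 (n : ℕ) (hn : 2 ≤ n) :
    -- pulling back along affine flags is a morphism of complexes, `Vol` is a cocycle, and the
    -- pullback `borelAffine n` of `Vol` depends only on the underlying flags
    ((∀ (k : ℕ) (f : BorelCocycle.Config k → ℝ), BorelCocycle.IsAltConfig f →
        BorelCocycle.coboundary (BorelCocycle.pullT n f) =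
          BorelCocycle.pullT n (BorelCocycle.configD f)) ∧
      BorelCocycle.IsAltConfig BorelCocycle.Vol ∧
      BorelCocycle.configD BorelCocycle.Vol = 0 ∧
      ∀ A : Fin 4 → BorelCocycle.AffineFlag n,
        BorelCocycle.borelAffine n A =
          BorelCocycle.borelCocycle n fun i => (A i).toCFlag) ∧
    -- invariant, alternating, strict cocycle, Borel
    ((∀ (g : GL (Fin n) ℂ) (F : Fin 4 → BorelCocycle.CFlag n),
        BorelCocycle.borelCocycle n (fun i => g • F i) = BorelCocycle.borelCocycle n F) ∧
      (∀ (σ : Equiv.Perm (Fin 4)) (F : Fin 4 → BorelCocycle.CFlag n),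
        BorelCocycle.borelCocycle n (fun i => F (σ i)) =
          ((Equiv.Perm.sign σ : ℤ) : ℝ) * BorelCocycle.borelCocycle n F) ∧
      (∀ F : Fin 5 → BorelCocycle.CFlag n,
        BorelCocycle.coboundary (BorelCocycle.borelCocycle n) F = 0) ∧
      Measurable (BorelCocycle.borelCocycle n)) ∧
    -- the bound and the case of equality
    ∀ F : Fin 4 → BorelCocycle.CFlag n,
      |BorelCocycle.borelCocycle n F| ≤ (n : ℝ) * ((n : ℝ) ^ 2 - 1) / 6 * BorelCocycle.v3 ∧
      (|BorelCocycle.borelCocycle n F| = (n : ℝ) * ((n : ℝ) ^ 2 - 1) / 6 * BorelCocycle.v3 ↔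
        ∃ (g : GL (Fin n) ℂ) (ξ : Fin 4 → ℙ ℂ (Fin 2 → ℂ)),
          BorelCocycle.IsRegularIdealSimplex ξ ∧
            ∀ i, F i = g • BorelCocycle.veronese n (ξ i)) := by
  refine ⟨⟨fun k f hf => BorelCocycle.coboundary_pullT n f hf, BorelCocycle.isAltConfig_Vol,
    BorelCocycle.configD_Vol, BorelCocycle.borelAffine_eq⟩,
    ⟨BorelCocycle.borelCocycle_smul, BorelCocycle.borelCocycle_perm,
      BorelCocycle.coboundary_borelCocycle, BorelCocycle.measurable_borelCocycle n⟩,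
    fun F => ⟨BorelCocycle.abs_borelCocycle_le hn F, BorelCocycle.abs_borelCocycle_eq_iff hn F⟩⟩
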